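/- **Setting.** Let $n\ge 2$ and let $D$ be an oriented smooth $n$-dimensional Riemannian manifold with (possibly empty) boundary, with Riemannian volume form $\mathrm{vol}$ and Levi-Civita connection $\nabla$. Let $\mathrm{SVect}(D)$ be the smooth divergence-free vector fields on $D$ tangent to $\partial D$. For $X\in\mathrm{SVect}(D)$ and $[u]\in\Omega^1(D)/d\Omega^0(D)$ put $\mathcal L_X[u]=[\mathcal L_Xu]$, and write $v^\flat=\langle v,\cdot\rangle$. Families depend smoothly on parameters; two families of 1-forms define the same family in $\Omega^1(D)/d\Omega^0(D)$ if their difference is $d\psi$ with $\psi$ smooth in the parameters and the point. On $\mathrm{SVect}(D)$ use the Lie algebra bracket $[X,Y]$ of the group $\mathrm{SDiff}(D)$, i.e. minus the commutator of vector fields (for this sign $\langle \mathrm{ad}^*_Xm,Y\rangle=\langle m,[X,Y]\rangle$ gives $\mathrm{ad}^*_X=\mathcal L_X$). For a family $2\pi$-periodic in $\tau$ put $\bar f=\langle f\rangle=\frac1{2\pi}\int_0^{2\pi}f\,d\tau$, $\tilde f=f-\bar f$, and $\tilde f^\tau=\int_0^\tau\tilde f\,d\sigma-\big\langle\int_0^\tau\tilde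 f\,d\sigma\big\rangle$. A *two-timing solution* consists of expansions $\mu=\sum_k\epsilon^k\mu_k(s,\tau)$, with $\mu_k=[u_k]\in\Omega^1(D)/d\Omega^0(D)$, and $v=\sum_k\epsilon^kv_k(s,\tau)$, with $v_k\in\mathrm{SVect}(D)$, $2\pi$-periodic in the fast time $\tau$, which satisfy $$\tfrac1\epsilon\,\partial_\tau\mu+\epsilon\,\partial_s\mu=-\mathcal L_v\mu$$ in the orders $\epsilon^{-1},\epsilon^0,\epsilon^1,\epsilon^2$, with $\bar\mu_0=0$, $\bar v_0=0$ and $\tilde v_0$ independent of $s$. Its drift is $V_0=\big\langle\tfrac12[\tilde v_0,\tilde v_0^{\tau}]\big\rangle$. **Theorem 5.1 ($n$-dimensional Craik–Leibovich equation).** (1) (*Averaged equation.*) For every two-timing solution, $V_0$, $\bar v_1(s)$ and $\bar v_1(s)+V_0$ lie in $\mathrm{SVect}(D)$ (smoothly in $s$), and $$\frac{d}{ds}\bar\mu_1=-\mathcal L_{\bar v_1+V_0}\,\bar\mu_1 .$$ If $\bar\mu_1=[\bar v_1^\flat]$, then with $v=\bar v_1$ and $u=v^\flat$, $$\frac{d}{ds}[u]=-\mathcal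 L_{v+V_0}[u]\qquad\text{in }\Omega^1(D)/d\Omega^0(D).$$ (2) (*Free-boundary fluid.*) In particular, let $D$ be a domain in $\mathbb R^n$. Let $\eta=\sum_k\epsilon^k\eta_k(s,\tau)$ be a formal expansion, $2\pi$-periodic in $\tau$ and with $\eta_0$ an embedding independent of $\tau$, of volume-preserving embeddings $D\to\mathbb R^n$, and put $\dot\eta=\frac1\epsilon\partial_\tau\eta+\epsilon\,\partial_s\eta$. Let $a=\sum_k\epsilon^ka_k$, $a_k\in\mathrm{SVect}(D)$, be the connection term of the boundary motion, determined by the Hodge decomposition $\dot\eta=T\eta(a)+(\nabla\Phi)\circ\eta$ (to all orders in $\epsilon$). Let $w=\sum_k\epsilon^kw_k$ with $w_k\in\mathrm{SVect}(D)$. If $\mu=[w^\flat]$ and the fluid velocity $v=w-a$ form a two-timing solution, and $\bar\mu_1=[\bar v_1^\flat]$, then the averaged velocity $v=\bar v_1$ satisfies $\frac{d}{ds}[u]=-\mathcal L_{v+V_0}[u]$ with $u=v^\flat$. (3) (*Vector form.*) Let $v(t)\in\mathrm{SVect}(D)$ be a smooth family and $V_0\in\mathrm{SVect}(D)$. For each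 $t$ there is a unique smooth $(n-2)$-vector field $\mathrm{curl}\,v$ with $i_{\mathrm{curl}\,v}\mathrm{vol}=dv^\flat$, i.e. $\mathrm{vol}(\mathrm{curl}\,v\wedge y\wedge z)=dv^\flat(y,z)$. The equation $\frac{d}{dt}[v^\flat]=-\mathcal L_{v+V_0}[v^\flat]$ in $\Omega^1(D)/d\Omega^0(D)$ holds if and only if there is a smooth function $p(t,x)$ with $$v_t+\nabla_vv+\mathrm{curl}\,v\times V_0=-\nabla p ,$$ where $\mathrm{curl}\,v\times V_0=\star(\mathrm{curl}\,v\wedge V_0)$, i.e. $\langle\mathrm{curl}\,v\times V_0,y\rangle=\mathrm{vol}(\mathrm{curl}\,v\wedge V_0\wedge y)$ for all tangent vectors $y$. -/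

import Mathlib

open scoped Manifold ContDiff Bundle

noncomputable section

namespace CraikLeibovich

open VectorField

/-! ## Fields on an `n`-dimensional manifold with boundary

`D` is an `n`-dimensional manifold with boundary (modelled on the Euclidean half-space).  Vector
fields and covector fields are sections of the tangent and cotangent bundle. -/

/-- Sections of the tangent bundle. -/
abbrev VField (n : ℕ) [NeZero n] (D : Type*) [TopologicalSpace D]
    [ChartedSpace (EuclideanHalfSpace n) D] : Type _ :=
  Π x : D, TangentSpace (𝓡∂ n) x

/-- Sections of the cotangent bundle. -/
abbrev CField (n : ℕ) [NeZero n] (D : Type*) [TopologicalSpace D]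
    [ChartedSpace (EuclideanHalfSpace n) D] : Type _ :=
  Π x : D, TangentSpace (𝓡∂ n) x →L[ℝ] ℝ

/-- A family of real functions depending smoothly on a parameter `p : P` and on the point. -/
def SmoothFamily (n : ℕ) [NeZero n] {D : Type*} [TopologicalSpace D]
    [ChartedSpace (EuclideanHalfSpace n) D] {P : Type*} [NormedAddCommGroup P] [NormedSpace ℝ P]
    (f : P → D → ℝ) : Prop :=
  ContMDiff (𝓘(ℝ, P).prod (𝓡∂ n)) 𝓘(ℝ, ℝ) ∞ (fun q : P × D ↦ f q.1 q.2)

theorem SmoothFamily.slice {n : ℕ} [NeZero n] {D : Type*} [TopologicalSpace D]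
    [ChartedSpace (EuclideanHalfSpace n) D] {P : Type*} [NormedAddCommGroup P] [NormedSpace ℝ P]
    {f : P → D → ℝ} (hf : SmoothFamily n f) (p : P) :
    ContMDiff (𝓡∂ n) 𝓘(ℝ, ℝ) ∞ (f p) := by
  have h : ContMDiff (𝓡∂ n) (𝓘(ℝ, P).prod (𝓡∂ n)) ∞ (fun x : D ↦ (p, x)) :=
    contMDiff_const.prodMk contMDiff_id
  exact ContMDiff.comp (g := fun q : P × D ↦ f q.1 q.2) hf h

/-- The differential `df` of a function, as a 1-form. -/
def differential {n : ℕ} [NeZero n] {D : Type*} [TopologicalSpace D]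
    [ChartedSpace (EuclideanHalfSpace n) D] (f : D → ℝ) : CField n D :=
  fun x ↦ mvfderiv (𝓡∂ n) f x

section Basic

variable {n : ℕ} [NeZero n] {D : Type*} [TopologicalSpace D]
  [ChartedSpace (EuclideanHalfSpace n) D] [IsManifold (𝓡∂ n) ∞ D]
  {P : Type*} [NormedAddCommGroup P] [NormedSpace ℝ P]

/-- A smooth vector field. -/
def SmoothVField (X : VField n D) : Prop :=
  ContMDiff (𝓡∂ n) (𝓡∂ n).tangent ∞ (fun x ↦ (⟨x, X x⟩ : TangentBundle (𝓡∂ n) D))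

/-- A family of vector fields depending smoothly on a parameter `p : P` and on the point. -/
def SmoothVFamily (X : P → VField n D) : Prop :=
  ContMDiff (𝓘(ℝ, P).prod (𝓡∂ n)) (𝓡∂ n).tangent ∞
    (fun q : P × D ↦ (⟨q.2, X q.1 q.2⟩ : TangentBundle (𝓡∂ n) D))

/-- A smooth differential 1-form. -/
def SmoothCField (u : CField n D) : Prop :=
  ContMDiff (𝓡∂ n) ((𝓡∂ n).prod 𝓘(ℝ, EuclideanSpace ℝ (Fin n) →L[ℝ] ℝ)) ∞
    (fun x : D ↦ Bundle.TotalSpace.mk' (EuclideanSpace ℝ (Fin n) →L[ℝ] ℝ)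
      (E := fun x : D ↦ TangentSpace (𝓡∂ n) x →L[ℝ] ℝ) x (u x))

/-- A family of 1-forms depending smoothly on a parameter `p : P` and on the point. -/
def SmoothCFamily (u : P → CField n D) : Prop :=
  ContMDiff (𝓘(ℝ, P).prod (𝓡∂ n))
    ((𝓡∂ n).prod 𝓘(ℝ, EuclideanSpace ℝ (Fin n) →L[ℝ] ℝ)) ∞
    (fun q : P × D ↦ Bundle.TotalSpace.mk' (EuclideanSpace ℝ (Fin n) →L[ℝ] ℝ)
      (E := fun x : D ↦ TangentSpace (𝓡∂ n) x →L[ℝ] ℝ) q.2 (u q.1 q.2))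

theorem SmoothCField.mdiffAt_apply {u : CField n D} (hu : SmoothCField u) {Y : VField n D} {x : D}
    (hY : MDifferentiableAt (𝓡∂ n) (𝓡∂ n).tangent
      (fun x ↦ (⟨x, Y x⟩ : TangentBundle (𝓡∂ n) D)) x) :
    MDifferentiableAt (𝓡∂ n) 𝓘(ℝ, ℝ) (fun y ↦ u y (Y y)) x := by
  have h1 := (hu x).mdifferentiableAt (by simp)
  have := MDifferentiableAt.clm_bundle_apply (F₁ := EuclideanSpace ℝ (Fin n)) (F₂ := ℝ)
    (E₁ := fun x : D ↦ TangentSpace (𝓡∂ n) x) (E₂ := Bundle.Trivial D ℝ) (b := id)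
    (ϕ := u) (v := Y) (IB := 𝓡∂ n) (IM := 𝓡∂ n) h1 hY
  simp only [mdifferentiableAt_totalSpace] at this
  exact this.2

/-! ### Lie derivative and exterior derivative of 1-forms -/

/-- `(X, u, Y) ↦ X (u(Y)) - u([X, Y])` at the point `x`. -/
def lieDerivAux (X : VField n D) (u : CField n D) (x : D) (Y : VField n D) : ℝ :=
  mvfderiv (𝓡∂ n) (fun y ↦ u y (Y y)) x (X x) - u x (mlieBracket (𝓡∂ n) X Y x)

/-- `(u, Y, Z) ↦ Y (u(Z)) - Z (u(Y)) - u([Y, Z])` at the point `x`. -/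
def extDerivAux (u : CField n D) (x : D) (Y Z : VField n D) : ℝ :=
  mvfderiv (𝓡∂ n) (fun y ↦ u y (Z y)) x (Y x) - mvfderiv (𝓡∂ n) (fun y ↦ u y (Y y)) x (Z x)
    - u x (mlieBracket (𝓡∂ n) Y Z x)

theorem lieDerivAux_tensorial {X : VField n D} {u : CField n D} (hu : SmoothCField u) (x : D) :
    TensorialAt (𝓡∂ n) (EuclideanSpace ℝ (Fin n)) (lieDerivAux X u x) x where
  smul {f Y} hf hY := by
    have h1 : MDifferentiableAt (𝓡∂ n) 𝓘(ℝ, ℝ) (fun y ↦ u y (Y y)) x := hu.mdiffAt_apply hY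
    have e : (fun y ↦ u y ((f • Y) y)) = f * fun y ↦ u y (Y y) := by
      ext y; simp
    simp only [lieDerivAux, e, mvfderiv_mul hf h1, mlieBracket_smul_right hf hY]
    simp
    ring
  add {Y Z} hY hZ := by
    have h1 : MDifferentiableAt (𝓡∂ n) 𝓘(ℝ, ℝ) (fun y ↦ u y (Y y)) x := hu.mdiffAt_apply hY
    have h2 : MDifferentiableAt (𝓡∂ n) 𝓘(ℝ, ℝ) (fun y ↦ u y (Z y)) x := hu.mdiffAt_apply hZ
    have e : (fun y ↦ u y ((Y + Z) y)) = (fun y ↦ u y (Y y)) + fun y ↦ u y (Z y) := by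
      ext y; simp
    simp only [lieDerivAux, e, mvfderiv_add h1 h2, mlieBracket_add_right hY hZ]
    simp
    ring

set_option linter.unusedSectionVars false in
theorem extDerivAux_swap (u : CField n D) (x : D) (Y Z : VField n D) :
    extDerivAux u x Y Z = - extDerivAux u x Z Y := by
  simp only [extDerivAux]
  rw [mlieBracket_swap_apply, map_neg]
  ring

theorem extDerivAux_tensorial_right {u : CField n D} (hu : SmoothCField u) (x : D)
    (Y : VField n D) :
    TensorialAt (𝓡∂ n) (EuclideanSpace ℝ (Fin n)) (extDerivAux u x Y) x where
  smul {f Z} hf hZ := by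
    have h1 : MDifferentiableAt (𝓡∂ n) 𝓘(ℝ, ℝ) (fun y ↦ u y (Z y)) x := hu.mdiffAt_apply hZ
    have e : (fun y ↦ u y ((f • Z) y)) = f * fun y ↦ u y (Z y) := by
      ext y; simp
    simp only [extDerivAux, e, mvfderiv_mul hf h1, mlieBracket_smul_right hf hZ]
    simp
    ring
  add {Z W} hZ hW := by
    have h1 : MDifferentiableAt (𝓡∂ n) 𝓘(ℝ, ℝ) (fun y ↦ u y (Z y)) x := hu.mdiffAt_apply hZ
    have h2 : MDifferentiableAt (𝓡∂ n) 𝓘(ℝ, ℝ) (fun y ↦ u y (W y)) x := hu.mdiffAt_apply hW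
    have e : (fun y ↦ u y ((Z + W) y)) = (fun y ↦ u y (Z y)) + fun y ↦ u y (W y) := by
      ext y; simp
    simp only [extDerivAux, e, mvfderiv_add h1 h2, mlieBracket_add_right hZ hW]
    simp
    ring

theorem extDerivAux_tensorial_left {u : CField n D} (hu : SmoothCField u) (x : D)
    (Z : VField n D) :
    TensorialAt (𝓡∂ n) (EuclideanSpace ℝ (Fin n)) (fun Y ↦ extDerivAux u x Y Z) x where
  smul {f Y} hf hY := by
    simp only [extDerivAux_swap u x _ Z]
    rw [(extDerivAux_tensorial_right hu x Z).smul hf hY]; simp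
  add {Y W} hY hW := by
    simp only [extDerivAux_swap u x _ Z]
    rw [(extDerivAux_tensorial_right hu x Z).add hY hW]; ring

open Classical in
/-- The Lie derivative `𝓛_X u` of a 1-form `u` along a vector field `X`: the covector field with
`(𝓛_X u)(Y) = X (u(Y)) - u([X, Y])` for all vector fields `Y`.  The condition of the `if` says that
the right hand side at `x` depends on `Y` through `Y x` alone; it holds for every smooth `u`. -/
def lieDeriv (X : VField n D) (u : CField n D) : CField n D := fun x ↦
  if h : TensorialAt (𝓡∂ n) (EuclideanSpace ℝ (Fin n)) (lieDerivAux X u x) x then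
    TensorialAt.mkHom (lieDerivAux X u x) x h
  else 0

theorem lieDeriv_apply {X Y : VField n D} {u : CField n D} (hu : SmoothCField u) {x : D}
    (hY : MDifferentiableAt (𝓡∂ n) (𝓡∂ n).tangent
      (fun x ↦ (⟨x, Y x⟩ : TangentBundle (𝓡∂ n) D)) x) :
    lieDeriv X u x (Y x) =
      mvfderiv (𝓡∂ n) (fun y ↦ u y (Y y)) x (X x) - u x (mlieBracket (𝓡∂ n) X Y x) := by
  rw [lieDeriv, dif_pos (lieDerivAux_tensorial hu x)]
  exact TensorialAt.mkHom_apply _ hY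

open Classical in
/-- The exterior derivative `du` of a 1-form `u`: the 2-form with
`du(Y, Z) = Y (u(Z)) - Z (u(Y)) - u([Y, Z])` for all vector fields `Y`, `Z`.  The condition of the
`if` holds for every smooth `u`. -/
def extDeriv₁ (u : CField n D) (x : D) :
    TangentSpace (𝓡∂ n) x →L[ℝ] TangentSpace (𝓡∂ n) x →L[ℝ] ℝ :=
  if h : (∀ Z : VField n D, MDifferentiableAt (𝓡∂ n) (𝓡∂ n).tangent
        (fun x ↦ (⟨x, Z x⟩ : TangentBundle (𝓡∂ n) D)) x →
        TensorialAt (𝓡∂ n) (EuclideanSpace ℝ (Fin n)) (fun Y ↦ extDerivAux u x Y Z) x) ∧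
      (∀ Y : VField n D, MDifferentiableAt (𝓡∂ n) (𝓡∂ n).tangent
        (fun x ↦ (⟨x, Y x⟩ : TangentBundle (𝓡∂ n) D)) x →
        TensorialAt (𝓡∂ n) (EuclideanSpace ℝ (Fin n)) (extDerivAux u x Y) x) then
    TensorialAt.mkHom₂ (extDerivAux u x) x h.1 h.2
  else 0

theorem extDeriv₁_apply {Y Z : VField n D} {u : CField n D} (hu : SmoothCField u) {x : D}
    (hY : MDifferentiableAt (𝓡∂ n) (𝓡∂ n).tangent
      (fun x ↦ (⟨x, Y x⟩ : TangentBundle (𝓡∂ n) D)) x)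
    (hZ : MDifferentiableAt (𝓡∂ n) (𝓡∂ n).tangent
      (fun x ↦ (⟨x, Z x⟩ : TangentBundle (𝓡∂ n) D)) x) :
    extDeriv₁ u x (Y x) (Z x) =
      mvfderiv (𝓡∂ n) (fun y ↦ u y (Z y)) x (Y x) - mvfderiv (𝓡∂ n) (fun y ↦ u y (Y y)) x (Z x)
        - u x (mlieBracket (𝓡∂ n) Y Z x) := by
  rw [extDeriv₁, dif_pos ⟨fun Z _ ↦ extDerivAux_tensorial_left hu x Z,
    fun Y _ ↦ extDerivAux_tensorial_right hu x Y⟩]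
  exact TensorialAt.mkHom₂_apply _ _ hY hZ

/-! ### The space `Ω¹(D)/dΩ⁰(D)` -/

/-- Families `α(p) = dψ(p)` of exact 1-forms, with a potential `ψ` that is smooth in the parameter
`p` and in the point. -/
def exactForms (n : ℕ) [NeZero n] (D : Type*) [TopologicalSpace D]
    [ChartedSpace (EuclideanHalfSpace n) D] (P : Type*) [NormedAddCommGroup P] [NormedSpace ℝ P] :
    Submodule ℝ (P → CField n D) where
  carrier := {α | ∃ ψ : P → D → ℝ, SmoothFamily n ψ ∧ ∀ p, α p = differential (ψ p)}
  add_mem' := by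
    rintro α β ⟨ψ, hψ, hα⟩ ⟨φ, hφ, hβ⟩
    refine ⟨fun p x ↦ ψ p x + φ p x, hψ.add hφ, fun p ↦ ?_⟩
    funext x
    have h1 := (hψ.slice p x).mdifferentiableAt (by simp)
    have h2 := (hφ.slice p x).mdifferentiableAt (by simp)
    simp only [Pi.add_apply, hα, hβ, differential]
    exact (mvfderiv_add h1 h2).symm
  zero_mem' := ⟨fun _ _ ↦ 0, contMDiff_const, fun p ↦ by
    funext x; simp [differential, mvfderiv_const]⟩
  smul_mem' := by
    rintro c α ⟨ψ, hψ, hα⟩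
    refine ⟨fun p x ↦ c * ψ p x, contMDiff_const.mul hψ, fun p ↦ ?_⟩
    funext x
    have h1 := (hψ.slice p x).mdifferentiableAt (by simp)
    have h2 := mvfderiv_mul (mdifferentiableAt_const (c := c)) h1
    simp only [Pi.smul_apply, hα, differential]
    refine Eq.trans ?_ h2.symm
    ext y
    simp [mvfderiv_const]

/-- The class `[u]` of a family of 1-forms in `Ω¹(D)/dΩ⁰(D)`.  With `P = ℝ` (time), this is a smooth
curve in `Ω¹(D)/dΩ⁰(D)`. -/
def cls (u : P → CField n D) : (P → CField n D) ⧸ exactForms n D P :=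
  Submodule.Quotient.mk u

/-- The time derivative of a family of 1-forms, at each point of `D`. -/
def timeDerivC (u : ℝ → CField n D) : ℝ → CField n D := fun t x ↦
  deriv (F := EuclideanSpace ℝ (Fin n) →L[ℝ] ℝ) (fun r ↦ u r x) t

/-- The time derivative of a family of vector fields, at each point of `D`. -/
def timeDerivV (X : ℝ → VField n D) : ℝ → VField n D := fun t x ↦
  deriv (F := EuclideanSpace ℝ (Fin n)) (fun r ↦ X r x) t

/-- The equation `d[u]/ds = -𝓛_w [u]` in `Ω¹(D)/dΩ⁰(D)`, where `𝓛_w [u] = [𝓛_w u]`. -/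
def IsAdvected (w : ℝ → VField n D) (u : ℝ → CField n D) : Prop :=
  cls (timeDerivC u) = - cls (fun s ↦ lieDeriv (w s) (u s))

/-! ### Averages over the fast time -/

/-- The average of a `2π`-periodic family of vector fields. -/
def avgV (X : ℝ → VField n D) : VField n D := fun x ↦
  (2 * Real.pi)⁻¹ • intervalIntegral (E := EuclideanSpace ℝ (Fin n))
    (fun τ ↦ X τ x) 0 (2 * Real.pi) MeasureTheory.volume

/-- The average of a `2π`-periodic family of 1-forms. -/
def avgC (u : ℝ → CField n D) : CField n D := fun x ↦
  (2 * Real.pi)⁻¹ • intervalIntegral (E := EuclideanSpace ℝ (Fin n) →L[ℝ] ℝ)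
    (fun τ ↦ u τ x) 0 (2 * Real.pi) MeasureTheory.volume

/-- The oscillating part `X̃ = X - X̄`. -/
def oscillating (X : ℝ → VField n D) : ℝ → VField n D := fun τ ↦ X τ - avgV X

/-- The primitive `X^τ = ∫₀^τ X dσ - (average of ∫₀^τ X dσ)`. -/
def oscPrimitive (X : ℝ → VField n D) : ℝ → VField n D :=
  let Y : ℝ → VField n D := fun τ x ↦ intervalIntegral (E := EuclideanSpace ℝ (Fin n))
    (fun σ ↦ X σ x) 0 τ MeasureTheory.volume
  fun τ ↦ Y τ - avgV Y

/-- The bracket of the Lie algebra `SVect(D)` of the group `SDiff(D)`: minus the commutator of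
vector fields.  This is the sign for which `⟨ad*_X m, Y⟩ = ⟨m, [X, Y]⟩` gives `ad*_X = 𝓛_X`
on `Ω¹(D)/dΩ⁰(D)`. -/
def adBracket (X Y : VField n D) : VField n D := - mlieBracket (𝓡∂ n) X Y

/-- The drift `V₀ = ½ ⟨[ṽ, ṽ^τ]⟩`, the average being over the fast time. -/
def stokesDrift (v : ℝ → VField n D) : VField n D :=
  avgV (fun τ ↦ (1 / 2 : ℝ) • adBracket (oscillating v τ) (oscPrimitive (oscillating v) τ))

/-- The derivative in the fast time `τ` of a family depending on `(s, τ)`. -/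
def fastDeriv (u : ℝ × ℝ → CField n D) : ℝ × ℝ → CField n D := fun p ↦
  timeDerivC (fun τ ↦ u (p.1, τ)) p.2

/-- The derivative in the slow time `s` of a family depending on `(s, τ)`. -/
def slowDeriv (u : ℝ × ℝ → CField n D) : ℝ × ℝ → CField n D := fun p ↦
  timeDerivC (fun s ↦ u (s, p.2)) p.1

end Basic

/-! ## Riemannian geometry -/

section Riemannian

variable {n : ℕ} [NeZero n] {D : Type*} [TopologicalSpace D]
  [ChartedSpace (EuclideanHalfSpace n) D] [IsManifold (𝓡∂ n) ∞ D]
  [Bundle.RiemannianBundle (fun x : D ↦ TangentSpace (𝓡∂ n) x)]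
  {P : Type*} [NormedAddCommGroup P] [NormedSpace ℝ P]

/-- The 1-form `v♭ = ⟨v, ·⟩`. -/
def flat (v : VField n D) : CField n D := fun x ↦ innerSL ℝ (v x)

/-- The tangent vector `α♯` with `⟨α♯, y⟩ = α(y)`. -/
def sharp {x : D} (α : TangentSpace (𝓡∂ n) x →ₗ[ℝ] ℝ) : TangentSpace (𝓡∂ n) x :=
  haveI : FiniteDimensional ℝ (TangentSpace (𝓡∂ n) x) :=
    inferInstanceAs (FiniteDimensional ℝ (EuclideanSpace ℝ (Fin n)))
  haveI : CompleteSpace (TangentSpace (𝓡∂ n) x) := FiniteDimensional.complete ℝ _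
  (InnerProductSpace.toDual ℝ (TangentSpace (𝓡∂ n) x)).symm (LinearMap.toContinuousLinearMap α)

set_option linter.unusedSectionVars false in
theorem inner_sharp {x : D} (α : TangentSpace (𝓡∂ n) x →ₗ[ℝ] ℝ) (y : TangentSpace (𝓡∂ n) x) :
    inner ℝ (sharp α) y = α y := by
  have : FiniteDimensional ℝ (TangentSpace (𝓡∂ n) x) :=
    inferInstanceAs (FiniteDimensional ℝ (EuclideanSpace ℝ (Fin n)))
  have : CompleteSpace (TangentSpace (𝓡∂ n) x) := FiniteDimensional.complete ℝ _
  simp [sharp]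

/-- The gradient of a function. -/
def gradient (p : D → ℝ) : VField n D := fun x ↦ 
  sharp ((differential p x : TangentSpace (𝓡∂ n) x →L[ℝ] ℝ) : TangentSpace (𝓡∂ n) x →ₗ[ℝ] ℝ)

/-- A field of alternating `n`-linear forms. -/
abbrev TopForm (n : ℕ) [NeZero n] (D : Type*) [TopologicalSpace D]
    [ChartedSpace (EuclideanHalfSpace n) D] : Type _ :=
  Π x : D, TangentSpace (𝓡∂ n) x [⋀^Fin n]→ₗ[ℝ] ℝ

/-- `ν` is the Riemannian volume form of an orientation of `D`: a smooth `n`-form with values `±1`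
on orthonormal bases. -/
structure IsVolumeForm (ν : TopForm n D) : Prop where
  unit : ∀ (x : D) (b : OrthonormalBasis (Fin n) ℝ (TangentSpace (𝓡∂ n) x)), |ν x b| = 1
  smooth : ∀ Y : Fin n → VField n D, (∀ i, SmoothVField (Y i)) →
    ContMDiff (𝓡∂ n) 𝓘(ℝ, ℝ) ∞ (fun x ↦ ν x (fun i ↦ Y i x))

/-- Membership in `SVect(D)`: smooth vector fields that are divergence-free (`𝓛_X ν = 0`) and
tangent to the boundary (they annihilate, at the boundary, the functions vanishing on it). -/
structure IsSVect (ν : TopForm n D) (X : VField n D) : Prop where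
  smooth : SmoothVField X
  div_free : ∀ Y : Fin n → VField n D, (∀ i, SmoothVField (Y i)) → ∀ x : D,
    mvfderiv (𝓡∂ n) (fun y ↦ ν y (fun i ↦ Y i y)) x (X x) =
      ∑ i, ν x (Function.update (fun j ↦ Y j x) i (mlieBracket (𝓡∂ n) X (Y i) x))
  tangent : ∀ f : D → ℝ, ContMDiff (𝓡∂ n) 𝓘(ℝ, ℝ) ∞ f →
    (∀ y ∈ (𝓡∂ n).boundary D, f y = 0) →
    ∀ x ∈ (𝓡∂ n).boundary D, mvfderiv (𝓡∂ n) f x (X x) = 0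

/-- A smooth family of elements of `SVect(D)`. -/
structure IsSVectFamily (ν : TopForm n D) (X : P → VField n D) : Prop where
  smooth : SmoothVFamily X
  mem : ∀ p, IsSVect ν (X p)

/-! ### Multivector fields, curl and cross product -/

/-- The value `ν(y₁ ∧ ⋯ ∧ y_n) = ν(y₁, …, y_n)` of an `n`-form on multivectors (zero in degrees
other than `n`). -/
def pair {x : D} (ν : TangentSpace (𝓡∂ n) x [⋀^Fin n]→ₗ[ℝ] ℝ) :
    ExteriorAlgebra ℝ (TangentSpace (𝓡∂ n) x) →ₗ[ℝ] ℝ :=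
  ExteriorAlgebra.liftAlternating (Pi.single n ν)

set_option linter.unusedSectionVars false in
theorem pair_ιMulti {x : D} (ν : TangentSpace (𝓡∂ n) x [⋀^Fin n]→ₗ[ℝ] ℝ)
    (y : Fin n → TangentSpace (𝓡∂ n) x) : pair ν (ExteriorAlgebra.ιMulti ℝ n y) = ν y := by
  simp [pair]

/-- Fields of `k`-vectors. -/
abbrev MultiVField (n : ℕ) [NeZero n] (D : Type*) [TopologicalSpace D]
    [ChartedSpace (EuclideanHalfSpace n) D] (k : ℕ) : Type _ :=
  Π x : D, ⋀[ℝ]^k (TangentSpace (𝓡∂ n) x)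

/-- A smooth `k`-vector field: its pairing with smooth 1-forms `α₁ ∧ ⋯ ∧ α_k` is smooth. -/
def SmoothMultiVField {k : ℕ} (c : MultiVField n D k) : Prop :=
  ∀ α : Fin k → CField n D, (∀ i, SmoothCField (α i)) →
    ContMDiff (𝓡∂ n) 𝓘(ℝ, ℝ) ∞ (fun x ↦
      exteriorPower.pairingDual ℝ (TangentSpace (𝓡∂ n) x) k
        (exteriorPower.ιMulti ℝ k fun i ↦ (α i x : TangentSpace (𝓡∂ n) x →ₗ[ℝ] ℝ)) (c x))

/-- `c = curl v`: the smooth `(n-2)`-vector field with `i_c ν = d(v♭)`, where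
`(i_c ν)(y, z) = ν(c ∧ y ∧ z)`. -/
structure IsCurl (ν : TopForm n D) (v : VField n D) (c : MultiVField n D (n - 2)) : Prop where
  smooth : SmoothMultiVField c
  interior : ∀ (x : D) (y z : TangentSpace (𝓡∂ n) x),
    pair (ν x) ((c x : ExteriorAlgebra ℝ (TangentSpace (𝓡∂ n) x)) * ExteriorAlgebra.ι ℝ y *
      ExteriorAlgebra.ι ℝ z) = extDeriv₁ (flat v) x y z

/-- The Hodge star of an `(n-1)`-vector `w`: the vector `⋆w` with `⟨⋆w, y⟩ = ν(w ∧ y)`. -/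
def hodgeStar (ν : TopForm n D) {x : D} (w : ExteriorAlgebra ℝ (TangentSpace (𝓡∂ n) x)) :
    TangentSpace (𝓡∂ n) x :=
  sharp ((pair (ν x)).comp ((LinearMap.mulLeft ℝ w).comp (ExteriorAlgebra.ι ℝ)))

/-- The cross product `c × w = ⋆(c ∧ w)` of an `(n-2)`-vector field and a vector field. -/
def cross (ν : TopForm n D) (c : MultiVField n D (n - 2)) (w : VField n D) : VField n D := fun x ↦
  hodgeStar ν ((c x : ExteriorAlgebra ℝ (TangentSpace (𝓡∂ n) x)) * ExteriorAlgebra.ι ℝ (w x))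

/-- `nabla` is the Levi-Civita connection of the metric. -/
structure IsLeviCivita
    [IsContMDiffRiemannianBundle (𝓡∂ n) ∞ (EuclideanSpace ℝ (Fin n))
      (fun x : D ↦ TangentSpace (𝓡∂ n) x)]
    (nabla : CovariantDerivative (𝓡∂ n) (EuclideanSpace ℝ (Fin n))
      (fun x : D ↦ TangentSpace (𝓡∂ n) x)) : Prop where
  metric :
    haveI : IsContMDiffRiemannianBundle (𝓡∂ n) 1 (EuclideanSpace ℝ (Fin n))
      (fun x : D ↦ TangentSpace (𝓡∂ n) x) := IsContMDiffRiemannianBundle.of_le (n := ∞) (by simp)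
    nabla.IsMetricCompatible
  torsion_free : nabla.torsion = 0

/-- `v_t + ∇_v v + curl v × V₀ = -∇p` for some pressure `p`, where `c t = curl (v t)`. -/
def IsCLSolution (ν : TopForm n D)
    (nabla : CovariantDerivative (𝓡∂ n) (EuclideanSpace ℝ (Fin n))
      (fun x : D ↦ TangentSpace (𝓡∂ n) x))
    (c : ℝ → MultiVField n D (n - 2)) (v : ℝ → VField n D) (V₀ : VField n D) : Prop :=
  ∃ p : ℝ → D → ℝ, SmoothFamily n p ∧ ∀ (t : ℝ) (x : D),
    timeDerivV v t x + nabla (v t) x (v t x) + cross ν (c t) V₀ x = - gradient (p t) x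

/-! ### Two-timing expansions -/

/-- Two-timing expansions `μ = μ₀ + ε μ₁ + ε² μ₂ + ε³ μ₃ + ⋯` (with `μ_k = [u k]` in
`Ω¹(D)/dΩ⁰(D)`) and `v = v₀ + ε v₁ + ε² v₂ + ⋯` (in `SVect(D)`), `2π`-periodic in the fast time
`τ`, which satisfy
`(1/ε) ∂_τ μ + ε ∂_s μ = -𝓛_v μ`
in the orders `ε⁻¹, ε⁰, ε¹, ε²`, with `μ̄₀ = 0`, `v̄₀ = 0`, and `ṽ₀` independent of the slow time.
Families depend on the point `p = (s, τ)`. -/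
structure IsTwoTimingSolution (ν : TopForm n D) (u : ℕ → ℝ × ℝ → CField n D)
    (v : ℕ → ℝ × ℝ → VField n D) : Prop where
  smooth_u : ∀ k ≤ 3, SmoothCFamily (u k)
  mem_v : ∀ k ≤ 2, IsSVectFamily ν (v k)
  periodic_u : ∀ k ≤ 3, cls (fun p : ℝ × ℝ ↦ u k (p.1, p.2 + 2 * Real.pi)) = cls (u k)
  periodic_v : ∀ k ≤ 2, ∀ s τ, v k (s, τ + 2 * Real.pi) = v k (s, τ)
  order_neg_one : cls (fastDeriv (u 0)) = 0
  order_zero : cls (fastDeriv (u 1)) = - cls (fun p ↦ lieDeriv (v 0 p) (u 0 p))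
  order_one : cls (fastDeriv (u 2)) + cls (slowDeriv (u 0)) =
    - (cls (fun p ↦ lieDeriv (v 0 p) (u 1 p)) + cls (fun p ↦ lieDeriv (v 1 p) (u 0 p)))
  order_two : cls (fastDeriv (u 3)) + cls (slowDeriv (u 1)) =
    - (cls (fun p ↦ lieDeriv (v 0 p) (u 2 p)) + cls (fun p ↦ lieDeriv (v 1 p) (u 1 p))
      + cls (fun p ↦ lieDeriv (v 2 p) (u 0 p)))
  avg_u_zero : cls (fun s : ℝ ↦ avgC (fun τ ↦ u 0 (s, τ))) = 0
  avg_v_zero : ∀ s, avgV (fun τ ↦ v 0 (s, τ)) = 0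
  osc_v_indep : ∀ s s', oscillating (fun τ ↦ v 0 (s, τ)) = oscillating (fun τ ↦ v 0 (s', τ))

/-- The averaged first order velocity `v̄₁(s)`. -/
def avgVelocity (v : ℕ → ℝ × ℝ → VField n D) : ℝ → VField n D := fun s ↦
  avgV (fun τ ↦ v 1 (s, τ))

/-- The averaged first order momentum `μ̄₁(s)`. -/
def avgMomentum (u : ℕ → ℝ × ℝ → CField n D) : ℝ → CField n D := fun s ↦
  avgC (fun τ ↦ u 1 (s, τ))

/-- The drift `V₀ = ½ ⟨[ṽ₀, ṽ₀^τ]⟩` of an expansion (`ṽ₀` does not depend on `s`). -/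
def drift (v : ℕ → ℝ × ℝ → VField n D) : VField n D :=
  stokesDrift (fun τ ↦ v 0 (0, τ))

/-! ### The fluid with a free boundary -/

/-- `ι` realizes `D` as a domain in `ℝⁿ`, with its Euclidean metric and volume form. -/
structure IsEuclideanDomain (ν : TopForm n D) (ι : D → EuclideanSpace ℝ (Fin n)) : Prop where
  smooth : ContMDiff (𝓡∂ n) 𝓘(ℝ, EuclideanSpace ℝ (Fin n)) ∞ ι
  embedding : Topology.IsEmbedding ι
  isometry : ∀ (x : D) (y z : TangentSpace (𝓡∂ n) x),
    inner ℝ (mvfderiv (𝓡∂ n) ι x y) (mvfderiv (𝓡∂ n) ι x z) = inner ℝ y z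
  volume : ∀ (x : D) (y : Fin n → TangentSpace (𝓡∂ n) x),
    (EuclideanSpace.basisFun (Fin n) ℝ).toBasis.det (fun i ↦ mvfderiv (𝓡∂ n) ι x (y i)) = ν x y

/-- The coefficient of `ε^m` in `(1/ε) ∂_τ η + ε ∂_s η`, for `η = Σ ε^k η_k` and `m ≥ 0`. -/
def embeddingVelocity (η : ℕ → ℝ × ℝ → D → EuclideanSpace ℝ (Fin n)) (m : ℕ) (p : ℝ × ℝ)
    (x : D) : EuclideanSpace ℝ (Fin n) :=
  deriv (fun τ ↦ η (m + 1) (p.1, τ) x) p.2 +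
    if m = 0 then 0 else deriv (fun s ↦ η (m - 1) (s, p.2) x) p.1

/-- The motion of the free boundary and its connection term.  `η = Σ ε^k η_k` is a two-timing
expansion of volume-preserving embeddings `D → ℝⁿ`; at each time, `η` is the value at the boundary
`Σ = η(∂D)` of the local section of the bundle of embeddings over the manifold of boundaries.
`a = Σ ε^k a_k` is the value of the connection on the velocity `η̇`, pulled back to `D`: the
divergence-free component, tangent to the boundary, of the Hodge decomposition
`η̇ = Tη(a) + (∇Φ) ∘ η`, where `Φ` is then the harmonic function whose normal derivative is the
normal velocity of the boundary.  The decomposition is expressed on `D`: `⟨η̇ - Tη(a), Tη(·)⟩` is the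
exact form `d(Φ ∘ η)`. -/
structure IsFreeBoundaryMotion (ν : TopForm n D)
    (η : ℕ → ℝ × ℝ → D → EuclideanSpace ℝ (Fin n)) (a : ℕ → ℝ × ℝ → VField n D) : Prop where
  smooth : ∀ k, ContMDiff (𝓘(ℝ, ℝ × ℝ).prod (𝓡∂ n)) 𝓘(ℝ, EuclideanSpace ℝ (Fin n)) ∞
    (fun q : (ℝ × ℝ) × D ↦ η k q.1 q.2)
  periodic : ∀ k s τ, η k (s, τ + 2 * Real.pi) = η k (s, τ)
  embedding : ∀ p, Topology.IsEmbedding (η 0 p)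
  leading : ∀ s τ τ', η 0 (s, τ) = η 0 (s, τ')
  volume : ∀ (m : ℕ) (p : ℝ × ℝ) (x : D) (y : Fin n → TangentSpace (𝓡∂ n) x),
    ∑ k ∈ Finset.piAntidiag (Finset.univ : Finset (Fin n)) m,
      (EuclideanSpace.basisFun (Fin n) ℝ).toBasis.det
        (fun i ↦ mvfderiv (𝓡∂ n) (η (k i) p) x (y i)) = if m = 0 then ν x y else 0
  mem_a : ∀ k, IsSVectFamily ν (a k)
  hodge : ∀ m : ℕ, cls (fun (p : ℝ × ℝ) (x : D) ↦
    ∑ i ∈ Finset.HasAntidiagonal.antidiagonal m,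
      (innerSL ℝ (embeddingVelocity η i.1 p x -
        ∑ k ∈ Finset.HasAntidiagonal.antidiagonal i.1, mvfderiv (𝓡∂ n) (η k.1 p) x (a k.2 p x))).comp
        (mvfderiv (𝓡∂ n) (η i.2 p) x)) = 0

end Riemannian

end CraikLeibovich

/-! Averaging. The orders are solved one at a time modulo exact families. Order `ε⁻¹` together with
the vanishing mean makes `u 0` exact. Hence `𝓛_{v₀} u₀` is exact, and order `ε⁰` says that `u 1`
agrees with its mean `m(s)`. Order `ε¹` then reduces to `∂_τ u₂ = -𝓛_{v₀} m`, so `u₂ = u₂(s, 0) -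
𝓛_V m` with `V = ∫₀^τ v₀` (`IsTwoTimingSolution.u_two_sub_mem`). Order `ε²` is averaged over a
period: `∂_τ u₃` disappears because the class of `u 3` is periodic, the unknown `u₂(s, 0)`
disappears because `v₀` has mean zero, and what survives is `∂_s m + 𝓛_{v̄₁} m - ⟨𝓛_{v₀} 𝓛_V m⟩ =
0`.

The drift comes from `avgC_lieDeriv_lieDeriv`. Split `𝓛_v 𝓛_V` into its symmetric and antisymmetric
halves. The symmetric half is half the `τ`-derivative of `𝓛_V 𝓛_V`, which integrates to zero because
`V` vanishes at both ends of the period. The antisymmetric half is half the Lie derivative along the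
commutator of `v` and `V` (`lieDeriv_commutator`). With the sign of the group bracket its average is
`-𝓛_{V₀}`. Replacing `V` by its mean-free version changes nothing, again because `v` has mean zero.
The free-boundary statement is the instance `u = w♭`, `v = w - a`.

Vector form. One has `𝓛_v v♭ = (∇_v v)♭ + ½ d|v|²` for the Levi-Civita connection and `𝓛_{V₀} v♭ =
i_{V₀} dv♭ + d⟨v, V₀⟩` by Cartan's formula, while `i_{V₀} dv♭ = (curl v × V₀)♭` by the definition of
the curl. The advection form and the Craik–Leibovich left-hand side thus differ by the differential
of an explicit smooth function (`advection_apply`). The curl exists because every alternating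
bilinear form is an interior product of the volume form (`exists_interior_expansion`). It is unique
because `⋀^(n-2)` and the dual of `⋀²` have equal dimension (`interiorForm_injective`).

The analytic burden is that "exact" demands potentials smooth in parameters and point jointly, up to
the boundary. Lie derivatives, parameter derivatives and integrals must therefore preserve smooth
families and commute where needed. Fields are tested on smooth functions and forms on smooth vector
fields, which reduces these facts to differentiation under the integral sign for functions. -/

namespace CraikLeibovich

open VectorField

/-! ### Differentiation under the integral sign over a convex set -/

section ParametricIntegral

open Set MeasureTheory Topology

/-- Compactness of `[0, 1]` makes `f' r w` close to `f' r w₀` uniformly in `r`, and the mean value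
inequality on the convex set `K ∩ ball` turns this into a uniform estimate of the remainder.
Derivatives within `K` are needed because `K` will be a piece of a half-space. -/
theorem hasFDerivWithinAt_intervalIntegral {W F : Type} [NormedAddCommGroup W] [NormedSpace ℝ W]
    [NormedAddCommGroup F] [NormedSpace ℝ F] [CompleteSpace F] {K : Set W} (hK : Convex ℝ K)
    {f : ℝ → W → F} {f' : ℝ → W → W →L[ℝ] F}
    (hf : ContinuousOn (Function.uncurry f) (univ ×ˢ K))
    (hf' : ContinuousOn (Function.uncurry f') (univ ×ˢ K))
    (h : ∀ r, ∀ w ∈ K, HasFDerivWithinAt (f r) (f' r w) K w) {w₀ : W} (hw₀ : w₀ ∈ K) :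
    HasFDerivWithinAt (fun w ↦ ∫ r in (0:ℝ)..1, f r w) (∫ r in (0:ℝ)..1, f' r w₀) K w₀ := by
  have slice {G : Type} [NormedAddCommGroup G] {g : ℝ → W → G}
      (hg : ContinuousOn (Function.uncurry g) (univ ×ˢ K)) {w : W} (hw : w ∈ K) :
      Continuous fun r ↦ g r w := by
    rw [← continuousOn_univ]
    exact hg.comp (f := fun r : ℝ ↦ (r, w)) (by fun_prop) fun r _ ↦ ⟨mem_univ _, hw⟩
  rw [hasFDerivWithinAt_iff_isLittleO, Asymptotics.isLittleO_iff]
  intro ε hε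
  -- Tube lemma: one neighbourhood of `w₀` in `K` serves all `r ∈ [0, 1]`.
  obtain ⟨v, hv, hvε⟩ := isCompact_Icc (a := (0 : ℝ)) (b := 1) |>.mem_uniformity_of_prod
    (f := fun w r ↦ f' r w) (s := K)
    (hf'.comp (f := Prod.swap) continuous_swap.continuousOn fun p hp ↦ ⟨mem_univ _, hp.1⟩)
    hw₀ (Metric.dist_mem_uniformity hε)
  obtain ⟨δ, hδ, hball⟩ := Metric.mem_nhdsWithin_iff.1 hv
  filter_upwards [self_mem_nhdsWithin, mem_nhdsWithin_of_mem_nhds (Metric.ball_mem_nhds w₀ hδ)]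
    with w hw hwδ
  have e : (∫ r in (0:ℝ)..1, f r w) - (∫ r in (0:ℝ)..1, f r w₀)
      - (∫ r in (0:ℝ)..1, f' r w₀) (w - w₀)
      = ∫ r in (0:ℝ)..1, (f r w - f r w₀ - f' r w₀ (w - w₀)) := by
    rw [intervalIntegral.integral_sub, intervalIntegral.integral_sub,
      ContinuousLinearMap.intervalIntegral_apply]
    · exact (slice hf' hw₀).intervalIntegrable _ _
    · exact (slice hf hw).intervalIntegrable _ _
    · exact (slice hf hw₀).intervalIntegrable _ _
    · exact ((slice hf hw).sub (slice hf hw₀)).intervalIntegrable _ _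
    · exact ((slice hf' hw₀).clm_apply continuous_const).intervalIntegrable _ _
  rw [e]
  refine (intervalIntegral.norm_integral_le_of_norm_le_const (C := ε * ‖w - w₀‖) ?_).trans
    (by simp)
  intro r hr
  rw [uIoc_of_le zero_le_one] at hr
  refine (hK.inter (convex_ball w₀ δ)).norm_image_sub_le_of_norm_hasFDerivWithin_le'
    (f' := fun w ↦ f' r w)
    (fun y hy ↦ (h r y hy.1).mono inter_subset_left) (fun y hy ↦ ?_)
    ⟨hw₀, Metric.mem_ball_self hδ⟩ ⟨hw, hwδ⟩
  have := hvε y (hball ⟨hy.2, hy.1⟩) r ⟨hr.1.le, hr.2⟩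
  rw [← dist_eq_norm]
  exact le_of_lt this

/-- Induction on the order of differentiability. The derivative of the integral is again an integral
of the same kind, with values in `W →L[ℝ] F`. For this reason `F` is quantified inside the induction
and the derivative formula is carried along. -/
theorem contDiffOn_nat_intervalIntegral {W : Type} [NormedAddCommGroup W] [NormedSpace ℝ W]
    {K : Set W} (hK : Convex ℝ K) (hu : UniqueDiffOn ℝ K) (m : ℕ) :
    ∀ {F : Type} [NormedAddCommGroup F] [NormedSpace ℝ F] [CompleteSpace F]
    {f : ℝ × W → F}, ContDiffOn ℝ ∞ f (univ ×ˢ K) →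
    ContDiffOn ℝ m (fun w ↦ ∫ r in (0:ℝ)..1, f (r, w)) K ∧
    ∀ w ∈ K, HasFDerivWithinAt (fun w ↦ ∫ r in (0:ℝ)..1, f (r, w))
      (∫ r in (0:ℝ)..1, (fderivWithin ℝ f (univ ×ˢ K) (r, w)).comp
        (ContinuousLinearMap.inr ℝ ℝ W)) K w := by
  induction m with
  | zero =>
    intro F _ _ _ f hf
    have hD : ∀ w ∈ K, HasFDerivWithinAt (fun w ↦ ∫ r in (0:ℝ)..1, f (r, w))
      (∫ r in (0:ℝ)..1, (fderivWithin ℝ f (univ ×ˢ K) (r, w)).comp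
        (ContinuousLinearMap.inr ℝ ℝ W)) K w := by
      intro w hw
      refine hasFDerivWithinAt_intervalIntegral hK (f := fun r w ↦ f (r, w))
        (f' := fun r w ↦ (fderivWithin ℝ f (univ ×ˢ K) (r, w)).comp
        (ContinuousLinearMap.inr ℝ ℝ W)) hf.continuousOn ?_ ?_ hw
      · exact (hf.continuousOn_fderivWithin (uniqueDiffOn_univ.prod hu) (by simp)).clm_comp
          continuousOn_const
      · intro r y hy
        have h1 := (hf.differentiableOn (by simp) (r, y) ⟨mem_univ _, hy⟩).hasFDerivWithinAt
        exact h1.comp y (hasFDerivAt_prodMk_right r y).hasFDerivWithinAt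
          fun z hz ↦ ⟨mem_univ _, hz⟩
    refine ⟨?_, hD⟩
    simp only [Nat.cast_zero, contDiffOn_zero]
    exact fun w hw ↦ (hD w hw).continuousWithinAt
  | succ m ih =>
    intro F _ _ _ f hf
    have hD := (ih hf).2
    refine ⟨?_, hD⟩
    push_cast
    rw [contDiffOn_succ_iff_hasFDerivWithinAt_of_uniqueDiffOn hu]
    refine ⟨by simp, _, (ih (f := fun p ↦ (fderivWithin ℝ f (univ ×ˢ K) p).comp
      (ContinuousLinearMap.inr ℝ ℝ W)) ?_).1, hD⟩
    exact (hf.fderivWithin (uniqueDiffOn_univ.prod hu) (by simp)).clm_comp contDiffOn_const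

theorem contDiffOn_intervalIntegral {W : Type} [NormedAddCommGroup W] [NormedSpace ℝ W]
    {K : Set W} (hK : Convex ℝ K) (hu : UniqueDiffOn ℝ K)
    {F : Type} [NormedAddCommGroup F] [NormedSpace ℝ F] [CompleteSpace F]
    {f : ℝ × W → F} (hf : ContDiffOn ℝ ∞ f (univ ×ˢ K)) :
    ContDiffOn ℝ ∞ (fun w ↦ ∫ r in (0:ℝ)..1, f (r, w)) K :=
  contDiffOn_infty.2 fun m ↦ (contDiffOn_nat_intervalIntegral hK hu m hf).1

end ParametricIntegral

/-! ### Integrals of smooth families of functions on the manifold -/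

section FamilyIntegral

set_option linter.unusedSectionVars false

open Set MeasureTheory Topology

variable {n : ℕ} [NeZero n] {D : Type*} [TopologicalSpace D]
  [ChartedSpace (EuclideanHalfSpace n) D] [IsManifold (𝓡∂ n) ∞ D]
  {P Q : Type} [NormedAddCommGroup P] [NormedSpace ℝ P] [NormedAddCommGroup Q] [NormedSpace ℝ Q]

theorem SmoothFamily.contDiffOn_chart {f : P → D → ℝ} (hf : SmoothFamily n f) (x₀ : D) :
    ContDiffOn ℝ ∞ (fun q : P × EuclideanSpace ℝ (Fin n) ↦ f q.1 ((extChartAt (𝓡∂ n) x₀).symm q.2))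
      (univ ×ˢ (extChartAt (𝓡∂ n) x₀).target) := by
  suffices h : ContMDiffOn (𝓘(ℝ, P).prod 𝓘(ℝ, EuclideanSpace ℝ (Fin n))) 𝓘(ℝ, ℝ) ∞
      (fun q : P × EuclideanSpace ℝ (Fin n) ↦ f q.1 ((extChartAt (𝓡∂ n) x₀).symm q.2))
      (univ ×ˢ (extChartAt (𝓡∂ n) x₀).target) by
    rwa [← modelWithCornersSelf_prod, chartedSpaceSelf_prod, contMDiffOn_iff_contDiffOn] at h
  refine ContMDiff.comp_contMDiffOn (g := fun q : P × D ↦ f q.1 q.2) hf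
    (f := fun q : P × EuclideanSpace ℝ (Fin n) ↦ (q.1, (extChartAt (𝓡∂ n) x₀).symm q.2)) ?_
  refine contMDiff_fst.contMDiffOn.prodMk ?_
  exact (contMDiffOn_extChartAt_symm x₀).comp contMDiff_snd.contMDiffOn fun q hq ↦ hq.2

/-- A ball intersected with the model half-space is convex and has unique derivatives even at
boundary points, so the results for convex sets apply in charts up to the boundary. -/
theorem exists_convex_chart_nhds (x₀ : D) :
    ∃ K ⊆ (extChartAt (𝓡∂ n) x₀).target, Convex ℝ K ∧ UniqueDiffOn ℝ K ∧
      extChartAt (𝓡∂ n) x₀ x₀ ∈ K ∧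
      K ∈ 𝓝[range (𝓡∂ n)] (extChartAt (𝓡∂ n) x₀ x₀) := by
  obtain ⟨r, hr, hK⟩ := Metric.mem_nhdsWithin_iff.1 (extChartAt_target_mem_nhdsWithin (I := 𝓡∂ n) x₀)
  refine ⟨_, hK, (convex_ball _ _).inter (𝓡∂ n).convex_range, ?_, ?_, ?_⟩
  · rw [inter_comm]
    exact (𝓡∂ n).uniqueDiffOn.inter Metric.isOpen_ball
  · exact ⟨Metric.mem_ball_self hr, mem_range_self _⟩
  · exact Filter.inter_mem (mem_nhdsWithin_of_mem_nhds (Metric.ball_mem_nhds _ hr)) self_mem_nhdsWithin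

theorem contMDiffAt_of_contDiffOn_chart {f : P → D → ℝ} {x₀ : D} {K : Set (EuclideanSpace ℝ (Fin n))}
    (hx : extChartAt (𝓡∂ n) x₀ x₀ ∈ K) (hK : K ∈ 𝓝[range (𝓡∂ n)] (extChartAt (𝓡∂ n) x₀ x₀))
    (hf : ContDiffOn ℝ ∞ (fun q : P × EuclideanSpace ℝ (Fin n) ↦
      f q.1 ((extChartAt (𝓡∂ n) x₀).symm q.2)) (univ ×ˢ K)) (p₀ : P) :
    ContMDiffAt (𝓘(ℝ, P).prod (𝓡∂ n)) 𝓘(ℝ, ℝ) ∞ (fun q : P × D ↦ f q.1 q.2) (p₀, x₀) := by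
  have hmem : (extChartAt (𝓡∂ n) x₀) ⁻¹' K ∈ 𝓝 x₀ := by
    have h1 : Filter.Tendsto (extChartAt (𝓡∂ n) x₀) (𝓝 x₀)
        (𝓝[range (𝓡∂ n)] (extChartAt (𝓡∂ n) x₀ x₀)) := by
      refine tendsto_nhdsWithin_iff.2 ⟨continuousAt_extChartAt x₀, ?_⟩
      filter_upwards [extChartAt_source_mem_nhds (I := 𝓡∂ n) x₀] with y hy
      exact extChartAt_target_subset_range x₀ ((extChartAt (𝓡∂ n) x₀).map_source hy)
    exact h1 hK
  have h1 : ContMDiffWithinAt (𝓘(ℝ, P).prod 𝓘(ℝ, EuclideanSpace ℝ (Fin n))) 𝓘(ℝ, ℝ) ∞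
      (fun q : P × EuclideanSpace ℝ (Fin n) ↦ f q.1 ((extChartAt (𝓡∂ n) x₀).symm q.2))
      (univ ×ˢ K) (p₀, extChartAt (𝓡∂ n) x₀ x₀) := by
    rw [← modelWithCornersSelf_prod, chartedSpaceSelf_prod, contMDiffWithinAt_iff_contDiffWithinAt]
    exact hf _ ⟨mem_univ _, hx⟩
  have h2 : ContMDiffAt (𝓘(ℝ, P).prod (𝓡∂ n)) (𝓘(ℝ, P).prod 𝓘(ℝ, EuclideanSpace ℝ (Fin n))) ∞
      (fun q : P × D ↦ (q.1, extChartAt (𝓡∂ n) x₀ q.2)) (p₀, x₀) := by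
    refine contMDiffAt_fst.prodMk ?_
    exact ContMDiffAt.comp (g := extChartAt (𝓡∂ n) x₀) (f := fun q : P × D ↦ q.2) (p₀, x₀)
      contMDiffAt_extChartAt contMDiffAt_snd
  have hs : {q : P × D | q.2 ∈ (extChartAt (𝓡∂ n) x₀).source ∧ extChartAt (𝓡∂ n) x₀ q.2 ∈ K} ∈
      𝓝 (p₀, x₀) :=
    (continuousAt_snd (p := (p₀, x₀))).preimage_mem_nhds
      (Filter.inter_mem (extChartAt_source_mem_nhds (I := 𝓡∂ n) x₀) hmem)
  have h3 := h1.comp (f := fun q : P × D ↦ (q.1, extChartAt (𝓡∂ n) x₀ q.2)) (p₀, x₀)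
    (h2.contMDiffWithinAt (s := {q : P × D | q.2 ∈ (extChartAt (𝓡∂ n) x₀).source ∧
      extChartAt (𝓡∂ n) x₀ q.2 ∈ K}))
    fun q hq ↦ ⟨mem_univ _, hq.2⟩
  refine (h3.contMDiffAt hs).congr_of_eventuallyEq ?_
  filter_upwards [hs] with q hq
  simp only [Function.comp_apply, (extChartAt (𝓡∂ n) x₀).left_inv hq.1]

theorem mvfderiv_eq_of_hasFDerivWithinAt_chart {f : D → ℝ} {x : D}
    (hf : MDifferentiableAt (𝓡∂ n) 𝓘(ℝ, ℝ) f x) {L : EuclideanSpace ℝ (Fin n) →L[ℝ] ℝ}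
    (h : HasFDerivWithinAt (fun y ↦ f ((extChartAt (𝓡∂ n) x).symm y)) L (range (𝓡∂ n))
      (extChartAt (𝓡∂ n) x x)) (w : EuclideanSpace ℝ (Fin n)) :
    mvfderiv (𝓡∂ n) f x w = L w := by
  have : mfderiv (𝓡∂ n) 𝓘(ℝ, ℝ) f x = L := by
    exact hf.mfderiv.trans (h.fderivWithin ((𝓡∂ n).uniqueDiffOn _ (mem_range_self _)))
  exact congrArg (fun L : EuclideanSpace ℝ (Fin n) →L[ℝ] ℝ ↦ L w) this

theorem SmoothFamily.integral_zero_one {f : ℝ × P → D → ℝ} (hf : SmoothFamily n f) :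
    SmoothFamily n (fun p x ↦ ∫ r in (0:ℝ)..1, f (r, p) x) := by
  rintro ⟨p₀, x₀⟩
  obtain ⟨K, hKt, hKc, hKu, hx, hKn⟩ := exists_convex_chart_nhds (n := n) x₀
  refine contMDiffAt_of_contDiffOn_chart (f := fun p x ↦ ∫ r in (0:ℝ)..1, f (r, p) x) hx hKn ?_ p₀
  refine contDiffOn_intervalIntegral (f := fun q : ℝ × P × EuclideanSpace ℝ (Fin n) ↦
    f (q.1, q.2.1) ((extChartAt (𝓡∂ n) x₀).symm q.2.2)) (convex_univ.prod hKc)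
    (uniqueDiffOn_univ.prod hKu) ?_
  refine (hf.contDiffOn_chart x₀).comp (f := fun q : ℝ × P × EuclideanSpace ℝ (Fin n) ↦
    ((q.1, q.2.1), q.2.2)) (by fun_prop) fun q hq ↦ ⟨mem_univ _, hKt hq.2.2⟩

theorem SmoothFamily.comp_param {f : P → D → ℝ} (hf : SmoothFamily n f) {g : Q → P}
    (hg : ContDiff ℝ ∞ g) : SmoothFamily n (fun q ↦ f (g q)) := by
  refine ContMDiff.comp (g := fun q : P × D ↦ f q.1 q.2) hf
    (f := fun q : Q × D ↦ (g q.1, q.2)) ?_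
  exact (hg.contMDiff.comp contMDiff_fst).prodMk contMDiff_snd

theorem SmoothFamily.contDiff_apply {f : P → D → ℝ} (hf : SmoothFamily n f) (x : D) :
    ContDiff ℝ ∞ fun p ↦ f p x := by
  rw [← contMDiff_iff_contDiff]
  exact ContMDiff.comp (g := fun q : P × D ↦ f q.1 q.2) hf
    (contMDiff_id.prodMk contMDiff_const)

theorem SmoothFamily.mdifferentiableAt {f : P → D → ℝ} (hf : SmoothFamily n f) (p : P) (x : D) :
    MDifferentiableAt (𝓡∂ n) 𝓘(ℝ, ℝ) (f p) x :=
  (hf.slice p x).mdifferentiableAt (by simp)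

/-- Differentiation under the integral sign. -/
theorem SmoothFamily.mvfderiv_integral_zero_one {f : ℝ → D → ℝ} (hf : SmoothFamily n f) (x : D)
    (w : EuclideanSpace ℝ (Fin n)) :
    mvfderiv (𝓡∂ n) (fun x ↦ ∫ r in (0:ℝ)..1, f r x) x w =
      ∫ r in (0:ℝ)..1, mvfderiv (𝓡∂ n) (f r) x w := by
  -- A dummy parameter is added, since `integral_zero_one` treats families over `ℝ × P`.
  have hs : SmoothFamily n (fun (_ : ℝ) x ↦ ∫ r in (0:ℝ)..1, f r x) :=
    (hf.comp_param (g := fun q : ℝ × ℝ ↦ q.1) (by fun_prop)).integral_zero_one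
  obtain ⟨K, hKt, hKc, hKu, hx, hKn⟩ := exists_convex_chart_nhds (n := n) x
  have hc : ContDiffOn ℝ ∞ (fun q : ℝ × EuclideanSpace ℝ (Fin n) ↦
      f q.1 ((extChartAt (𝓡∂ n) x).symm q.2)) (univ ×ˢ K) :=
    (hf.contDiffOn_chart x).mono (prod_mono_right hKt)
  have hc' := (hc.continuousOn_fderivWithin (uniqueDiffOn_univ.prod hKu) (by simp)).clm_comp
    (continuousOn_const (c := ContinuousLinearMap.inr ℝ ℝ (EuclideanSpace ℝ (Fin n))))
  have hd : ∀ r, ∀ y ∈ K, HasFDerivWithinAt (fun y ↦ f r ((extChartAt (𝓡∂ n) x).symm y))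
      ((fderivWithin ℝ (fun q : ℝ × EuclideanSpace ℝ (Fin n) ↦
      f q.1 ((extChartAt (𝓡∂ n) x).symm q.2)) (univ ×ˢ K) (r, y)).comp
        (ContinuousLinearMap.inr ℝ ℝ _)) K y := by
    intro r y hy
    have h1 := (hc.differentiableOn (by simp) (r, y) ⟨mem_univ _, hy⟩).hasFDerivWithinAt
    exact h1.comp y (hasFDerivAt_prodMk_right r y).hasFDerivWithinAt
      fun z hz ↦ ⟨mem_univ _, hz⟩
  have h1 := hasFDerivWithinAt_intervalIntegral hKc
    (f := fun r y ↦ f r ((extChartAt (𝓡∂ n) x).symm y))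
    (f' := fun r y ↦ (fderivWithin ℝ (fun q : ℝ × EuclideanSpace ℝ (Fin n) ↦
      f q.1 ((extChartAt (𝓡∂ n) x).symm q.2)) (univ ×ˢ K) (r, y)).comp
        (ContinuousLinearMap.inr ℝ ℝ _))
    hc.continuousOn hc' hd hx
  rw [mvfderiv_eq_of_hasFDerivWithinAt_chart (hs.mdifferentiableAt 0 x)
    (h1.mono_of_mem_nhdsWithin hKn), ContinuousLinearMap.intervalIntegral_apply]
  · congr 1
    ext r
    exact (mvfderiv_eq_of_hasFDerivWithinAt_chart (hf.mdifferentiableAt r x)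
      ((hd r _ hx).mono_of_mem_nhdsWithin hKn) w).symm
  · refine Continuous.intervalIntegrable ?_ _ _
    rw [← continuousOn_univ]
    exact hc'.comp (f := fun r : ℝ ↦ (r, extChartAt (𝓡∂ n) x x)) (by fun_prop)
      fun r _ ↦ ⟨mem_univ _, hx⟩

theorem SmoothFamily.integral {f : ℝ × P → D → ℝ} (hf : SmoothFamily n f) {a b : P → ℝ}
    (ha : ContDiff ℝ ∞ a) (hb : ContDiff ℝ ∞ b) :
    SmoothFamily n (fun p x ↦ ∫ r in a p..b p, f (r, p) x) := by
  -- The affine substitution onto `[0, 1]` moves the variable endpoints into the integrand, where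
  -- they are ordinary smooth parameters.
  have e : (fun p x ↦ ∫ r in a p..b p, f (r, p) x) = fun p x ↦
      (b p - a p) * ∫ r in (0:ℝ)..1, f (a p + (b p - a p) * r, p) x := by
    ext p x
    have := intervalIntegral.smul_integral_comp_add_mul (fun r ↦ f (r, p) x) (b p - a p) (a p)
      (a := 0) (b := 1)
    simp only [smul_eq_mul] at this
    rw [this]
    simp
  rw [e]
  have h1 : SmoothFamily n (fun p x ↦ ∫ r in (0:ℝ)..1, f (a p + (b p - a p) * r, p) x) :=
    (hf.comp_param (g := fun q : ℝ × P ↦ (a q.2 + (b q.2 - a q.2) * q.1, q.2))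
      (by fun_prop)).integral_zero_one
  exact ContMDiff.mul ((hb.sub ha).contMDiff.comp contMDiff_fst) h1

theorem SmoothFamily.mvfderiv_integral {f : ℝ → D → ℝ} (hf : SmoothFamily n f) (a b : ℝ) (x : D)
    (w : EuclideanSpace ℝ (Fin n)) :
    mvfderiv (𝓡∂ n) (fun x ↦ ∫ r in a..b, f r x) x w =
      ∫ r in a..b, mvfderiv (𝓡∂ n) (f r) x w := by
  have key (g : ℝ → ℝ) : ∫ r in a..b, g r = (b - a) * ∫ r in (0:ℝ)..1, g (a + (b - a) * r) := by
    have := intervalIntegral.smul_integral_comp_add_mul g (b - a) a (a := 0) (b := 1)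
    simp only [smul_eq_mul] at this
    rw [this]
    simp
  have h1 : SmoothFamily n (fun r ↦ f (a + (b - a) * r)) :=
    hf.comp_param (g := fun r : ℝ ↦ a + (b - a) * r) (by fun_prop)
  have h2 : SmoothFamily n (fun (_ : ℝ) x ↦ ∫ r in (0:ℝ)..1, f (a + (b - a) * r) x) :=
    (h1.comp_param (g := fun q : ℝ × ℝ ↦ q.1) (by fun_prop)).integral_zero_one
  simp only [key]
  have h3 := mvfderiv_mul (mdifferentiableAt_const (c := b - a)) (h2.mdifferentiableAt 0 x)
  refine (congrArg (fun L : TangentSpace (𝓡∂ n) x →L[ℝ] ℝ ↦ L w) h3).trans ?_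
  simp only [mvfderiv_const, smul_zero, add_zero]
  change (b - a) * mvfderiv (𝓡∂ n) (fun x ↦ ∫ r in (0:ℝ)..1, f (a + (b - a) * r) x) x w = _
  rw [h1.mvfderiv_integral_zero_one]

end FamilyIntegral

/-! ### Testing fields with globally smooth functions and vector fields -/

section Probes

set_option linter.unusedSectionVars false

open Set Topology

variable {n : ℕ} [NeZero n] {D : Type*} [TopologicalSpace D]
  [ChartedSpace (EuclideanHalfSpace n) D] [IsManifold (𝓡∂ n) ∞ D]
  {P : Type} [NormedAddCommGroup P] [NormedSpace ℝ P]

theorem SmoothVField.family {X : VField n D} (hX : SmoothVField X) :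
    SmoothVFamily (fun _ : P ↦ X) :=
  ContMDiff.comp (g := fun x : D ↦ (⟨x, X x⟩ : TangentBundle (𝓡∂ n) D)) hX contMDiff_snd

theorem SmoothCField.family {u : CField n D} (hu : SmoothCField u) :
    SmoothCFamily (fun _ : P ↦ u) :=
  ContMDiff.comp (g := fun x : D ↦ Bundle.TotalSpace.mk' (EuclideanSpace ℝ (Fin n) →L[ℝ] ℝ)
      (E := fun x : D ↦ TangentSpace (𝓡∂ n) x →L[ℝ] ℝ) x (u x)) hu contMDiff_snd

theorem smoothFamily_const {f : D → ℝ} (hf : ContMDiff (𝓡∂ n) 𝓘(ℝ, ℝ) ∞ f) :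
    SmoothFamily n (fun _ : P ↦ f) :=
  hf.comp contMDiff_snd

theorem SmoothVFamily.slice {X : P → VField n D} (hX : SmoothVFamily X) (p : P) :
    SmoothVField (X p) :=
  ContMDiff.comp (g := fun q : P × D ↦ (⟨q.2, X q.1 q.2⟩ : TangentBundle (𝓡∂ n) D)) hX
    (contMDiff_const.prodMk contMDiff_id)

theorem SmoothCFamily.slice {u : P → CField n D} (hu : SmoothCFamily u) (p : P) :
    SmoothCField (u p) :=
  ContMDiff.comp (g := fun q : P × D ↦
    Bundle.TotalSpace.mk' (EuclideanSpace ℝ (Fin n) →L[ℝ] ℝ)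
      (E := fun x : D ↦ TangentSpace (𝓡∂ n) x →L[ℝ] ℝ) q.2 (u q.1 q.2)) hu
    (contMDiff_const.prodMk contMDiff_id)

theorem SmoothVFamily.comp_param {Q : Type} [NormedAddCommGroup Q] [NormedSpace ℝ Q]
    {X : P → VField n D} (hX : SmoothVFamily X) {g : Q → P} (hg : ContDiff ℝ ∞ g) :
    SmoothVFamily (fun q ↦ X (g q)) :=
  ContMDiff.comp (g := fun q : P × D ↦ (⟨q.2, X q.1 q.2⟩ : TangentBundle (𝓡∂ n) D)) hX
    (f := fun q : Q × D ↦ (g q.1, q.2))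
    ((hg.contMDiff.comp contMDiff_fst).prodMk contMDiff_snd)

theorem SmoothCFamily.comp_param {Q : Type} [NormedAddCommGroup Q] [NormedSpace ℝ Q]
    {u : P → CField n D} (hu : SmoothCFamily u) {g : Q → P} (hg : ContDiff ℝ ∞ g) :
    SmoothCFamily (fun q ↦ u (g q)) :=
  ContMDiff.comp (g := fun q : P × D ↦
    Bundle.TotalSpace.mk' (EuclideanSpace ℝ (Fin n) →L[ℝ] ℝ)
      (E := fun x : D ↦ TangentSpace (𝓡∂ n) x →L[ℝ] ℝ) q.2 (u q.1 q.2)) hu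
    (f := fun q : Q × D ↦ (g q.1, q.2))
    ((hg.contMDiff.comp contMDiff_fst).prodMk contMDiff_snd)

theorem SmoothVField.mdiffAt {X : VField n D} (hX : SmoothVField X) (x : D) :
    MDifferentiableAt (𝓡∂ n) (𝓡∂ n).tangent
      (fun x ↦ (⟨x, X x⟩ : TangentBundle (𝓡∂ n) D)) x :=
  (hX x).mdifferentiableAt (by simp)

/-- Pairing of families. -/
theorem SmoothCFamily.apply {u : P → CField n D} (hu : SmoothCFamily u) {X : P → VField n D}
    (hX : SmoothVFamily X) : SmoothFamily n (fun p x ↦ u p x (X p x)) := by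
  have := ContMDiff.clm_bundle_apply (F₁ := EuclideanSpace ℝ (Fin n)) (F₂ := ℝ)
    (E₁ := fun x : D ↦ TangentSpace (𝓡∂ n) x) (E₂ := Bundle.Trivial D ℝ)
    (b := fun q : P × D ↦ q.2) (ϕ := fun q ↦ u q.1 q.2) (v := fun q ↦ X q.1 q.2)
    (IB := 𝓡∂ n) (IM := 𝓘(ℝ, P).prod (𝓡∂ n)) hu hX
  intro q
  have h2 := this q
  rw [Bundle.contMDiffAt_totalSpace] at h2
  exact h2.2

/-- Directional derivative of a family of functions along a family of vector fields. -/
theorem SmoothFamily.mvfderiv_apply {f : P → D → ℝ} (hf : SmoothFamily n f) {X : P → VField n D}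
    (hX : SmoothVFamily X) : SmoothFamily n (fun p x ↦ mvfderiv (𝓡∂ n) (f p) x (X p x)) := by
  intro q₀
  have h1 := ContMDiffAt.mfderiv (J := 𝓘(ℝ, P).prod (𝓡∂ n)) (I := 𝓡∂ n) (I' := 𝓘(ℝ, ℝ)) (x₀ := q₀)
    (fun (q : P × D) (x : D) ↦ f q.1 x) (fun q ↦ q.2) (n := ∞) (m := ∞)
    (ContMDiffAt.comp (I' := 𝓘(ℝ, P).prod (𝓡∂ n)) (g := fun q : P × D ↦ f q.1 q.2)
      (f := fun q : (P × D) × D ↦ (q.1.1, q.2)) _ (hf _)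
      ((contMDiff_fst.comp contMDiff_fst).prodMk contMDiff_snd).contMDiffAt)
    contMDiffAt_snd (by simp)
  have hv := hX q₀
  have h2 := ContMDiffAt.clm_apply_of_inCoordinates (F₁ := EuclideanSpace ℝ (Fin n)) (F₂ := ℝ)
    (E₁ := fun x : D ↦ TangentSpace (𝓡∂ n) x) (E₂ := fun y : ℝ ↦ TangentSpace 𝓘(ℝ, ℝ) y)
    (b₁ := fun q : P × D ↦ q.2) (b₂ := fun q : P × D ↦ f q.1 q.2)
    (ϕ := fun q : P × D ↦ mfderiv (𝓡∂ n) 𝓘(ℝ, ℝ) (f q.1) q.2)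
    (v := fun q ↦ X q.1 q.2) h1 hv (hf q₀)
  have h3 := ((contMDiff_snd_tangentBundle_modelSpace (n := ∞) ℝ 𝓘(ℝ, ℝ)).contMDiffAt).comp q₀ h2
  exact h3

variable [T2Space D]

/-- The local frame of the trivialization is multiplied by a bump function. The result is globally
smooth and unchanged where the bump equals one. -/
theorem exists_frame_probe (x₀ : D) :
    ∃ Y : Fin n → VField n D, (∀ j, SmoothVField (Y j)) ∧ ∀ᶠ x in 𝓝 x₀, ∀ j,
      Y j x = (trivializationAt (EuclideanSpace ℝ (Fin n)) (TangentSpace (𝓡∂ n)) x₀).symmL ℝ x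
        (EuclideanSpace.basisFun (Fin n) ℝ j) := by
  let t := trivializationAt (EuclideanSpace ℝ (Fin n)) (TangentSpace (𝓡∂ n) : D → Type _) x₀
  obtain ⟨χ⟩ : Nonempty (SmoothBumpFunction (𝓡∂ n) x₀) := inferInstance
  let b := (EuclideanSpace.basisFun (Fin n) ℝ).toBasis
  refine ⟨fun j x ↦ χ x • t.localFrame b j x, fun j x ↦ ?_, ?_⟩
  · by_cases hx : x ∈ tsupport χ
    · have hx' : x ∈ t.baseSet := χ.tsupport_subset_chartAt_source hx
      exact ContMDiffAt.smul_section (χ.contMDiffAt) (contMDiffAt_localFrame_of_mem ∞ t b j hx')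
    · have h0 : ContMDiffAt (𝓡∂ n) (𝓡∂ n).tangent ∞
          (fun x ↦ (⟨x, 0⟩ : TangentBundle (𝓡∂ n) D)) x :=
        (Bundle.contMDiff_zeroSection ℝ (TangentSpace (𝓡∂ n) : D → Type _)).contMDiffAt
      refine h0.congr_of_eventuallyEq ?_
      have : (tsupport χ)ᶜ ∈ 𝓝 x := (isClosed_tsupport _).isOpen_compl.mem_nhds hx
      filter_upwards [this] with y hy
      simp [image_eq_zero_of_notMem_tsupport hy]
  · filter_upwards [χ.eventuallyEq_one, t.open_baseSet.mem_nhds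
      (FiberBundle.mem_baseSet_trivializationAt' x₀)] with x h1 hx j
    simp only [h1, Pi.one_apply, one_smul]
    rw [t.localFrame_apply_of_mem_baseSet b hx]
    simp only [Bundle.Trivialization.basisAt, b, Module.Basis.map_apply, OrthonormalBasis.coe_toBasis]
    exact (t.symmL_apply hx _).symm

/-- Chart coordinates times a bump function. The derivative of the extended chart is the tangent
trivialization, so these functions read off the components of tangent vectors. -/
theorem exists_coord_probe (x₀ : D) :
    ∃ f : Fin n → D → ℝ, (∀ j, ContMDiff (𝓡∂ n) 𝓘(ℝ, ℝ) ∞ (f j)) ∧ ∀ᶠ x in 𝓝 x₀, ∀ j,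
      ∀ v : TangentSpace (𝓡∂ n) x, mvfderiv (𝓡∂ n) (f j) x v =
        ((trivializationAt (EuclideanSpace ℝ (Fin n)) (TangentSpace (𝓡∂ n)) x₀).continuousLinearMapAt
          ℝ x v : EuclideanSpace ℝ (Fin n)) j := by
  obtain ⟨χ⟩ : Nonempty (SmoothBumpFunction (𝓡∂ n) x₀) := inferInstance
  refine ⟨fun j x ↦ χ x • (extChartAt (𝓡∂ n) x₀ x) j, fun j ↦ ?_, ?_⟩
  · refine χ.contMDiff_smul ?_
    have h1 : ContMDiffOn (𝓡∂ n) 𝓘(ℝ, EuclideanSpace ℝ (Fin n)) ∞ (extChartAt (𝓡∂ n) x₀)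
      (chartAt (EuclideanHalfSpace n) x₀).source := contMDiffOn_extChartAt
    exact ((EuclideanSpace.proj j : EuclideanSpace ℝ (Fin n) →L[ℝ] ℝ).contMDiff
      (n := ∞)).comp_contMDiffOn h1
  · have hs : (chartAt (EuclideanHalfSpace n) x₀).source ∈ 𝓝 x₀ := chart_source_mem_nhds _ x₀
    filter_upwards [χ.eventuallyEq_one.eventuallyEq_nhds, hs] with x hx hxs j v
    have e : (fun x ↦ χ x • (extChartAt (𝓡∂ n) x₀ x) j) =ᶠ[𝓝 x]
        (EuclideanSpace.proj j : EuclideanSpace ℝ (Fin n) →L[ℝ] ℝ) ∘ extChartAt (𝓡∂ n) x₀ := by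
      filter_upwards [hx] with y hy
      simp [hy]
    have h1 := e.mfderiv_eq (I := 𝓡∂ n) (I' := 𝓘(ℝ, ℝ))
    have h2 : MDifferentiableAt (𝓡∂ n) 𝓘(ℝ, EuclideanSpace ℝ (Fin n)) (extChartAt (𝓡∂ n) x₀) x :=
      mdifferentiableAt_extChartAt hxs
    rw [mfderiv_comp x (EuclideanSpace.proj j :
      EuclideanSpace ℝ (Fin n) →L[ℝ] ℝ).differentiableAt.mdifferentiableAt h2,
      ContinuousLinearMap.mfderiv_eq] at h1
    have h3 := TangentBundle.continuousLinearMapAt_trivializationAt (I := 𝓡∂ n) hxs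
    rw [← h3] at h1
    exact congrArg (fun L : EuclideanSpace ℝ (Fin n) →L[ℝ] ℝ ↦ L v) h1

theorem eventually_mem_baseSet (x₀ : D) : ∀ᶠ x in 𝓝 x₀, x ∈ (trivializationAt
    (EuclideanSpace ℝ (Fin n)) (TangentSpace (𝓡∂ n) : D → Type _) x₀).baseSet :=
  (trivializationAt (EuclideanSpace ℝ (Fin n)) (TangentSpace (𝓡∂ n) : D → Type _)
    x₀).open_baseSet.mem_nhds (FiberBundle.mem_baseSet_trivializationAt' x₀)

/-- The components of `X` in a trivialization are its derivatives of the functions from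
`exists_coord_probe`. Smoothness of a section thereby becomes smoothness of real functions. -/
theorem smoothVFamily_of_probe {X : P → VField n D}
    (h : ∀ f : D → ℝ, ContMDiff (𝓡∂ n) 𝓘(ℝ, ℝ) ∞ f →
      SmoothFamily n (fun p x ↦ mvfderiv (𝓡∂ n) f x (X p x))) : SmoothVFamily X := by
  rintro ⟨p₀, x₀⟩
  rw [Bundle.contMDiffAt_totalSpace]
  refine ⟨contMDiffAt_snd, ?_⟩
  obtain ⟨f, hf, he⟩ := exists_coord_probe (n := n) x₀
  have h1 : ContMDiffAt (𝓘(ℝ, P).prod (𝓡∂ n)) 𝓘(ℝ, EuclideanSpace ℝ (Fin n)) ∞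
      (fun q : P × D ↦ ∑ j, mvfderiv (𝓡∂ n) (f j) q.2 (X q.1 q.2) •
        (EuclideanSpace.basisFun (Fin n) ℝ j)) (p₀, x₀) := by
    refine contMDiffAt_finsetSum fun j _ ↦ ?_
    exact ContMDiffAt.smul (h (f j) (hf j) (p₀, x₀)) contMDiffAt_const
  refine h1.congr_of_eventuallyEq ?_
  filter_upwards [(continuousAt_snd (p := (p₀, x₀))).eventually (he.and (eventually_mem_baseSet (n := n) x₀))] with q hq
  have h3 := (EuclideanSpace.basisFun (Fin n) ℝ).sum_repr
    ((trivializationAt (EuclideanSpace ℝ (Fin n)) (TangentSpace (𝓡∂ n)) x₀).continuousLinearMapAt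
          ℝ q.2 (X q.1 q.2))
  have h4 := congrFun (Bundle.Trivialization.coe_linearMapAt_of_mem (R := ℝ) (trivializationAt
    (EuclideanSpace ℝ (Fin n)) (TangentSpace (𝓡∂ n) : D → Type _) x₀) hq.2) (X q.1 q.2)
  refine h4.symm.trans (h3.symm.trans ?_)
  refine Finset.sum_congr rfl fun j _ ↦ ?_
  rw [hq.1 j]
  rfl

/-- Dual to `smoothVFamily_of_probe`: the components of `u` are its values on the fields from
`exists_frame_probe`. -/
theorem smoothCFamily_of_probe {u : P → CField n D}
    (h : ∀ Y : VField n D, SmoothVField Y → SmoothFamily n (fun p x ↦ u p x (Y x))) :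
    SmoothCFamily u := by
  rintro ⟨p₀, x₀⟩
  have := contMDiffAt_hom_bundle (n := ∞) (𝕜 := ℝ) (F₁ := EuclideanSpace ℝ (Fin n)) (F₂ := ℝ)
    (E₁ := fun x : D ↦ TangentSpace (𝓡∂ n) x) (E₂ := Bundle.Trivial D ℝ) (IB := 𝓡∂ n)
    (IM := 𝓘(ℝ, P).prod (𝓡∂ n)) (x₀ := (p₀, x₀))
    (fun q : P × D ↦ Bundle.TotalSpace.mk' (EuclideanSpace ℝ (Fin n) →L[ℝ] ℝ)
      (E := fun x : D ↦ TangentSpace (𝓡∂ n) x →L[ℝ] Bundle.Trivial D ℝ x) q.2 (u q.1 q.2))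
  refine this.2 ⟨contMDiffAt_snd, ?_⟩
  obtain ⟨Y, hY, he⟩ := exists_frame_probe (n := n) x₀
  have h1 : ContMDiffAt (𝓘(ℝ, P).prod (𝓡∂ n)) 𝓘(ℝ, EuclideanSpace ℝ (Fin n) →L[ℝ] ℝ) ∞
      (fun q : P × D ↦ ∑ j, u q.1 q.2 (Y j q.2) •
        (EuclideanSpace.proj j : EuclideanSpace ℝ (Fin n) →L[ℝ] ℝ)) (p₀, x₀) := by
    refine contMDiffAt_finsetSum fun j _ ↦ ?_
    exact ContMDiffAt.smul (h (Y j) (hY j) (p₀, x₀)) contMDiffAt_const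
  refine h1.congr_of_eventuallyEq ?_
  filter_upwards [(continuousAt_snd (p := (p₀, x₀))).eventually (he.and (eventually_mem_baseSet (n := n) x₀))] with q hq
  rw [ContinuousLinearMap.inCoordinates_eq hq.2 (Set.mem_univ _)]
  refine ContinuousLinearMap.coe_injective
    ((EuclideanSpace.basisFun (Fin n) ℝ).toBasis.ext fun i ↦ ?_)
  simp [hq.1]
  exact congrArg _ (Bundle.Trivialization.symmL_apply _ hq.2 _).symm

theorem exists_smoothVField_apply {x : D} (v : TangentSpace (𝓡∂ n) x) :
    ∃ Y : VField n D, SmoothVField Y ∧ Y x = v := by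
  obtain ⟨Y, hY, he⟩ := exists_frame_probe (n := n) x
  let t := trivializationAt (EuclideanSpace ℝ (Fin n)) (TangentSpace (𝓡∂ n) : D → Type _) x
  let c : EuclideanSpace ℝ (Fin n) := t.continuousLinearMapAt ℝ x v
  refine ⟨fun y ↦ ∑ j, c j • Y j y, ?_, ?_⟩
  · exact ContMDiff.sum_section fun j _ ↦ ContMDiff.const_smul_section (hY j)
  · have h1 := (EuclideanSpace.basisFun (Fin n) ℝ).sum_repr c
    have h2 := t.symmL_continuousLinearMapAt (R := ℝ)
      (FiberBundle.mem_baseSet_trivializationAt' x) v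
    change t.symmL ℝ x c = v at h2
    rw [← h1, map_sum] at h2
    rw [← h2]
    refine Finset.sum_congr rfl fun j _ ↦ ?_
    rw [he.self_of_nhds j, map_smul]
    rfl

theorem eq_of_forall_mvfderiv {x : D} {v w : TangentSpace (𝓡∂ n) x}
    (h : ∀ f : D → ℝ, ContMDiff (𝓡∂ n) 𝓘(ℝ, ℝ) ∞ f →
      mvfderiv (𝓡∂ n) f x v = mvfderiv (𝓡∂ n) f x w) : v = w := by
  obtain ⟨f, hf, he⟩ := exists_coord_probe (n := n) x
  let t := trivializationAt (EuclideanSpace ℝ (Fin n)) (TangentSpace (𝓡∂ n) : D → Type _) x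
  have hx := FiberBundle.mem_baseSet_trivializationAt' (F := EuclideanSpace ℝ (Fin n))
    (E := (TangentSpace (𝓡∂ n) : D → Type _)) x
  have h1 : t.continuousLinearMapAt ℝ x v = t.continuousLinearMapAt ℝ x w := by
    ext j
    exact (he.self_of_nhds j v).symm.trans ((h _ (hf j)).trans (he.self_of_nhds j w))
  rw [← t.symmL_continuousLinearMapAt (R := ℝ) hx v, h1, t.symmL_continuousLinearMapAt hx]

/-- Every tangent vector extends to a global smooth field. Identities between Lie derivatives can
therefore be checked on such fields, where the defining formula is available. -/
theorem covector_ext {x : D} {α β : TangentSpace (𝓡∂ n) x →L[ℝ] ℝ}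
    (h : ∀ Y : VField n D, SmoothVField Y → α (Y x) = β (Y x)) : α = β := by
  ext v
  obtain ⟨Y, hY, rfl⟩ := exists_smoothVField_apply v
  exact h Y hY

end Probes

/-! ### Lie brackets of smooth vector fields -/

section LieCalculus

set_option linter.unusedSectionVars false

open Set Topology

variable {n : ℕ} [NeZero n] {D : Type*} [TopologicalSpace D]
  [ChartedSpace (EuclideanHalfSpace n) D] [IsManifold (𝓡∂ n) ∞ D]
  {P : Type} [NormedAddCommGroup P] [NormedSpace ℝ P]

theorem SmoothVField.mlieBracket {X Y : VField n D} (hX : SmoothVField X) (hY : SmoothVField Y) :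
    SmoothVField (mlieBracket (𝓡∂ n) X Y) :=
  have h2 : (2 : WithTop ℕ∞) ≤ ∞ := ENat.LEInfty.out
  have : IsManifold (𝓡∂ n) (minSmoothness ℝ 2) D := .of_le (n := ∞) (by simpa using h2)
  have : IsManifold (𝓡∂ n) (((⊤ : ℕ∞) : WithTop ℕ∞) + 1) D := inferInstanceAs (IsManifold (𝓡∂ n) ∞ D)
  ContDiff.mlieBracket_vectorField (n := ⊤) (m := ⊤) hX hY (by simp)

theorem jacobi_mlieBracket {X Y Z : VField n D} (hX : SmoothVField X) (hY : SmoothVField Y)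
    (hZ : SmoothVField Z) (x : D) :
    mlieBracket (𝓡∂ n) X (mlieBracket (𝓡∂ n) Y Z) x =
      mlieBracket (𝓡∂ n) (mlieBracket (𝓡∂ n) X Y) Z x +
        mlieBracket (𝓡∂ n) Y (mlieBracket (𝓡∂ n) X Z) x := by
  have h3 : (3 : WithTop ℕ∞) ≤ ∞ := ENat.LEInfty.out
  have h2 : (2 : WithTop ℕ∞) ≤ ∞ := ENat.LEInfty.out
  have : IsManifold (𝓡∂ n) (minSmoothness ℝ 3) D := .of_le (n := ∞) (by simpa using h3)
  exact leibniz_identity_mlieBracket_apply ((hX x).of_le (by simpa using h2))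
    ((hY x).of_le (by simpa using h2)) ((hZ x).of_le (by simpa using h2))

theorem contMDiff_mvfderiv_apply {f : D → ℝ} (hf : ContMDiff (𝓡∂ n) 𝓘(ℝ, ℝ) ∞ f) {X : VField n D}
    (hX : SmoothVField X) : ContMDiff (𝓡∂ n) 𝓘(ℝ, ℝ) ∞ (fun x ↦ mvfderiv (𝓡∂ n) f x (X x)) :=
  ((smoothFamily_const (P := ℝ) hf).mvfderiv_apply hX.family).slice 0

variable [T2Space D]

theorem SmoothVField.smul {f : D → ℝ} (hf : ContMDiff (𝓡∂ n) 𝓘(ℝ, ℝ) ∞ f) {X : VField n D}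
    (hX : SmoothVField X) : SmoothVField (f • X) :=
  ContMDiff.smul_section hf hX

/-- Expand the Jacobi identity for `X`, `Y`, `f • Z` with the Leibniz rule. The terms with a single
derivative of `f` along `X` or `Y` occur on both sides, the terms without derivatives of `f` cancel
by Jacobi for `X`, `Y`, `Z`, and the remaining coefficient of `Z` is the claim. -/
theorem mvfderiv_mlieBracket {X Y : VField n D} (hX : SmoothVField X) (hY : SmoothVField Y)
    {f : D → ℝ} (hf : ContMDiff (𝓡∂ n) 𝓘(ℝ, ℝ) ∞ f) (x : D) :
    mvfderiv (𝓡∂ n) f x (mlieBracket (𝓡∂ n) X Y x) =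
      mvfderiv (𝓡∂ n) (fun y ↦ mvfderiv (𝓡∂ n) f y (Y y)) x (X x) -
        mvfderiv (𝓡∂ n) (fun y ↦ mvfderiv (𝓡∂ n) f y (X y)) x (Y x) := by
  -- Any field that does not vanish at `x` would do. It is only needed to cancel the factor `Z x` at
  -- the end.
  obtain ⟨Z, hZ, hZx⟩ := exists_smoothVField_apply (n := n) (x := x)
    (EuclideanSpace.basisFun (Fin n) ℝ 0)
  have hne : Z x ≠ 0 := by
    rw [hZx]; exact (EuclideanSpace.basisFun (Fin n) ℝ).toBasis.ne_zero 0
  have md {g : D → ℝ} (hg : ContMDiff (𝓡∂ n) 𝓘(ℝ, ℝ) ∞ g) (y : D) :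
      MDifferentiableAt (𝓡∂ n) 𝓘(ℝ, ℝ) g y := (hg y).mdifferentiableAt (by simp)
  have br {W : VField n D} (hW : SmoothVField W) {g : D → ℝ} (hg : ContMDiff (𝓡∂ n) 𝓘(ℝ, ℝ) ∞ g)
      {V : VField n D} (hV : SmoothVField V) : mlieBracket (𝓡∂ n) W (g • V) =
      (fun y ↦ mvfderiv (𝓡∂ n) g y (W y)) • V + g • mlieBracket (𝓡∂ n) W V := by
    ext y
    exact mlieBracket_smul_right (md hg y) (hV.mdiffAt y)
  have brs {W : VField n D} (hW : SmoothVField W) {V₁ V₂ : VField n D} (hV₁ : SmoothVField V₁)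
      (hV₂ : SmoothVField V₂) : mlieBracket (𝓡∂ n) W (V₁ + V₂) =
      mlieBracket (𝓡∂ n) W V₁ + mlieBracket (𝓡∂ n) W V₂ := by
    ext y
    exact mlieBracket_add_right (hV₁.mdiffAt y) (hV₂.mdiffAt y)
  have e {A B : VField n D} (hA : SmoothVField A) (hB : SmoothVField B) :
      mlieBracket (𝓡∂ n) A (mlieBracket (𝓡∂ n) B (f • Z)) x =
      mvfderiv (𝓡∂ n) (fun y ↦ mvfderiv (𝓡∂ n) f y (B y)) x (A x) • Z x +
      mvfderiv (𝓡∂ n) f x (B x) • mlieBracket (𝓡∂ n) A Z x +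
      (mvfderiv (𝓡∂ n) f x (A x) • mlieBracket (𝓡∂ n) B Z x +
      f x • mlieBracket (𝓡∂ n) A (mlieBracket (𝓡∂ n) B Z) x) := by
    have hBf := contMDiff_mvfderiv_apply hf hB
    rw [br hB hf hZ, brs hA (SmoothVField.smul hBf hZ) (SmoothVField.smul hf (hB.mlieBracket hZ)),
      br hA hBf hZ, br hA hf (hB.mlieBracket hZ)]
    rfl
  have h1 := jacobi_mlieBracket hX hY (SmoothVField.smul hf hZ) x
  rw [e hX hY, e hY hX, br (hX.mlieBracket hY) hf hZ] at h1
  have h2 := jacobi_mlieBracket hX hY hZ x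
  rw [h2] at h1
  have h3 : (mvfderiv (𝓡∂ n) f x (mlieBracket (𝓡∂ n) X Y x) -
      (mvfderiv (𝓡∂ n) (fun y ↦ mvfderiv (𝓡∂ n) f y (Y y)) x (X x) -
        mvfderiv (𝓡∂ n) (fun y ↦ mvfderiv (𝓡∂ n) f y (X y)) x (Y x))) • Z x = 0 := by
    rw [Pi.add_apply, Pi.smul_apply', Pi.smul_apply'] at h1
    refine Eq.trans ?_ ((congrArg Neg.neg (sub_eq_zero.2 h1)).trans neg_zero)
    module
  exact sub_eq_zero.1 ((smul_eq_zero.1 h3).resolve_right hne)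

end LieCalculus

/-! ### Algebra of smooth families and calculus of the Lie derivative -/

section FamilyCalculus

set_option linter.unusedSectionVars false

open Set Topology

variable {n : ℕ} [NeZero n] {D : Type*} [TopologicalSpace D]
  [ChartedSpace (EuclideanHalfSpace n) D] [IsManifold (𝓡∂ n) ∞ D]
  {P : Type} [NormedAddCommGroup P] [NormedSpace ℝ P]

/-! ### Algebra of fields and families -/

theorem SmoothVField.add {X Y : VField n D} (hX : SmoothVField X) (hY : SmoothVField Y) :
    SmoothVField (X + Y) := ContMDiff.add_section hX hY

theorem SmoothVField.sub {X Y : VField n D} (hX : SmoothVField X) (hY : SmoothVField Y) :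
    SmoothVField (X - Y) := ContMDiff.sub_section hX hY

theorem SmoothVField.const_smul {X : VField n D} (hX : SmoothVField X) (c : ℝ) :
    SmoothVField (c • X) := ContMDiff.const_smul_section hX

theorem SmoothFamily.add {f g : P → D → ℝ} (hf : SmoothFamily n f) (hg : SmoothFamily n g) :
    SmoothFamily n (f + g) := ContMDiff.add hf hg

theorem SmoothFamily.sub {f g : P → D → ℝ} (hf : SmoothFamily n f) (hg : SmoothFamily n g) :
    SmoothFamily n (f - g) := ContMDiff.sub hf hg

theorem SmoothFamily.const_smul {f : P → D → ℝ} (hf : SmoothFamily n f) (c : ℝ) :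
    SmoothFamily n (c • f) := contMDiff_const.mul hf

theorem CField.neg_one_smul (u : CField n D) : (-1 : ℝ) • u = -u := by
  funext x
  ext w
  simp

theorem SmoothCField.apply {u : CField n D} (hu : SmoothCField u) {X : VField n D}
    (hX : SmoothVField X) : ContMDiff (𝓡∂ n) 𝓘(ℝ, ℝ) ∞ (fun x ↦ u x (X x)) :=
  ((hu.family (P := ℝ)).apply hX.family).slice 0

theorem _root_.ContMDiff.mdiff {f : D → ℝ} (hf : ContMDiff (𝓡∂ n) 𝓘(ℝ, ℝ) ∞ f) (x : D) :
    MDifferentiableAt (𝓡∂ n) 𝓘(ℝ, ℝ) f x := (hf x).mdifferentiableAt (by simp)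

theorem mvfderiv_const_mul {f : D → ℝ} {x : D} (hf : MDifferentiableAt (𝓡∂ n) 𝓘(ℝ, ℝ) f x) (c : ℝ)
    (w : TangentSpace (𝓡∂ n) x) :
    mvfderiv (𝓡∂ n) (fun x ↦ c * f x) x w = c * mvfderiv (𝓡∂ n) f x w := by
  have h3 := mvfderiv_mul (mdifferentiableAt_const (c := c)) hf
  refine (congrArg (fun L : TangentSpace (𝓡∂ n) x →L[ℝ] ℝ ↦ L w) h3).trans ?_
  simp [mvfderiv_const]

theorem mvfderiv_fun_add {f g : D → ℝ} {x : D} (hf : MDifferentiableAt (𝓡∂ n) 𝓘(ℝ, ℝ) f x)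
    (hg : MDifferentiableAt (𝓡∂ n) 𝓘(ℝ, ℝ) g x) (w : TangentSpace (𝓡∂ n) x) :
    mvfderiv (𝓡∂ n) (fun x ↦ f x + g x) x w = mvfderiv (𝓡∂ n) f x w + mvfderiv (𝓡∂ n) g x w :=
  congrArg (fun L : TangentSpace (𝓡∂ n) x →L[ℝ] ℝ ↦ L w) (mvfderiv_add hf hg)

theorem mvfderiv_fun_sub {f g : D → ℝ} {x : D} (hf : MDifferentiableAt (𝓡∂ n) 𝓘(ℝ, ℝ) f x)
    (hg : MDifferentiableAt (𝓡∂ n) 𝓘(ℝ, ℝ) g x) (w : TangentSpace (𝓡∂ n) x) :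
    mvfderiv (𝓡∂ n) (fun x ↦ f x - g x) x w = mvfderiv (𝓡∂ n) f x w - mvfderiv (𝓡∂ n) g x w :=
  congrArg (fun L : TangentSpace (𝓡∂ n) x →L[ℝ] ℝ ↦ L w) (mvfderiv_sub hf hg)

theorem differential_sub {f g : D → ℝ} (hf : ContMDiff (𝓡∂ n) 𝓘(ℝ, ℝ) ∞ f)
    (hg : ContMDiff (𝓡∂ n) 𝓘(ℝ, ℝ) ∞ g) :
    (differential (f - g) : CField n D) = differential f - differential g :=
  funext fun x ↦ mvfderiv_sub (hf.mdiff x) (hg.mdiff x)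

variable [T2Space D]

theorem SmoothVFamily.add {X Y : P → VField n D} (hX : SmoothVFamily X) (hY : SmoothVFamily Y) :
    SmoothVFamily (X + Y) := smoothVFamily_of_probe fun f hf ↦ by
  have := (smoothFamily_const hf).mvfderiv_apply hX
  simpa [SmoothFamily] using this.add ((smoothFamily_const hf).mvfderiv_apply hY)

theorem SmoothVFamily.const_smul {X : P → VField n D} (hX : SmoothVFamily X) (c : ℝ) :
    SmoothVFamily (c • X) := smoothVFamily_of_probe fun f hf ↦ by
  simpa [SmoothFamily] using! ((smoothFamily_const hf).mvfderiv_apply hX).const_smul c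

theorem SmoothVFamily.neg {X : P → VField n D} (hX : SmoothVFamily X) :
    SmoothVFamily (-X) := by
  simpa using hX.const_smul (-1)

theorem SmoothVFamily.sub {X Y : P → VField n D} (hX : SmoothVFamily X) (hY : SmoothVFamily Y) :
    SmoothVFamily (X - Y) := by
  simpa [sub_eq_add_neg] using hX.add hY.neg

theorem SmoothCFamily.add {u w : P → CField n D} (hu : SmoothCFamily u) (hw : SmoothCFamily w) :
    SmoothCFamily (u + w) := smoothCFamily_of_probe fun _ hY ↦
  (hu.apply hY.family).add (hw.apply hY.family)

theorem SmoothCFamily.const_smul {u : P → CField n D} (hu : SmoothCFamily u) (c : ℝ) :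
    SmoothCFamily (c • u) := smoothCFamily_of_probe fun _ hY ↦
  (hu.apply hY.family).const_smul c

theorem SmoothCFamily.neg {u : P → CField n D} (hu : SmoothCFamily u) :
    SmoothCFamily (-u) := by
  have e : -u = (-1 : ℝ) • u := by
    funext p
    exact (CField.neg_one_smul _).symm
  exact e ▸ hu.const_smul (-1)

theorem SmoothCFamily.sub {u w : P → CField n D} (hu : SmoothCFamily u) (hw : SmoothCFamily w) :
    SmoothCFamily (u - w) := by
  simpa [sub_eq_add_neg] using hu.add hw.neg

theorem SmoothFamily.differential {f : P → D → ℝ} (hf : SmoothFamily n f) :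
    SmoothCFamily (fun p ↦ (differential (f p) : CField n D)) :=
  smoothCFamily_of_probe fun _ hY ↦ hf.mvfderiv_apply hY.family

theorem smoothCField_of_probe {u : CField n D}
    (h : ∀ Y : VField n D, SmoothVField Y → ContMDiff (𝓡∂ n) 𝓘(ℝ, ℝ) ∞ (fun x ↦ u x (Y x))) :
    SmoothCField u :=
  (smoothCFamily_of_probe (P := ℝ) (u := fun _ ↦ u) fun Y hY ↦ smoothFamily_const (h Y hY)).slice 0

theorem SmoothCField.add {u w : CField n D} (hu : SmoothCField u) (hw : SmoothCField w) :
    SmoothCField (u + w) := smoothCField_of_probe fun _ hY ↦ (hu.apply hY).add (hw.apply hY)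

theorem SmoothCField.const_smul {u : CField n D} (hu : SmoothCField u) (c : ℝ) :
    SmoothCField (c • u) := smoothCField_of_probe fun _ hY ↦ contMDiff_const.mul (hu.apply hY)

theorem smoothCField_differential {f : D → ℝ} (hf : ContMDiff (𝓡∂ n) 𝓘(ℝ, ℝ) ∞ f) :
    SmoothCField (differential f : CField n D) :=
  smoothCField_of_probe fun _ hY ↦ contMDiff_mvfderiv_apply hf hY

/-! ### Lie derivatives -/

theorem SmoothVFamily.mlieBracket {X Y : P → VField n D} (hX : SmoothVFamily X)
    (hY : SmoothVFamily Y) : SmoothVFamily (fun p ↦ mlieBracket (𝓡∂ n) (X p) (Y p)) :=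
  smoothVFamily_of_probe fun f hf ↦ by
    simp only [mvfderiv_mlieBracket (hX.slice _) (hY.slice _) hf]
    exact (((smoothFamily_const hf).mvfderiv_apply hY).mvfderiv_apply hX).sub
      (((smoothFamily_const hf).mvfderiv_apply hX).mvfderiv_apply hY)

theorem lieDeriv_apply' {X Y : VField n D} {u : CField n D} (hu : SmoothCField u)
    (hY : SmoothVField Y) (x : D) : lieDeriv X u x (Y x) =
      mvfderiv (𝓡∂ n) (fun y ↦ u y (Y y)) x (X x) - u x (VectorField.mlieBracket (𝓡∂ n) X Y x) :=
  lieDeriv_apply hu (hY.mdiffAt x)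

theorem SmoothCFamily.lieDeriv {X : P → VField n D} (hX : SmoothVFamily X) {u : P → CField n D}
    (hu : SmoothCFamily u) : SmoothCFamily (fun p ↦ lieDeriv (X p) (u p)) :=
  smoothCFamily_of_probe fun Y hY ↦ by
    simp only [lieDeriv_apply' (hu.slice _) hY]
    exact ((hu.apply hY.family).mvfderiv_apply hX).sub (hu.apply (hX.mlieBracket hY.family))

theorem SmoothCField.lieDeriv {X : VField n D} (hX : SmoothVField X) {u : CField n D}
    (hu : SmoothCField u) : SmoothCField (lieDeriv X u) :=
  ((SmoothCFamily.lieDeriv (P := ℝ) hX.family hu.family).slice 0)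

theorem lieDeriv_add_right {X : VField n D} {u w : CField n D} (hu : SmoothCField u)
    (hw : SmoothCField w) : lieDeriv X (u + w) = lieDeriv X u + lieDeriv X w := by
  funext x
  refine covector_ext fun Y hY ↦ ?_
  simp only [Pi.add_apply, add_apply]
  rw [lieDeriv_apply' (hu.add hw) hY, lieDeriv_apply' hu hY, lieDeriv_apply' hw hY]
  simp only [Pi.add_apply, add_apply]
  rw [mvfderiv_fun_add ((hu.apply hY).mdiff x) ((hw.apply hY).mdiff x)]
  ring

theorem lieDeriv_const_smul_right {X : VField n D} {u : CField n D} (hu : SmoothCField u) (c : ℝ) :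
    lieDeriv X (c • u) = c • lieDeriv X u := by
  funext x
  refine covector_ext fun Y hY ↦ ?_
  simp only [Pi.smul_apply, smul_apply, smul_eq_mul]
  rw [lieDeriv_apply' (hu.const_smul c) hY, lieDeriv_apply' hu hY]
  simp only [Pi.smul_apply, smul_apply, smul_eq_mul]
  rw [mvfderiv_const_mul ((hu.apply hY).mdiff x)]
  ring

theorem lieDeriv_neg_right {X : VField n D} {u : CField n D} (hu : SmoothCField u) :
    lieDeriv X (-u) = -lieDeriv X u := by
  rw [← CField.neg_one_smul, lieDeriv_const_smul_right hu, CField.neg_one_smul]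

theorem lieDeriv_sub_right {X : VField n D} {u w : CField n D} (hu : SmoothCField u)
    (hw : SmoothCField w) : lieDeriv X (u - w) = lieDeriv X u - lieDeriv X w := by
  have hw' : SmoothCField (-w) := by
    rw [← CField.neg_one_smul]
    exact hw.const_smul (-1)
  rw [sub_eq_add_neg, lieDeriv_add_right hu hw', lieDeriv_neg_right hw, sub_eq_add_neg]

theorem lieDeriv_add_left {X X' : VField n D} (hX : SmoothVField X) (hX' : SmoothVField X')
    {u : CField n D} (hu : SmoothCField u) :
    lieDeriv (X + X') u = lieDeriv X u + lieDeriv X' u := by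
  funext x
  refine covector_ext fun Y hY ↦ ?_
  simp only [Pi.add_apply, add_apply]
  rw [lieDeriv_apply' hu hY, lieDeriv_apply' hu hY, lieDeriv_apply' hu hY, Pi.add_apply,
    mlieBracket_add_left (hX.mdiffAt x) (hX'.mdiffAt x), map_add, map_add]
  ring

theorem lieDeriv_const_smul_left {X : VField n D} (hX : SmoothVField X)
    {u : CField n D} (hu : SmoothCField u) (c : ℝ) :
    lieDeriv (c • X) u = c • lieDeriv X u := by
  funext x
  refine covector_ext fun Y hY ↦ ?_
  simp only [Pi.smul_apply, smul_apply, smul_eq_mul]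
  rw [lieDeriv_apply' hu hY, lieDeriv_apply' hu hY, Pi.smul_apply,
    mlieBracket_const_smul_left (hX.mdiffAt x), map_smul, map_smul]
  simp only [smul_eq_mul]
  ring

/-- This is `mvfderiv_mlieBracket` read as a statement about 1-forms. It is what lets `𝓛_X` descend
to `Ω¹(D)/dΩ⁰(D)`. -/
theorem lieDeriv_differential {X : VField n D} (hX : SmoothVField X) {f : D → ℝ}
    (hf : ContMDiff (𝓡∂ n) 𝓘(ℝ, ℝ) ∞ f) :
    lieDeriv X (differential f) = differential (fun x ↦ mvfderiv (𝓡∂ n) f x (X x)) := by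
  funext x
  refine covector_ext fun Y hY ↦ ?_
  rw [lieDeriv_apply' (smoothCField_differential hf) hY]
  simp only [differential]
  rw [mvfderiv_mlieBracket hX hY hf]
  ring

/-- Evaluated on `Z`, the mixed terms are symmetric in the two fields and cancel. The second
derivatives of `u(Z)` combine by `mvfderiv_mlieBracket`, the iterated brackets by Jacobi. -/
theorem lieDeriv_commutator {X Y : VField n D} (hX : SmoothVField X) (hY : SmoothVField Y)
    {u : CField n D} (hu : SmoothCField u) :
    lieDeriv X (lieDeriv Y u) - lieDeriv Y (lieDeriv X u) =
      lieDeriv (mlieBracket (𝓡∂ n) X Y) u := by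
  funext x
  refine covector_ext fun Z hZ ↦ ?_
  have e {A B : VField n D} (hA : SmoothVField A) (hB : SmoothVField B) :
      lieDeriv A (lieDeriv B u) x (Z x) =
      mvfderiv (𝓡∂ n) (fun y ↦ mvfderiv (𝓡∂ n) (fun y ↦ u y (Z y)) y (B y)) x (A x)
      - mvfderiv (𝓡∂ n) (fun y ↦ u y (mlieBracket (𝓡∂ n) B Z y)) x (A x)
      - (mvfderiv (𝓡∂ n) (fun y ↦ u y (mlieBracket (𝓡∂ n) A Z y)) x (B x)
        - u x (mlieBracket (𝓡∂ n) B (mlieBracket (𝓡∂ n) A Z) x)) := by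
    rw [lieDeriv_apply' (hu.lieDeriv hB) hZ, lieDeriv_apply' hu (hA.mlieBracket hZ)]
    simp only [lieDeriv_apply' hu hZ]
    rw [mvfderiv_fun_sub ((contMDiff_mvfderiv_apply (hu.apply hZ) hB).mdiff x)
      ((hu.apply (hB.mlieBracket hZ)).mdiff x)]
  simp only [Pi.sub_apply, sub_apply]
  rw [e hX hY, e hY hX, lieDeriv_apply' hu hZ, mvfderiv_mlieBracket hX hY (hu.apply hZ),
    jacobi_mlieBracket hX hY hZ, map_add]
  ring

end FamilyCalculus

/-! ### Integrals of curves of vector fields and of 1-forms -/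

section FieldIntegrals

set_option linter.unusedSectionVars false

open Set Topology

variable {n : ℕ} [NeZero n] {D : Type*} [TopologicalSpace D]
  [ChartedSpace (EuclideanHalfSpace n) D] [IsManifold (𝓡∂ n) ∞ D]
  {P : Type} [NormedAddCommGroup P] [NormedSpace ℝ P]

/-- The integral `∫_a^b X dr` of a curve of vector fields. -/
def integralV (X : ℝ → VField n D) (a b : ℝ) : VField n D := fun x ↦
  intervalIntegral (E := EuclideanSpace ℝ (Fin n)) (fun r ↦ X r x) a b MeasureTheory.volume

/-- The integral `∫_a^b u dr` of a curve of 1-forms. -/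
def integralC (u : ℝ → CField n D) (a b : ℝ) : CField n D := fun x ↦
  intervalIntegral (E := EuclideanSpace ℝ (Fin n) →L[ℝ] ℝ) (fun r ↦ u r x) a b
    MeasureTheory.volume

/-- At a fixed point the trivialization is a fixed linear isomorphism, so it can be applied and then
undone. This makes the pointwise integrals and time derivatives of fields meaningful. -/
theorem SmoothVFamily.contDiff_apply {X : P → VField n D} (hX : SmoothVFamily X) (x : D) :
    ContDiff ℝ ∞ (F := EuclideanSpace ℝ (Fin n)) (fun p ↦ X p x) := by
  let t := trivializationAt (EuclideanSpace ℝ (Fin n)) (TangentSpace (𝓡∂ n) : D → Type _) x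
  have hx := FiberBundle.mem_baseSet_trivializationAt' (F := EuclideanSpace ℝ (Fin n))
    (E := (TangentSpace (𝓡∂ n) : D → Type _)) x
  have h1 : ContDiff ℝ ∞ (F := EuclideanSpace ℝ (Fin n))
      (fun p ↦ t.continuousLinearMapAt ℝ x (X p x)) := by
    rw [← contMDiff_iff_contDiff]
    intro p
    have h := (Bundle.contMDiffAt_totalSpace.1 (hX (p, x))).2
    have h2 := h.comp (I := 𝓘(ℝ, P)) (f := fun p : P ↦ (p, x)) p
      (contMDiff_id.prodMk contMDiff_const).contMDiffAt
    refine h2.congr_of_eventuallyEq (Filter.Eventually.of_forall fun p ↦ ?_)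
    exact congrFun (Bundle.Trivialization.coe_linearMapAt_of_mem (R := ℝ) t hx) (X p x)
  have h2 : ContDiff ℝ ∞ (F := EuclideanSpace ℝ (Fin n))
      (fun p ↦ t.symmL ℝ x (t.continuousLinearMapAt ℝ x (X p x))) :=
    ContinuousLinearMap.contDiff (E := EuclideanSpace ℝ (Fin n)) (F := EuclideanSpace ℝ (Fin n))
      (t.symmL ℝ x) |>.comp h1
  have e : (fun p ↦ X p x) = (fun p ↦ t.symmL ℝ x (t.continuousLinearMapAt ℝ x (X p x))) :=
    funext fun p ↦ (t.symmL_continuousLinearMapAt hx _).symm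
  rw [e]
  exact h2

theorem mvfderiv_integralV {X : ℝ → VField n D} (hX : SmoothVFamily X) (f : D → ℝ) (a b : ℝ)
    (x : D) : mvfderiv (𝓡∂ n) f x (integralV X a b x) =
      ∫ r in a..b, mvfderiv (𝓡∂ n) f x (X r x) :=
  (ContinuousLinearMap.intervalIntegral_comp_comm (E := EuclideanSpace ℝ (Fin n))
    (mvfderiv (𝓡∂ n) f x) ((hX.contDiff_apply x).continuous.intervalIntegrable a b)).symm

theorem apply_integralV {X : ℝ → VField n D} (hX : SmoothVFamily X) {x : D}
    (α : TangentSpace (𝓡∂ n) x →L[ℝ] ℝ) (a b : ℝ) :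
    α (integralV X a b x) = ∫ r in a..b, α (X r x) :=
  (ContinuousLinearMap.intervalIntegral_comp_comm (E := EuclideanSpace ℝ (Fin n))
    α ((hX.contDiff_apply x).continuous.intervalIntegrable a b)).symm

variable [T2Space D]

theorem SmoothCFamily.contDiff_apply {u : P → CField n D} (hu : SmoothCFamily u) (x : D) :
    ContDiff ℝ ∞ (F := EuclideanSpace ℝ (Fin n) →L[ℝ] ℝ) (fun p ↦ u p x) := by
  have h (v : EuclideanSpace ℝ (Fin n)) : ContDiff ℝ ∞ (fun p ↦ u p x v) := by
    obtain ⟨Y, hY, hYx⟩ := exists_smoothVField_apply (n := n) (x := x) v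
    rw [← hYx]
    exact (hu.apply hY.family).contDiff_apply x
  have e : (fun p ↦ (u p x : EuclideanSpace ℝ (Fin n) →L[ℝ] ℝ)) = fun p ↦
      ∑ j, u p x (EuclideanSpace.basisFun (Fin n) ℝ j) •
        (EuclideanSpace.proj j : EuclideanSpace ℝ (Fin n) →L[ℝ] ℝ) := by
    funext p
    refine ContinuousLinearMap.coe_injective
      ((EuclideanSpace.basisFun (Fin n) ℝ).toBasis.ext fun i ↦ ?_)
    simp
    rfl
  rw [e]
  exact ContDiff.sum fun j _ ↦ (h _).smul contDiff_const

theorem integralC_apply {u : ℝ → CField n D} (hu : SmoothCFamily u) (a b : ℝ) (x : D)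
    (v : TangentSpace (𝓡∂ n) x) : integralC u a b x v = ∫ r in a..b, u r x v :=
  ContinuousLinearMap.intervalIntegral_apply (F := EuclideanSpace ℝ (Fin n)) (E := ℝ)
    (φ := fun r ↦ u r x)
    ((hu.contDiff_apply x).continuous.intervalIntegrable a b) v

theorem SmoothVFamily.integral {X : ℝ × P → VField n D} (hX : SmoothVFamily X) {a b : P → ℝ}
    (ha : ContDiff ℝ ∞ a) (hb : ContDiff ℝ ∞ b) :
    SmoothVFamily (fun p ↦ integralV (fun r ↦ X (r, p)) (a p) (b p)) :=
  smoothVFamily_of_probe fun f hf ↦ by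
    have h (p : P) : SmoothVFamily (fun r ↦ X (r, p)) :=
      hX.comp_param (g := fun r : ℝ ↦ (r, p)) (by fun_prop)
    simp only [mvfderiv_integralV (h _)]
    exact ((smoothFamily_const hf).mvfderiv_apply hX).integral ha hb

theorem SmoothCFamily.integral {u : ℝ × P → CField n D} (hu : SmoothCFamily u) {a b : P → ℝ}
    (ha : ContDiff ℝ ∞ a) (hb : ContDiff ℝ ∞ b) :
    SmoothCFamily (fun p ↦ integralC (fun r ↦ u (r, p)) (a p) (b p)) :=
  smoothCFamily_of_probe fun Y hY ↦ by
    have h (p : P) : SmoothCFamily (fun r ↦ u (r, p)) :=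
      hu.comp_param (g := fun r : ℝ ↦ (r, p)) (by fun_prop)
    simp only [integralC_apply (h _)]
    exact (hu.apply hY.family).integral ha hb

theorem SmoothVFamily.integralV {X : ℝ → VField n D} (hX : SmoothVFamily X) (a b : ℝ) :
    SmoothVField (integralV X a b) :=
  ((hX.comp_param (g := fun q : ℝ × ℝ ↦ q.1) (by fun_prop)).integral (a := fun _ ↦ a)
    (b := fun _ ↦ b) contDiff_const contDiff_const).slice 0

theorem SmoothCFamily.integralC {u : ℝ → CField n D} (hu : SmoothCFamily u) (a b : ℝ) :
    SmoothCField (integralC u a b) :=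
  ((hu.comp_param (g := fun q : ℝ × ℝ ↦ q.1) (by fun_prop)).integral (a := fun _ ↦ a)
    (b := fun _ ↦ b) contDiff_const contDiff_const).slice 0

theorem integral_differential {f : ℝ → D → ℝ} (hf : SmoothFamily n f) (a b : ℝ) :
    integralC (fun r ↦ (differential (f r) : CField n D)) a b =
      differential (fun x ↦ ∫ r in a..b, f r x) := by
  funext x
  ext w
  rw [integralC_apply hf.differential]
  exact (hf.mvfderiv_integral a b x w).symm

/-- Tested on functions, the bracket is a difference of iterated derivatives, each of which commutes
with the integral. -/
theorem mlieBracket_integralV_left {X : ℝ → VField n D} (hX : SmoothVFamily X) {Y : VField n D}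
    (hY : SmoothVField Y) (a b : ℝ) : mlieBracket (𝓡∂ n) (integralV X a b) Y =
      integralV (fun r ↦ mlieBracket (𝓡∂ n) (X r) Y) a b := by
  funext x
  refine eq_of_forall_mvfderiv fun f hf ↦ ?_
  have hXY := hX.mlieBracket hY.family
  have hXf := (smoothFamily_const hf).mvfderiv_apply hX
  have hYf := contMDiff_mvfderiv_apply hf hY
  rw [mvfderiv_mlieBracket (hX.integralV a b) hY hf, mvfderiv_integralV hX,
    mvfderiv_integralV hXY]
  simp only [mvfderiv_integralV hX, mvfderiv_mlieBracket (hX.slice _) hY hf]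
  rw [intervalIntegral.integral_sub]
  -- Only this term, where `Y` acts last, needs differentiation in the point under the integral. In
  -- the other one the integrated field enters linearly at `x`.
  · exact congrArg _ (hXf.mvfderiv_integral a b x (Y x))
  · exact (((smoothFamily_const hYf).mvfderiv_apply hX).contDiff_apply
      x).continuous.intervalIntegrable _ _
  · exact ((hXf.mvfderiv_apply hY.family).contDiff_apply x).continuous.intervalIntegrable _ _

theorem lieDeriv_integralV {X : ℝ → VField n D} (hX : SmoothVFamily X) {u : CField n D}
    (hu : SmoothCField u) (a b : ℝ) : lieDeriv (integralV X a b) u =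
      integralC (fun r ↦ lieDeriv (X r) u) a b := by
  funext x
  refine covector_ext fun Y hY ↦ ?_
  have hXY := hX.mlieBracket hY.family
  rw [lieDeriv_apply' hu hY, integralC_apply (SmoothCFamily.lieDeriv hX hu.family),
    mlieBracket_integralV_left hX hY, mvfderiv_integralV hX, apply_integralV hXY]
  simp only [lieDeriv_apply' hu hY]
  rw [intervalIntegral.integral_sub]
  · exact (((smoothFamily_const (hu.apply hY)).mvfderiv_apply hX).contDiff_apply
      x).continuous.intervalIntegrable _ _
  · exact ((hu.family.apply hXY).contDiff_apply x).continuous.intervalIntegrable _ _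

theorem lieDeriv_integralC {X : VField n D} (hX : SmoothVField X) {u : ℝ → CField n D}
    (hu : SmoothCFamily u) (a b : ℝ) : lieDeriv X (integralC u a b) =
      integralC (fun r ↦ lieDeriv X (u r)) a b := by
  funext x
  refine covector_ext fun Y hY ↦ ?_
  have huY := hu.apply hY.family
  rw [lieDeriv_apply' (hu.integralC a b) hY, integralC_apply (SmoothCFamily.lieDeriv hX.family hu)]
  simp only [lieDeriv_apply' (hu.slice _) hY, integralC_apply hu]
  rw [intervalIntegral.integral_sub]
  · exact congrArg (· - _) (huY.mvfderiv_integral a b x (X x))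
  · exact ((huY.mvfderiv_apply hX.family).contDiff_apply x).continuous.intervalIntegrable _ _
  · exact ((hu.apply (hX.mlieBracket hY).family).contDiff_apply x).continuous.intervalIntegrable _ _

theorem integralC_add {u w : ℝ → CField n D} (hu : SmoothCFamily u) (hw : SmoothCFamily w)
    (a b : ℝ) : integralC (fun r ↦ u r + w r) a b = integralC u a b + integralC w a b :=
  funext fun x ↦ intervalIntegral.integral_add (E := EuclideanSpace ℝ (Fin n) →L[ℝ] ℝ)
    ((hu.contDiff_apply x).continuous.intervalIntegrable a b)
    ((hw.contDiff_apply x).continuous.intervalIntegrable a b)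

theorem integralC_const_smul (u : ℝ → CField n D) (c a b : ℝ) :
    integralC (fun r ↦ c • u r) a b = c • integralC u a b :=
  funext fun _ ↦ intervalIntegral.integral_smul (E := EuclideanSpace ℝ (Fin n) →L[ℝ] ℝ) c _

theorem integralC_neg (u : ℝ → CField n D) (a b : ℝ) :
    integralC (fun r ↦ -u r) a b = -integralC u a b :=
  funext fun _ ↦ intervalIntegral.integral_neg (E := EuclideanSpace ℝ (Fin n) →L[ℝ] ℝ)

theorem integralC_const (u : CField n D) (a b : ℝ) :
    integralC (fun _ ↦ u) a b = (b - a) • u :=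
  funext fun x ↦ intervalIntegral.integral_const (E := EuclideanSpace ℝ (Fin n) →L[ℝ] ℝ) (u x)

theorem integralV_const_smul (X : ℝ → VField n D) (c a b : ℝ) :
    integralV (fun r ↦ c • X r) a b = c • integralV X a b :=
  funext fun _ ↦ intervalIntegral.integral_smul (E := EuclideanSpace ℝ (Fin n)) c _

theorem integralV_sub {X Y : ℝ → VField n D} (hX : SmoothVFamily X) (hY : SmoothVFamily Y)
    (a b : ℝ) : integralV (fun r ↦ X r - Y r) a b = integralV X a b - integralV Y a b :=
  funext fun x ↦ intervalIntegral.integral_sub (E := EuclideanSpace ℝ (Fin n))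
    ((hX.contDiff_apply x).continuous.intervalIntegrable a b)
    ((hY.contDiff_apply x).continuous.intervalIntegrable a b)

theorem avgV_eq (X : ℝ → VField n D) :
    avgV X = (2 * Real.pi)⁻¹ • integralV X 0 (2 * Real.pi) := rfl

theorem avgC_eq (u : ℝ → CField n D) :
    avgC u = (2 * Real.pi)⁻¹ • integralC u 0 (2 * Real.pi) := rfl

end FieldIntegrals

/-! ### Closure of `SVect(D)` under linear operations, brackets and integrals -/

section SVectClosure

set_option linter.unusedSectionVars false

open Set Topology

variable {n : ℕ} [NeZero n] {D : Type*} [TopologicalSpace D] [T2Space D]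
  [ChartedSpace (EuclideanHalfSpace n) D] [IsManifold (𝓡∂ n) ∞ D]
  [Bundle.RiemannianBundle (fun x : D ↦ TangentSpace (𝓡∂ n) x)]
  {P : Type} [NormedAddCommGroup P] [NormedSpace ℝ P] {ν : TopForm n D}

theorem exists_continuousLinearMap_eq {x : D} (α : TangentSpace (𝓡∂ n) x →ₗ[ℝ] ℝ) :
    ∃ L : TangentSpace (𝓡∂ n) x →L[ℝ] ℝ, ∀ v, L v = α v :=
  haveI : FiniteDimensional ℝ (TangentSpace (𝓡∂ n) x) :=
    inferInstanceAs (FiniteDimensional ℝ (EuclideanSpace ℝ (Fin n)))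
  ⟨LinearMap.toContinuousLinearMap α, fun _ ↦ rfl⟩

theorem mvfderiv_finset_sum {ι : Type*} (s : Finset ι) {f : ι → D → ℝ}
    (hf : ∀ i, ContMDiff (𝓡∂ n) 𝓘(ℝ, ℝ) ∞ (f i)) (x : D) (w : TangentSpace (𝓡∂ n) x) :
    mvfderiv (𝓡∂ n) (fun y ↦ ∑ i ∈ s, f i y) x w = ∑ i ∈ s, mvfderiv (𝓡∂ n) (f i) x w := by
  classical
  induction s using Finset.induction_on with
  | empty => simp [mvfderiv_const]
  | insert a s ha ih =>
    simp only [Finset.sum_insert ha]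
    rw [mvfderiv_fun_add ((hf a).mdiff x) ((contMDiff_finsetSum fun i _ ↦ hf i).mdiff x), ih]

theorem update_apply_field (Y : Fin n → VField n D) (i : Fin n) (Z : VField n D) (x : D) :
    (fun j ↦ Function.update Y i Z j x) = Function.update (fun j ↦ Y j x) i (Z x) := by
  funext j
  by_cases h : j = i
  · subst h; simp
  · simp [h]

theorem smooth_update {Y : Fin n → VField n D} (hY : ∀ i, SmoothVField (Y i)) (i : Fin n)
    {Z : VField n D} (hZ : SmoothVField Z) (j : Fin n) :
    SmoothVField (Function.update Y i Z j) := by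
  by_cases h : j = i
  · subst h; simpa using hZ
  · simpa [h] using hY j

theorem IsSVect.add {X X' : VField n D} (hX : IsSVect ν X) (hX' : IsSVect ν X') :
    IsSVect ν (X + X') where
  smooth := hX.smooth.add hX'.smooth
  div_free Y hY x := by
    rw [Pi.add_apply, map_add, hX.div_free Y hY x, hX'.div_free Y hY x, ← Finset.sum_add_distrib]
    refine Finset.sum_congr rfl fun i _ ↦ ?_
    rw [mlieBracket_add_left (hX.smooth.mdiffAt x) (hX'.smooth.mdiffAt x),
      AlternatingMap.map_update_add]
  tangent f hf hb x hx := by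
    rw [Pi.add_apply, map_add, hX.tangent f hf hb x hx, hX'.tangent f hf hb x hx, add_zero]

theorem IsSVect.const_smul {X : VField n D} (hX : IsSVect ν X) (c : ℝ) : IsSVect ν (c • X) where
  smooth := hX.smooth.const_smul c
  div_free Y hY x := by
    rw [Pi.smul_apply, map_smul, hX.div_free Y hY x, Finset.smul_sum]
    refine Finset.sum_congr rfl fun i _ ↦ ?_
    rw [mlieBracket_const_smul_left (hX.smooth.mdiffAt x), AlternatingMap.map_update_smul]
  tangent f hf hb x hx := by
    rw [Pi.smul_apply, map_smul, hX.tangent f hf hb x hx, smul_zero]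

theorem IsSVect.neg {X : VField n D} (hX : IsSVect ν X) : IsSVect ν (-X) := by
  have e : -X = (-1 : ℝ) • X := by
    funext x
    simp
  exact e ▸ hX.const_smul (-1)

theorem IsSVect.sub {X X' : VField n D} (hX : IsSVect ν X) (hX' : IsSVect ν X') :
    IsSVect ν (X - X') := by
  rw [sub_eq_add_neg]
  exact hX.add hX'.neg

/-- The divergence condition reflects `𝓛_{[A, B]} = [𝓛_A, 𝓛_B]` on `ν`: applying it twice yields a
double sum over slots, in which distinct slots commute and equal slots give the Jacobi identity. For
tangency, `B f` again vanishes on the boundary if `f` does, so both second derivatives vanish there.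
-/
theorem IsSVect.mlieBracket (hν : IsVolumeForm ν) {A B : VField n D} (hA : IsSVect ν A)
    (hB : IsSVect ν B) : IsSVect ν (mlieBracket (𝓡∂ n) A B) where
  smooth := hA.smooth.mlieBracket hB.smooth
  div_free Y hY x := by
    have e {A B : VField n D} (hA : IsSVect ν A) (hB : IsSVect ν B) :
        mvfderiv (𝓡∂ n) (fun y ↦ mvfderiv (𝓡∂ n) (fun y ↦ ν y (fun i ↦ Y i y)) y (B y)) x (A x) =
        ∑ i, ∑ j, ν x (Function.update (Function.update (fun j ↦ Y j x) i
          (VectorField.mlieBracket (𝓡∂ n) B (Y i) x)) j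
          (VectorField.mlieBracket (𝓡∂ n) A
            (Function.update Y i (VectorField.mlieBracket (𝓡∂ n) B (Y i)) j) x)) := by
      have h1 (i : Fin n) (y : D) : ν y (Function.update (fun j ↦ Y j y) i
          (VectorField.mlieBracket (𝓡∂ n) B (Y i) y)) =
          ν y (fun j ↦ Function.update Y i (VectorField.mlieBracket (𝓡∂ n) B (Y i)) j y) := by
        rw [update_apply_field]
      -- The updated tuples are again tuples of smooth fields, so the divergence identity for `A`
      -- applies to each summand of the one for `B`.
      have hs (i j : Fin n) := smooth_update hY i (hB.smooth.mlieBracket (hY i)) j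
      simp only [hB.div_free Y hY, h1]
      rw [mvfderiv_finset_sum Finset.univ fun i ↦ hν.smooth _ (hs i)]
      refine Finset.sum_congr rfl fun i _ ↦ ?_
      rw [hA.div_free _ (hs i), update_apply_field]
    -- One double sum is transposed so that equal off-diagonal terms meet under the same pair of
    -- indices.
    rw [mvfderiv_mlieBracket hA.smooth hB.smooth (hν.smooth Y hY), e hA hB, e hB hA,
      Finset.sum_comm (γ := Fin n), ← Finset.sum_sub_distrib]
    refine Finset.sum_congr rfl fun i _ ↦ ?_
    rw [← Finset.sum_sub_distrib, Finset.sum_eq_single i]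
    · simp only [Function.update_self, Function.update_idem]
      rw [jacobi_mlieBracket hA.smooth hB.smooth (hY i), AlternatingMap.map_update_add,
        add_sub_cancel_right]
    · intro j _ hj
      rw [Function.update_of_ne hj, Function.update_of_ne hj.symm,
        Function.update_comm hj, sub_self]
    · simp
  tangent f hf hb x hx := by
    rw [mvfderiv_mlieBracket hA.smooth hB.smooth hf,
      hA.tangent _ (contMDiff_mvfderiv_apply hf hB.smooth) (fun y hy ↦ hB.tangent f hf hb y hy) x hx,
      hB.tangent _ (contMDiff_mvfderiv_apply hf hA.smooth) (fun y hy ↦ hA.tangent f hf hb y hy) x hx,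
      sub_self]

/-- Divergence-freeness and tangency are linear conditions on the field, hence pass under the
integral. -/
theorem IsSVect.integralV {X : ℝ → VField n D} (hX : IsSVectFamily ν X) (a b : ℝ) :
    IsSVect ν (integralV X a b) where
  smooth := hX.smooth.integralV a b
  div_free Y hY x := by
    -- Each slot of `ν x`, with the others fixed, is a functional on a finite-dimensional space. Its
    -- continuity is what allows it to commute with the integral.
    choose L hL using fun i : Fin n ↦ exists_continuousLinearMap_eq
      ((ν x).toMultilinearMap.toLinearMap (fun j ↦ Y j x) i)
    replace hL (i : Fin n) (v : TangentSpace (𝓡∂ n) x) :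
        ν x (Function.update (fun j ↦ Y j x) i v) = L i v := (hL i v).symm
    simp only [mvfderiv_integralV hX.smooth, (hX.mem _).div_free Y hY x, hL]
    rw [intervalIntegral.integral_finsetSum]
    · refine Finset.sum_congr rfl fun i _ ↦ ?_
      rw [mlieBracket_integralV_left hX.smooth (hY i),
        apply_integralV (hX.smooth.mlieBracket (hY i).family)]
    · intro i _
      exact Continuous.intervalIntegrable ((L i).continuous.comp
        ((hX.smooth.mlieBracket (hY i).family).contDiff_apply x).continuous) _ _
  tangent f hf hb x hx := by
    rw [mvfderiv_integralV hX.smooth]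
    simp [(hX.mem _).tangent f hf hb x hx]

end SVectClosure

/-! ### Derivatives in the parameter, and exact families -/

section ExactFamilies

set_option linter.unusedSectionVars false

open Set Topology

variable {n : ℕ} [NeZero n] {D : Type*} [TopologicalSpace D] [T2Space D]
  [ChartedSpace (EuclideanHalfSpace n) D] [IsManifold (𝓡∂ n) ∞ D]
  {P Q : Type} [NormedAddCommGroup P] [NormedSpace ℝ P] [NormedAddCommGroup Q] [NormedSpace ℝ Q]

/-! ### Derivatives in the parameter -/

theorem SmoothFamily.fderiv_param {f : P → D → ℝ} (hf : SmoothFamily n f) (w : P) :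
    SmoothFamily n (fun p x ↦ fderiv ℝ (fun q ↦ f q x) p w) := by
  intro q₀
  have h1 := ContMDiffAt.mfderiv (J := 𝓘(ℝ, P).prod (𝓡∂ n)) (I := 𝓘(ℝ, P)) (I' := 𝓘(ℝ, ℝ))
    (x₀ := q₀) (fun (q : P × D) (p : P) ↦ f p q.2) (fun q ↦ q.1) (n := ∞) (m := ∞)
    (ContMDiffAt.comp (I' := 𝓘(ℝ, P).prod (𝓡∂ n)) (g := fun q : P × D ↦ f q.1 q.2)
      (f := fun q : (P × D) × P ↦ (q.2, q.1.2)) _ (hf _)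
      (contMDiff_snd.prodMk (contMDiff_snd.comp contMDiff_fst)).contMDiffAt)
    contMDiffAt_fst (by simp)
  have h2 : ContMDiffAt (𝓘(ℝ, P).prod (𝓡∂ n)) 𝓘(ℝ, P →L[ℝ] ℝ) ∞
      (fun q : P × D ↦ fderiv ℝ (fun p ↦ f p q.2) q.1) q₀ := by
    refine h1.congr_of_eventuallyEq (Filter.Eventually.of_forall fun q ↦ ?_)
    exact (mfderiv_eq_fderiv (𝕜 := ℝ) (f := fun p ↦ f p q.2) (x := q.1)).symm.trans
      (congrFun (inTangentCoordinates_model_space (𝕜 := ℝ) (fun q : P × D ↦ q.1)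
        (fun q : P × D ↦ f q.1 q.2) (fun q ↦ mfderiv 𝓘(ℝ, P) 𝓘(ℝ, ℝ) (fun p ↦ f p q.2) q.1)
        q₀) q).symm
  exact h2.clm_apply contMDiffAt_const

theorem SmoothFamily.hasDerivAt_line {f : P → D → ℝ} (hf : SmoothFamily n f) (w p : P) (x : D)
    (r : ℝ) : HasDerivAt (fun r : ℝ ↦ f (p + r • w) x)
      (fderiv ℝ (fun q ↦ f q x) (p + r • w) w) r := by
  have h1 := ((hf.contDiff_apply x).differentiable (by simp) (p + r • w)).hasFDerivAt
  have h2 : HasDerivAt (fun r : ℝ ↦ p + r • w) w r := by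
    simpa using ((hasDerivAt_id r).smul_const w).const_add p
  exact h1.comp_hasDerivAt r h2

/-- Derivatives in the parameter commute with the differential. -/
theorem SmoothFamily.mvfderiv_fderiv_param {f : P → D → ℝ} (hf : SmoothFamily n f) (w p : P) (x : D)
    (v : TangentSpace (𝓡∂ n) x) :
    mvfderiv (𝓡∂ n) (fun x ↦ fderiv ℝ (fun q ↦ f q x) p w) x v =
      fderiv ℝ (fun q ↦ mvfderiv (𝓡∂ n) (f q) x v) p w := by
  obtain ⟨Y, hY, rfl⟩ := exists_smoothVField_apply v
  have hline : ContDiff ℝ ∞ fun r : ℝ ↦ p + r • w := by fun_prop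
  have hg := (hf.fderiv_param w).comp_param hline
  have hYg := hg.mvfderiv_apply hY.family
  -- Symmetry of mixed derivatives by way of integrals: write `f` along the line as its initial
  -- value plus the integral of its `w`-derivative, apply `Y` under the integral, then differentiate
  -- in `r` at `0` by the fundamental theorem of calculus.
  have e (r : ℝ) : mvfderiv (𝓡∂ n) (f (p + r • w)) x (Y x) = mvfderiv (𝓡∂ n) (f p) x (Y x) +
      ∫ ρ in (0:ℝ)..r, mvfderiv (𝓡∂ n) (fun x ↦ fderiv ℝ (fun q ↦ f q x) (p + ρ • w) w) x (Y x) := by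
    have h1 (y : D) : f (p + r • w) y = f p y +
        ∫ ρ in (0:ℝ)..r, fderiv ℝ (fun q ↦ f q y) (p + ρ • w) w := by
      rw [intervalIntegral.integral_eq_sub_of_hasDerivAt
        (fun ρ _ ↦ hf.hasDerivAt_line w p y ρ)
        ((hg.contDiff_apply y).continuous.intervalIntegrable _ _)]
      simp
    have hint : SmoothFamily n
        (fun (r : ℝ) x ↦ ∫ ρ in (0:ℝ)..r, fderiv ℝ (fun q ↦ f q x) (p + ρ • w) w) :=
      (hg.comp_param (g := fun q : ℝ × ℝ ↦ q.1) (by fun_prop)).integral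
        (a := fun _ ↦ 0) (b := fun r ↦ r) contDiff_const contDiff_id
    rw [funext h1, mvfderiv_fun_add ((hf.slice p).mdiff x) ((hint.slice r).mdiff x)]
    exact congrArg _ (hg.mvfderiv_integral 0 r x (Y x))
  have h1 := (hf.mvfderiv_apply hY.family).hasDerivAt_line w p x 0
  simp only [zero_smul, add_zero] at h1
  refine HasDerivAt.unique ?_ h1
  simp only [e]
  have h2 := intervalIntegral.integral_hasDerivAt_right (a := (0:ℝ)) (b := 0)
    ((hYg.contDiff_apply x).continuous.intervalIntegrable _ _)
    ((hYg.contDiff_apply x).continuous.stronglyMeasurableAtFilter _ _)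
    (hYg.contDiff_apply x).continuous.continuousAt
  simpa using h2.const_add (mvfderiv (𝓡∂ n) (f p) x (Y x))

/-- The derivative of a family of 1-forms in the direction `w` of the parameter space. -/
def paramDerivC (w : P) (u : P → CField n D) : P → CField n D := fun p x ↦
  fderiv ℝ (F := EuclideanSpace ℝ (Fin n) →L[ℝ] ℝ) (fun q ↦ u q x) p w

theorem paramDerivC_apply {u : P → CField n D} (hu : SmoothCFamily u) (w p : P) (x : D)
    (v : TangentSpace (𝓡∂ n) x) :
    paramDerivC w u p x v = fderiv ℝ (fun q ↦ u q x v) p w := by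
  have h := ((hu.contDiff_apply x).differentiable (by simp) p).hasFDerivAt
  have h2 := h.clm_apply (hasFDerivAt_const (E := P) (F := EuclideanSpace ℝ (Fin n)) v p)
  refine Eq.symm ((congrArg (fun L : P →L[ℝ] ℝ ↦ L w) h2.fderiv).trans ?_)
  exact (congrArg (· + _) (map_zero (u p x))).trans (zero_add _)

theorem SmoothCFamily.paramDerivC {u : P → CField n D} (hu : SmoothCFamily u) (w : P) :
    SmoothCFamily (paramDerivC w u) :=
  smoothCFamily_of_probe fun Y hY ↦ by
    simp only [paramDerivC_apply hu]
    exact (hu.apply hY.family).fderiv_param w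

theorem paramDerivC_add {u u' : P → CField n D} (hu : SmoothCFamily u) (hu' : SmoothCFamily u')
    (w : P) : paramDerivC w (u + u') = paramDerivC w u + paramDerivC w u' := by
  funext p x
  exact congrArg (fun L : P →L[ℝ] EuclideanSpace ℝ (Fin n) →L[ℝ] ℝ ↦ L w)
    (fderiv_add ((hu.contDiff_apply x).differentiable (by simp) p)
      ((hu'.contDiff_apply x).differentiable (by simp) p))

/-- The chain rule along a curve in the parameter space. The time, fast and slow derivatives are all
special cases. -/
theorem paramDerivC_line {u : P → CField n D} (hu : SmoothCFamily u) (w p : P) (x : D)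
    {γ : ℝ → P} {t : ℝ} (hγ : HasDerivAt γ w t) (hp : γ t = p) :
    HasDerivAt (F := EuclideanSpace ℝ (Fin n) →L[ℝ] ℝ) (fun r ↦ u (γ r) x)
      (paramDerivC w u p x) t := by
  subst hp
  exact ((hu.contDiff_apply x).differentiable (by simp) (γ t)).hasFDerivAt.comp_hasDerivAt t hγ

theorem timeDerivC_eq {u : ℝ → CField n D} (hu : SmoothCFamily u) :
    timeDerivC u = paramDerivC 1 u := by
  funext t x
  exact (paramDerivC_line hu 1 t x (hasDerivAt_id t) rfl).deriv

theorem fastDeriv_eq {u : ℝ × ℝ → CField n D} (hu : SmoothCFamily u) :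
    fastDeriv u = paramDerivC (0, 1) u := by
  funext p x
  exact (paramDerivC_line hu (0, 1) p x (γ := fun τ ↦ (p.1, τ))
    ((hasDerivAt_const p.2 p.1).prodMk (hasDerivAt_id p.2)) rfl).deriv

theorem slowDeriv_eq {u : ℝ × ℝ → CField n D} (hu : SmoothCFamily u) :
    slowDeriv u = paramDerivC (1, 0) u := by
  funext p x
  exact (paramDerivC_line hu (1, 0) p x (γ := fun s ↦ (s, p.2))
    ((hasDerivAt_id p.1).prodMk (hasDerivAt_const p.1 p.2)) rfl).deriv

theorem hasDerivAt_integralC {u : ℝ → CField n D} (hu : SmoothCFamily u) (a b : ℝ) (x : D) :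
    HasDerivAt (F := EuclideanSpace ℝ (Fin n) →L[ℝ] ℝ) (fun b ↦ integralC u a b x) (u b x) b :=
  intervalIntegral.integral_hasDerivAt_right (E := EuclideanSpace ℝ (Fin n) →L[ℝ] ℝ)
    ((hu.contDiff_apply x).continuous.intervalIntegrable _ _)
    ((hu.contDiff_apply x).continuous.stronglyMeasurableAtFilter _ _)
    (hu.contDiff_apply x).continuous.continuousAt

theorem integralC_fastDeriv {u : ℝ × ℝ → CField n D} (hu : SmoothCFamily u) (s a b : ℝ) :
    integralC (fun r ↦ fastDeriv u (s, r)) a b = u (s, b) - u (s, a) := by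
  funext x
  rw [fastDeriv_eq hu]
  exact intervalIntegral.integral_eq_sub_of_hasDerivAt (E := EuclideanSpace ℝ (Fin n) →L[ℝ] ℝ)
    (f := fun r ↦ u (s, r) x)
    (fun r _ ↦ paramDerivC_line hu (0, 1) (s, r) x (γ := fun τ ↦ (s, τ))
      ((hasDerivAt_const r s).prodMk (hasDerivAt_id r)) rfl)
    (((((hu.paramDerivC (0, 1)).contDiff_apply x).comp
      (contDiff_prodMk_right s)).continuous).intervalIntegrable _ _)

/-! ### Exact families -/

theorem cls_eq_cls_iff {u w : P → CField n D} : cls u = cls w ↔ u - w ∈ exactForms n D P :=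
  Submodule.Quotient.eq _

theorem cls_eq_zero_iff {u : P → CField n D} : cls u = 0 ↔ u ∈ exactForms n D P :=
  Submodule.Quotient.mk_eq_zero _

theorem isAdvected_iff {w : ℝ → VField n D} {u : ℝ → CField n D} : IsAdvected w u ↔
    timeDerivC u + (fun s ↦ lieDeriv (w s) (u s)) ∈ exactForms n D ℝ := by
  rw [IsAdvected, ← sub_eq_zero, sub_neg_eq_add]
  exact cls_eq_zero_iff (u := timeDerivC u + (fun s ↦ lieDeriv (w s) (u s)))

theorem smooth_of_mem_exactForms {u : P → CField n D} (hu : u ∈ exactForms n D P) :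
    SmoothCFamily u := by
  obtain ⟨ψ, hψ, h⟩ := hu
  rw [funext h]
  exact hψ.differential

/-- If `ψ` is a potential of `u`, then the derivative of `ψ` along `X` is one of the Lie derivative,
smooth in the parameter as well. -/
theorem lieDeriv_mem_exactForms {X : P → VField n D} (hX : SmoothVFamily X) {u : P → CField n D}
    (hu : u ∈ exactForms n D P) : (fun p ↦ lieDeriv (X p) (u p)) ∈ exactForms n D P := by
  obtain ⟨ψ, hψ, h⟩ := hu
  refine ⟨_, hψ.mvfderiv_apply hX, fun p ↦ ?_⟩
  change lieDeriv (X p) (u p) = _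
  rw [h, lieDeriv_differential (hX.slice p) (hψ.slice p)]

theorem paramDerivC_mem_exactForms {u : P → CField n D} (hu : u ∈ exactForms n D P) (w : P) :
    paramDerivC w u ∈ exactForms n D P := by
  have hs := smooth_of_mem_exactForms hu
  obtain ⟨ψ, hψ, h⟩ := hu
  refine ⟨_, hψ.fderiv_param w, fun p ↦ ?_⟩
  funext x
  ext v
  rw [paramDerivC_apply hs]
  simp only [h, differential]
  exact (hψ.mvfderiv_fderiv_param w p x v).symm

theorem comp_mem_exactForms {u : P → CField n D} (hu : u ∈ exactForms n D P) {g : Q → P}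
    (hg : ContDiff ℝ ∞ g) : (fun q ↦ u (g q)) ∈ exactForms n D Q := by
  obtain ⟨ψ, hψ, h⟩ := hu
  exact ⟨_, hψ.comp_param hg, fun q ↦ h (g q)⟩

/-- The potential is integrated. Endpoints depending on `p` cover both averages over a period and
primitives in the fast time. -/
theorem integralC_mem_exactForms {u : ℝ × P → CField n D} (hu : u ∈ exactForms n D (ℝ × P))
    {a b : P → ℝ} (ha : ContDiff ℝ ∞ a) (hb : ContDiff ℝ ∞ b) :
    (fun p ↦ integralC (fun r ↦ u (r, p)) (a p) (b p)) ∈ exactForms n D P := by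
  obtain ⟨ψ, hψ, h⟩ := hu
  refine ⟨_, hψ.integral ha hb, fun p ↦ ?_⟩
  simp only [h]
  exact integral_differential (hψ.comp_param (g := fun r : ℝ ↦ (r, p)) (by fun_prop)) _ _

end ExactFamilies

/-! ### The average of an iterated Lie derivative and the drift -/

section Averaging

set_option linter.unusedSectionVars false

open Set Topology

variable {n : ℕ} [NeZero n] {D : Type*} [TopologicalSpace D] [T2Space D]
  [ChartedSpace (EuclideanHalfSpace n) D] [IsManifold (𝓡∂ n) ∞ D]

theorem SmoothVFamily.primitive {v : ℝ → VField n D} (hv : SmoothVFamily v) :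
    SmoothVFamily (CraikLeibovich.integralV v 0) :=
  (hv.comp_param (g := fun q : ℝ × ℝ ↦ q.1) (by fun_prop)).integral (a := fun _ ↦ 0)
    (b := fun r ↦ r) contDiff_const contDiff_id

theorem SmoothVFamily.avgV {v : ℝ → VField n D} (hv : SmoothVFamily v) : SmoothVField (avgV v) :=
  (hv.integralV _ _).const_smul _

theorem avgC_lieDeriv {X : ℝ → VField n D} (hX : SmoothVFamily X) {u : CField n D}
    (hu : SmoothCField u) : avgC (fun r ↦ lieDeriv (X r) u) = lieDeriv (avgV X) u := by
  rw [avgC_eq, avgV_eq, lieDeriv_const_smul_left (hX.integralV _ _) hu, lieDeriv_integralV hX hu]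

theorem hasDerivAt_lieDeriv_left {v : ℝ → VField n D} (hv : SmoothVFamily v) {u : CField n D}
    (hu : SmoothCField u) (x : D) (a : ℝ) :
    HasDerivAt (F := EuclideanSpace ℝ (Fin n) →L[ℝ] ℝ)
      (fun a ↦ lieDeriv (integralV v 0 a) u x) (lieDeriv (v a) u x) a := by
  simp only [lieDeriv_integralV hv hu]
  exact hasDerivAt_integralC (SmoothCFamily.lieDeriv hv hu.family) 0 a x

theorem hasDerivAt_lieDeriv_right {v : ℝ → VField n D} (hv : SmoothVFamily v) {u : CField n D}
    (hu : SmoothCField u) {X : VField n D} (hX : SmoothVField X) (x : D) (b : ℝ) :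
    HasDerivAt (F := EuclideanSpace ℝ (Fin n) →L[ℝ] ℝ)
      (fun b ↦ lieDeriv X (lieDeriv (integralV v 0 b) u) x) (lieDeriv X (lieDeriv (v b) u) x) b := by
  have h := SmoothCFamily.lieDeriv hv hu.family
  simp only [lieDeriv_integralV hv hu, lieDeriv_integralC hX h]
  exact hasDerivAt_integralC (SmoothCFamily.lieDeriv hX.family h) 0 b x

/-- The product rule: give the two occurrences of `τ` separate names, differentiate in each, and
apply the chain rule along the diagonal. -/
theorem hasDerivAt_lieDeriv_lieDeriv {v : ℝ → VField n D} (hv : SmoothVFamily v) {u : CField n D}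
    (hu : SmoothCField u) (x : D) (τ : ℝ) :
    HasDerivAt (F := EuclideanSpace ℝ (Fin n) →L[ℝ] ℝ)
      (fun τ ↦ lieDeriv (integralV v 0 τ) (lieDeriv (integralV v 0 τ) u) x)
      (lieDeriv (v τ) (lieDeriv (integralV v 0 τ) u) x +
        lieDeriv (integralV v 0 τ) (lieDeriv (v τ) u) x) τ := by
  have hV := hv.primitive
  let H : ℝ × ℝ → CField n D := fun p ↦
    lieDeriv (integralV v 0 p.1) (lieDeriv (integralV v 0 p.2) u)
  have hH : SmoothCFamily H :=
    SmoothCFamily.lieDeriv (hV.comp_param (g := fun p : ℝ × ℝ ↦ p.1) (by fun_prop))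
      (SmoothCFamily.lieDeriv (hV.comp_param (g := fun p : ℝ × ℝ ↦ p.2) (by fun_prop)) hu.family)
  have h1 : paramDerivC (1, 0) H (τ, τ) x = lieDeriv (v τ) (lieDeriv (integralV v 0 τ) u) x :=
    (paramDerivC_line hH (1, 0) (τ, τ) x (γ := fun a ↦ (a, τ))
      ((hasDerivAt_id τ).prodMk (hasDerivAt_const τ τ)) rfl).unique
      (hasDerivAt_lieDeriv_left hv (hu.lieDeriv (hV.slice τ)) x τ)
  have h2 : paramDerivC (0, 1) H (τ, τ) x = lieDeriv (integralV v 0 τ) (lieDeriv (v τ) u) x :=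
    (paramDerivC_line hH (0, 1) (τ, τ) x (γ := fun b ↦ (τ, b))
      ((hasDerivAt_const τ τ).prodMk (hasDerivAt_id τ)) rfl).unique
      (hasDerivAt_lieDeriv_right hv hu (hV.slice τ) x τ)
  have h3 : paramDerivC ((1, 0) + (0, 1)) H (τ, τ) x =
      paramDerivC (1, 0) H (τ, τ) x + paramDerivC (0, 1) H (τ, τ) x :=
    map_add (fderiv ℝ (F := EuclideanSpace ℝ (Fin n) →L[ℝ] ℝ) (fun q ↦ H q x) (τ, τ)) _ _
  rw [← h1, ← h2, ← h3]
  refine paramDerivC_line hH _ (τ, τ) x (γ := fun a ↦ (a, a)) ?_ rfl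
  simpa using (hasDerivAt_id τ).prodMk (hasDerivAt_id τ)

theorem integralV_self (v : ℝ → VField n D) (a : ℝ) : integralV v a a = 0 :=
  funext fun _ ↦ intervalIntegral.integral_same (E := EuclideanSpace ℝ (Fin n))

theorem smoothVField_zero : SmoothVField (0 : VField n D) :=
  (smoothVFamily_of_probe (P := ℝ) (X := fun _ ↦ (0 : VField n D)) fun f hf ↦ by
    simpa [SmoothFamily] using contMDiff_const).slice 0

theorem lieDeriv_zero_left {u : CField n D} (hu : SmoothCField u) :
    lieDeriv (0 : VField n D) u = 0 := by
  have h := lieDeriv_const_smul_left smoothVField_zero hu 0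
  rwa [zero_smul, zero_smul] at h

theorem lieDeriv_neg_left {X : VField n D} (hX : SmoothVField X) {u : CField n D}
    (hu : SmoothCField u) : lieDeriv (-X) u = -lieDeriv X u := by
  have h := lieDeriv_const_smul_left hX hu (-1)
  rwa [CField.neg_one_smul, neg_one_smul] at h

theorem mlieBracket_sub_right (X : VField n D) {Y Z : VField n D} (hY : SmoothVField Y)
    (hZ : SmoothVField Z) (x : D) : mlieBracket (𝓡∂ n) X (Y - Z) x =
      mlieBracket (𝓡∂ n) X Y x - mlieBracket (𝓡∂ n) X Z x := by
  have h := mlieBracket_add_right (V := X) ((hY.sub hZ).mdiffAt x) (hZ.mdiffAt x)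
  rw [sub_add_cancel] at h
  rw [h, add_sub_cancel_right]

/-- The average of `𝓛_v 𝓛_V u` over a period, `V` being the primitive of an oscillating `v`. -/
theorem avgC_lieDeriv_lieDeriv {v : ℝ → VField n D} (hv : SmoothVFamily v) (h0 : avgV v = 0)
    {u : CField n D} (hu : SmoothCField u) :
    avgC (fun τ ↦ lieDeriv (v τ) (lieDeriv (integralV v 0 τ) u)) =
      -lieDeriv (stokesDrift v) u := by
  have hV := hv.primitive
  have hpi : (2 * Real.pi)⁻¹ ≠ 0 := by positivity
  have hint : integralV v 0 (2 * Real.pi) = 0 := by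
    rw [avgV_eq] at h0
    exact (smul_eq_zero.1 h0).resolve_left hpi
  have hvV := SmoothCFamily.lieDeriv hv (SmoothCFamily.lieDeriv hV hu.family)
  have hVv := SmoothCFamily.lieDeriv hV (SmoothCFamily.lieDeriv hv hu.family)
  -- The integrand is the derivative of `𝓛_V 𝓛_V u`, and `V` vanishes at `0` and, by the mean-zero
  -- condition, at `2π`.
  have htot : integralC (fun τ ↦ lieDeriv (v τ) (lieDeriv (integralV v 0 τ) u) +
      lieDeriv (integralV v 0 τ) (lieDeriv (v τ) u)) 0 (2 * Real.pi) = 0 := by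
    funext x
    refine (intervalIntegral.integral_eq_sub_of_hasDerivAt
      (E := EuclideanSpace ℝ (Fin n) →L[ℝ] ℝ)
      (fun τ _ ↦ hasDerivAt_lieDeriv_lieDeriv hv hu x τ)
      (((hvV.add hVv).contDiff_apply x).continuous.intervalIntegrable _ _)).trans ?_
    have e : lieDeriv (0 : VField n D) (lieDeriv 0 u) = 0 :=
      lieDeriv_zero_left (hu.lieDeriv smoothVField_zero)
    simp only [hint, integralV_self, e]
    exact sub_self _
  have hbr := hv.mlieBracket hV
  have hcomm : avgC (fun τ ↦ lieDeriv (v τ) (lieDeriv (integralV v 0 τ) u)) =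
      (1 / 2 : ℝ) • lieDeriv (avgV fun τ ↦ mlieBracket (𝓡∂ n) (v τ) (integralV v 0 τ)) u := by
    rw [← avgC_lieDeriv hbr hu]
    -- Symmetric plus antisymmetric half. The symmetric one integrates to zero by `htot`.
    have e1 (τ : ℝ) : lieDeriv (v τ) (lieDeriv (integralV v 0 τ) u) =
        (1 / 2 : ℝ) • ((lieDeriv (v τ) (lieDeriv (integralV v 0 τ) u) +
          lieDeriv (integralV v 0 τ) (lieDeriv (v τ) u)) +
          lieDeriv (mlieBracket (𝓡∂ n) (v τ) (integralV v 0 τ)) u) := by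
      rw [← lieDeriv_commutator (hv.slice τ) (hV.slice τ) hu]
      module
    rw [avgC_eq, avgC_eq]
    rw [funext e1]
    have e2 := integralC_add (hvV.add hVv) (SmoothCFamily.lieDeriv hbr hu.family) 0 (2 * Real.pi)
    rw [integralC_const_smul, smul_comm]
    congr 2
    exact e2.trans ((congrArg (· + _) htot).trans (zero_add _))
  -- The sign is that of `adBracket`. The constant `avgV V` subtracted in `oscPrimitive` contributes
  -- the bracket of `∫ v = 0` with it.
  have hdrift : stokesDrift v =
      -((1 / 2 : ℝ) • avgV fun τ ↦ mlieBracket (𝓡∂ n) (v τ) (integralV v 0 τ)) := by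
    have hosc : oscillating v = v := by
      funext τ
      rw [oscillating, h0, sub_zero]
    have hA := hV.avgV
    have hbA := hv.mlieBracket hA.family
    have e2 (τ : ℝ) : (1 / 2 : ℝ) • adBracket (v τ) (oscPrimitive v τ) =
        (1 / 2 : ℝ) • (mlieBracket (𝓡∂ n) (v τ) (avgV (integralV v 0)) -
          mlieBracket (𝓡∂ n) (v τ) (integralV v 0 τ)) := by
      funext x
      have h := mlieBracket_sub_right (v τ) (hV.slice τ) hA x
      have e : oscPrimitive v τ = integralV v 0 τ - avgV (integralV v 0) := rfl
      simp only [adBracket, Pi.smul_apply, Pi.neg_apply, Pi.sub_apply, e, h, neg_sub]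
    have e3 : integralV (fun τ ↦ mlieBracket (𝓡∂ n) (v τ) (avgV (integralV v 0))) 0
        (2 * Real.pi) = 0 := by
      rw [← mlieBracket_integralV_left hv hA, hint]
      exact mlieBracket_zero_left
    rw [stokesDrift, hosc]
    simp only [e2]
    rw [avgV_eq, integralV_const_smul, integralV_sub hbA hbr, e3, avgV_eq]
    module
  rw [hcomm, hdrift, lieDeriv_neg_left (hbr.avgV.const_smul _) hu,
    lieDeriv_const_smul_left hbr.avgV hu, neg_neg]

end Averaging

/-! ### Solving the two-timing equations order by order -/

section TwoTiming

set_option linter.unusedSectionVars false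

open Set Topology

variable {n : ℕ} [NeZero n] {D : Type*} [TopologicalSpace D] [T2Space D]
  [ChartedSpace (EuclideanHalfSpace n) D] [IsManifold (𝓡∂ n) ∞ D]

theorem avgC_add {u w : ℝ → CField n D} (hu : SmoothCFamily u) (hw : SmoothCFamily w) :
    avgC (fun r ↦ u r + w r) = avgC u + avgC w := by
  rw [avgC_eq, avgC_eq, avgC_eq, integralC_add hu hw, smul_add]

theorem avgC_neg (u : ℝ → CField n D) : avgC (fun r ↦ -u r) = -avgC u := by
  rw [avgC_eq, avgC_eq, integralC_neg, smul_neg]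

theorem avgC_const (u : CField n D) : avgC (fun _ ↦ u) = u := by
  rw [avgC_eq, integralC_const, smul_smul, sub_zero, inv_mul_cancel₀ (by positivity), one_smul]

theorem avgC_sub {u w : ℝ → CField n D} (hu : SmoothCFamily u) (hw : SmoothCFamily w) :
    avgC (fun r ↦ u r - w r) = avgC u - avgC w := by
  have h := avgC_add hu hw.neg
  rw [show avgC (-w) = -avgC w from avgC_neg w] at h
  rw [sub_eq_add_neg, ← h]
  simp only [sub_eq_add_neg, Pi.neg_apply]

theorem SmoothCFamily.curve {u : ℝ × ℝ → CField n D} (hu : SmoothCFamily u) (s : ℝ) :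
    SmoothCFamily (fun τ : ℝ ↦ u (s, τ)) :=
  hu.comp_param (g := fun τ : ℝ ↦ (s, τ)) (by fun_prop)

theorem SmoothVFamily.curve {v : ℝ × ℝ → VField n D} (hv : SmoothVFamily v) (s : ℝ) :
    SmoothVFamily (fun τ : ℝ ↦ v (s, τ)) :=
  hv.comp_param (g := fun τ : ℝ ↦ (s, τ)) (by fun_prop)

theorem SmoothCFamily.avgC {u : ℝ × ℝ → CField n D} (hu : SmoothCFamily u) :
    SmoothCFamily (fun s ↦ avgC fun τ ↦ u (s, τ)) :=
  ((hu.comp_param (g := fun q : ℝ × ℝ ↦ (q.2, q.1)) (by fun_prop)).integral (a := fun _ ↦ 0)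
    (b := fun _ ↦ 2 * Real.pi) contDiff_const contDiff_const).const_smul _

theorem SmoothVFamily.avgV_slow {v : ℝ × ℝ → VField n D} (hv : SmoothVFamily v) :
    SmoothVFamily (fun s ↦ CraikLeibovich.avgV fun τ ↦ v (s, τ)) :=
  ((hv.comp_param (g := fun q : ℝ × ℝ ↦ (q.2, q.1)) (by fun_prop)).integral (a := fun _ ↦ 0)
    (b := fun _ ↦ 2 * Real.pi) contDiff_const contDiff_const).const_smul _

/-- The primitive in the fast time of a family depending on `(s, τ)`. -/
def fastPrimitive (v : ℝ × ℝ → VField n D) : ℝ × ℝ → VField n D := fun p ↦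
  integralV (fun r ↦ v (p.1, r)) 0 p.2

theorem SmoothVFamily.fastPrimitive {v : ℝ × ℝ → VField n D} (hv : SmoothVFamily v) :
    SmoothVFamily (fastPrimitive v) :=
  (hv.comp_param (g := fun q : ℝ × ℝ × ℝ ↦ (q.2.1, q.1)) (by fun_prop)).integral (a := fun _ ↦ 0)
    (b := fun p ↦ p.2) contDiff_const contDiff_snd

theorem avgC_mem_exactForms {u : ℝ × ℝ → CField n D} (hu : u ∈ exactForms n D (ℝ × ℝ)) :
    (fun s ↦ avgC fun τ ↦ u (s, τ)) ∈ exactForms n D ℝ :=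
  Submodule.smul_mem _ (2 * Real.pi)⁻¹
    (integralC_mem_exactForms (comp_mem_exactForms hu (g := fun q : ℝ × ℝ ↦ (q.2, q.1))
      (by fun_prop)) (a := fun _ ↦ 0) (b := fun _ ↦ 2 * Real.pi) contDiff_const contDiff_const)

theorem exactForms_congr {P : Type} [NormedAddCommGroup P] [NormedSpace ℝ P]
    {u w : P → CField n D} (hu : u ∈ exactForms n D P) (h : ∀ p, w p = u p) :
    w ∈ exactForms n D P := by
  rwa [funext h]

/-- Integrate `∂_τ u + F` from `0` to `τ`, with the potential integrated likewise. -/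
theorem fast_increment_mem_exactForms {u F : ℝ × ℝ → CField n D} (hu : SmoothCFamily u)
    (hF : SmoothCFamily F) (h : fastDeriv u + F ∈ exactForms n D (ℝ × ℝ)) :
    (fun p ↦ u p - u (p.1, 0) + integralC (fun r ↦ F (p.1, r)) 0 p.2) ∈
      exactForms n D (ℝ × ℝ) := by
  refine exactForms_congr (integralC_mem_exactForms (comp_mem_exactForms h
    (g := fun q : ℝ × ℝ × ℝ ↦ (q.2.1, q.1)) (by fun_prop))
    (a := fun _ ↦ 0) (b := fun p ↦ p.2) contDiff_const contDiff_snd) fun p ↦ ?_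
  have hd : SmoothCFamily (fastDeriv u) := fastDeriv_eq hu ▸ hu.paramDerivC _
  refine Eq.trans ?_ (integralC_add (hd.curve p.1) (hF.curve p.1) 0 p.2).symm
  rw [integralC_fastDeriv hu]

/-- Averaging the hypothesis shows that the mean, too, agrees with the value at `τ = 0`. -/
theorem sub_avgC_mem_exactForms {u : ℝ × ℝ → CField n D} (hu : SmoothCFamily u)
    (h : (fun p ↦ u p - u (p.1, 0)) ∈ exactForms n D (ℝ × ℝ)) :
    (fun p ↦ u p - avgC fun τ ↦ u (p.1, τ)) ∈ exactForms n D (ℝ × ℝ) := by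
  refine exactForms_congr (Submodule.sub_mem _ h (comp_mem_exactForms (avgC_mem_exactForms h)
    (g := fun p : ℝ × ℝ ↦ p.1) (by fun_prop))) fun p ↦ ?_
  have e := avgC_sub (hu.curve p.1) (hu.slice (p.1, 0)).family
  rw [avgC_const] at e
  simp only [Pi.sub_apply, e]
  abel

theorem sub_avgC_mem_of_fastDeriv {u : ℝ × ℝ → CField n D} (hu : SmoothCFamily u)
    (h : fastDeriv u ∈ exactForms n D (ℝ × ℝ)) :
    (fun p ↦ u p - avgC fun τ ↦ u (p.1, τ)) ∈ exactForms n D (ℝ × ℝ) := by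
  have h0 : SmoothCFamily (0 : ℝ × ℝ → CField n D) :=
    smoothCFamily_of_probe fun Y hY ↦ by simpa [SmoothFamily] using contMDiff_const
  refine sub_avgC_mem_exactForms hu (exactForms_congr
    (fast_increment_mem_exactForms hu h0 (by rwa [add_zero])) fun p ↦ ?_)
  have e := integralC_const (0 : CField n D) 0 p.2
  rw [smul_zero] at e
  simp only [Pi.zero_apply, e, add_zero]

theorem lieDeriv_sub_mem {X : ℝ × ℝ → VField n D} (hX : SmoothVFamily X)
    {u w : ℝ × ℝ → CField n D} (hu : SmoothCFamily u) (hw : SmoothCFamily w)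
    (h : (fun p ↦ u p - w p) ∈ exactForms n D (ℝ × ℝ)) :
    (fun p ↦ lieDeriv (X p) (u p) - lieDeriv (X p) (w p)) ∈ exactForms n D (ℝ × ℝ) :=
  exactForms_congr (lieDeriv_mem_exactForms hX h) fun p ↦
    (lieDeriv_sub_right (hu.slice p) (hw.slice p)).symm

theorem paramDerivC_sub {P : Type} [NormedAddCommGroup P] [NormedSpace ℝ P]
    {u u' : P → CField n D} (hu : SmoothCFamily u) (hu' : SmoothCFamily u') (w : P) :
    paramDerivC w (u - u') = paramDerivC w u - paramDerivC w u' := by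
  have h := paramDerivC_add (hu.sub hu') hu' w
  rw [sub_add_cancel] at h
  rw [h, add_sub_cancel_right]

/-- Advection of a curve in `Ω¹(D)/dΩ⁰(D)` does not depend on the representative. -/
theorem IsAdvected.congr {X : ℝ → VField n D} (hX : SmoothVFamily X) {u w : ℝ → CField n D}
    (hu : SmoothCFamily u) (h : cls u = cls w) (hadv : IsAdvected X u) : IsAdvected X w := by
  rw [isAdvected_iff] at hadv ⊢
  rw [cls_eq_cls_iff] at h
  have hw : SmoothCFamily w := by
    have := hu.sub (smooth_of_mem_exactForms h)
    rwa [sub_sub_cancel] at this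
  have h1 := paramDerivC_mem_exactForms h 1
  rw [paramDerivC_sub hu hw] at h1
  rw [timeDerivC_eq hu] at hadv
  rw [timeDerivC_eq hw]
  refine exactForms_congr (Submodule.sub_mem _ (Submodule.sub_mem _ hadv h1)
    (lieDeriv_mem_exactForms hX h)) fun s ↦ ?_
  have e := lieDeriv_sub_right (X := X s) (hu.slice s) (hw.slice s)
  simp only [Pi.add_apply, Pi.sub_apply, e]
  abel

variable [Bundle.RiemannianBundle (fun x : D ↦ TangentSpace (𝓡∂ n) x)]
  {ν : TopForm n D} {u : ℕ → ℝ × ℝ → CField n D} {v : ℕ → ℝ × ℝ → VField n D}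

theorem IsSVectFamily.avgV {v : ℝ × ℝ → VField n D} (hv : IsSVectFamily ν v) :
    IsSVectFamily ν (fun s ↦ CraikLeibovich.avgV fun τ ↦ v (s, τ)) where
  smooth := hv.smooth.avgV_slow
  mem s := (IsSVect.integralV ⟨hv.smooth.curve s, fun τ ↦ hv.mem (s, τ)⟩ _ _).const_smul _

theorem IsSVectFamily.avgV_curve {v : ℝ → VField n D} (hv : IsSVectFamily ν v) :
    IsSVect ν (CraikLeibovich.avgV v) :=
  (IsSVect.integralV hv _ _).const_smul _

theorem IsSVectFamily.stokesDrift (hν : IsVolumeForm ν) {v : ℝ → VField n D}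
    (hv : IsSVectFamily ν v) : IsSVect ν (stokesDrift v) := by
  have hosc : IsSVectFamily ν (oscillating v) :=
    ⟨hv.smooth.sub hv.smooth.avgV.family, fun τ ↦ (hv.mem τ).sub hv.avgV_curve⟩
  have hprim : IsSVectFamily ν (integralV (oscillating v) 0) :=
    ⟨hosc.smooth.primitive, fun τ ↦ IsSVect.integralV hosc _ _⟩
  have hosc' : IsSVectFamily ν (oscPrimitive (oscillating v)) :=
    ⟨hprim.smooth.sub hprim.smooth.avgV.family, fun τ ↦ (hprim.mem τ).sub hprim.avgV_curve⟩
  exact IsSVectFamily.avgV_curve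
    ⟨(hosc.smooth.mlieBracket hosc'.smooth).neg.const_smul _,
      fun τ ↦ ((hosc.mem τ).mlieBracket hν (hosc'.mem τ)).neg.const_smul _⟩

theorem IsTwoTimingSolution.v_zero_indep (h : IsTwoTimingSolution ν u v) (s τ : ℝ) :
    v 0 (s, τ) = v 0 (0, τ) := by
  have e := congrFun (h.osc_v_indep s 0) τ
  simpa only [oscillating, h.avg_v_zero, sub_zero] using e

/-- Order `ε⁻¹` makes `u 0` equal to its mean modulo exact forms, and that mean is exact. -/
theorem IsTwoTimingSolution.u_zero_mem (h : IsTwoTimingSolution ν u v) :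
    u 0 ∈ exactForms n D (ℝ × ℝ) := by
  have h1 := sub_avgC_mem_of_fastDeriv (h.smooth_u 0 (by simp)) (cls_eq_zero_iff.1 h.order_neg_one)
  have h2 := comp_mem_exactForms (cls_eq_zero_iff.1 h.avg_u_zero) (g := fun p : ℝ × ℝ ↦ p.1)
    (by fun_prop)
  exact exactForms_congr (Submodule.add_mem _ h1 h2) fun p ↦ (sub_add_cancel _ _).symm

/-- In order `ε⁰` the right-hand side is exact because `u 0` is, so `u 1` does not depend on `τ`
modulo exact forms. -/
theorem IsTwoTimingSolution.u_one_sub_mem (h : IsTwoTimingSolution ν u v) :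
    (fun p ↦ u 1 p - avgMomentum u p.1) ∈ exactForms n D (ℝ × ℝ) := by
  refine sub_avgC_mem_of_fastDeriv (h.smooth_u 1 (by simp)) ?_
  have h1 : fastDeriv (u 1) - -(fun p ↦ lieDeriv (v 0 p) (u 0 p)) ∈ exactForms n D (ℝ × ℝ) :=
    cls_eq_cls_iff.1 h.order_zero
  exact exactForms_congr (Submodule.sub_mem _ h1
    (lieDeriv_mem_exactForms (h.mem_v 0 (by simp)).smooth h.u_zero_mem)) fun p ↦ by
      simp only [Pi.sub_apply, Pi.neg_apply]; abel

theorem IsTwoTimingSolution.smooth_avgMomentum (h : IsTwoTimingSolution ν u v) :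
    SmoothCFamily (avgMomentum u) := (h.smooth_u 1 (by simp)).avgC

/-- Order `ε¹`, after removal of all terms in `u 0`, is `∂_τ u₂ = -𝓛_{v₀} m`. As `m` does not depend
on `τ`, the Lie derivative integrates in its field argument. The value at `τ = 0` stays
undetermined. -/
theorem IsTwoTimingSolution.u_two_sub_mem (h : IsTwoTimingSolution ν u v) :
    (fun p ↦ u 2 p - (u 2 (p.1, 0) - lieDeriv (fastPrimitive (v 0) p) (avgMomentum u p.1))) ∈
      exactForms n D (ℝ × ℝ) := by
  have hm := h.smooth_avgMomentum
  have hm' := hm.comp_param (g := fun p : ℝ × ℝ ↦ p.1) (by fun_prop)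
  have hv0 := (h.mem_v 0 (by simp)).smooth
  have h1 : (fastDeriv (u 2) + slowDeriv (u 0)) - -((fun p ↦ lieDeriv (v 0 p) (u 1 p)) +
      fun p ↦ lieDeriv (v 1 p) (u 0 p)) ∈ exactForms n D (ℝ × ℝ) := cls_eq_cls_iff.1 h.order_one
  have h2 := paramDerivC_mem_exactForms h.u_zero_mem (1, 0)
  rw [← slowDeriv_eq (h.smooth_u 0 (by simp))] at h2
  have h3 := lieDeriv_mem_exactForms (h.mem_v 1 (by simp)).smooth h.u_zero_mem
  have h4 := lieDeriv_sub_mem hv0 (h.smooth_u 1 (by simp)) hm' h.u_one_sub_mem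
  have h5 : fastDeriv (u 2) + (fun p ↦ lieDeriv (v 0 p) (avgMomentum u p.1)) ∈
      exactForms n D (ℝ × ℝ) := by
    refine exactForms_congr (Submodule.sub_mem _ (Submodule.sub_mem _ (Submodule.sub_mem _ h1 h2) h3)
      h4) fun p ↦ ?_
    simp only [Pi.sub_apply, Pi.add_apply, Pi.neg_apply]
    abel
  refine exactForms_congr (fast_increment_mem_exactForms (h.smooth_u 2 (by simp))
    (SmoothCFamily.lieDeriv hv0 hm') h5) fun p ↦ ?_
  rw [fastPrimitive, lieDeriv_integralV (hv0.curve p.1) (hm.slice p.1)]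
  abel

theorem IsTwoTimingSolution.isSVect_drift (hν : IsVolumeForm ν) (h : IsTwoTimingSolution ν u v) :
    IsSVect ν (drift v) :=
  IsSVectFamily.stokesDrift hν ⟨(h.mem_v 0 (by simp)).smooth.curve 0,
    fun τ ↦ (h.mem_v 0 (by simp)).mem (0, τ)⟩

/-- Order `ε²` with `u 0`, `u 1`, `u 2` replaced by what the lower orders say about them, then
averaged over the fast time. -/
theorem IsTwoTimingSolution.isAdvected (hν : IsVolumeForm ν) (h : IsTwoTimingSolution ν u v) :
    IsAdvected (fun s ↦ avgVelocity v s + drift v) (avgMomentum u) := by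
  have hm := h.smooth_avgMomentum
  have hm' := hm.comp_param (g := fun p : ℝ × ℝ ↦ p.1) (by fun_prop)
  have hv0 := (h.mem_v 0 (by simp)).smooth
  have hv1 := (h.mem_v 1 (by simp)).smooth
  have hu1 := h.smooth_u 1 (by simp)
  have hu2 := h.smooth_u 2 (by simp)
  have hu3 := h.smooth_u 3 (by simp)
  have hu2' := hu2.comp_param (g := fun p : ℝ × ℝ ↦ (p.1, (0 : ℝ))) (by fun_prop)
  have hVm := SmoothCFamily.lieDeriv hv0.fastPrimitive hm'
  have h1 : (fastDeriv (u 3) + slowDeriv (u 1)) - -((fun p ↦ lieDeriv (v 0 p) (u 2 p)) +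
      (fun p ↦ lieDeriv (v 1 p) (u 1 p)) + fun p ↦ lieDeriv (v 2 p) (u 0 p)) ∈
      exactForms n D (ℝ × ℝ) := cls_eq_cls_iff.1 h.order_two
  have h2 := paramDerivC_mem_exactForms h.u_one_sub_mem (1, 0)
  rw [show (fun p ↦ u 1 p - avgMomentum u p.1) = u 1 - fun p ↦ avgMomentum u p.1 from rfl,
    paramDerivC_sub hu1 hm', ← slowDeriv_eq hu1, ← slowDeriv_eq hm'] at h2
  have h3 := lieDeriv_mem_exactForms (h.mem_v 2 (by simp)).smooth h.u_zero_mem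
  have h4 := lieDeriv_sub_mem hv1 hu1 hm' h.u_one_sub_mem
  have h5 := lieDeriv_sub_mem hv0 hu2 (hu2'.sub hVm) h.u_two_sub_mem
  have h6 : (fun p ↦ fastDeriv (u 3) p + (timeDerivC (avgMomentum u) p.1 +
      (lieDeriv (v 0 p) (u 2 (p.1, 0)) -
        lieDeriv (v 0 p) (lieDeriv (fastPrimitive (v 0) p) (avgMomentum u p.1)) +
      lieDeriv (v 1 p) (avgMomentum u p.1)))) ∈ exactForms n D (ℝ × ℝ) := by
    refine exactForms_congr (Submodule.sub_mem _ (Submodule.sub_mem _ (Submodule.sub_mem _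
      (Submodule.sub_mem _ h1 h2) h3) h4) h5) fun p ↦ ?_
    have e1 : slowDeriv (fun p ↦ avgMomentum u p.1) p = timeDerivC (avgMomentum u) p.1 := rfl
    have e2 := lieDeriv_sub_right (X := v 0 p) (hu2'.slice p) (hVm.slice p)
    simp only [Pi.sub_apply, Pi.add_apply, Pi.neg_apply, e1, e2]
    abel
  have h7 := avgC_mem_exactForms h6
  -- Only the class of `u 3` is periodic, so this average is an increment over one period: exact,
  -- but not necessarily zero.
  have h8 : (fun s ↦ avgC fun τ ↦ fastDeriv (u 3) (s, τ)) ∈ exactForms n D ℝ := by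
    have h9 := comp_mem_exactForms (cls_eq_cls_iff.1 (h.periodic_u 3 le_rfl))
      (g := fun s : ℝ ↦ (s, (0 : ℝ))) (by fun_prop)
    refine exactForms_congr (Submodule.smul_mem _ (2 * Real.pi)⁻¹ h9) fun s ↦ ?_
    rw [avgC_eq, integralC_fastDeriv hu3]
    simp
  rw [isAdvected_iff]
  refine exactForms_congr (Submodule.sub_mem _ h7 h8) fun s ↦ ?_
  have hd : SmoothCFamily (fastDeriv (u 3)) := fastDeriv_eq hu3 ▸ hu3.paramDerivC _
  have hms : SmoothCField (timeDerivC (avgMomentum u) s) := by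
    rw [timeDerivC_eq hm]
    exact (hm.paramDerivC 1).slice s
  have f1 := SmoothCFamily.lieDeriv (hv0.curve s) (hu2.slice (s, 0)).family
  have f2 := SmoothCFamily.lieDeriv (hv0.curve s) (hVm.curve s)
  have f3 := SmoothCFamily.lieDeriv (hv1.curve s) (hm.slice s).family
  have g0 := avgC_add (hd.curve s) (hms.family.add ((f1.sub f2).add f3))
  have g1 := avgC_add hms.family ((f1.sub f2).add f3)
  have g2 := avgC_add (f1.sub f2) f3
  have g3 := avgC_sub f1 f2
  have z0 := h.avg_v_zero s
  -- The undetermined initial value of `u 2` drops out here, since `v 0` has mean zero.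
  have k1 := avgC_lieDeriv (hv0.curve s) (hu2.slice (s, 0))
  rw [z0, lieDeriv_zero_left (hu2.slice (s, 0))] at k1
  have k2 := avgC_lieDeriv_lieDeriv (hv0.curve s) z0 (hm.slice s)
  -- `drift` is computed at slow time `0`; `v 0` is the same at every slow time.
  have hdr : stokesDrift (fun τ ↦ v 0 (s, τ)) = drift v := by
    rw [drift]
    simp only [h.v_zero_indep s]
  rw [hdr] at k2
  have k3 := avgC_lieDeriv (hv1.curve s) (hm.slice s)
  have k4 : avgC (fun _ ↦ timeDerivC (avgMomentum u) s) = timeDerivC (avgMomentum u) s :=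
    avgC_const _
  have total := g0.trans (congrArg (_ + ·) (g1.trans (congrArg₂ (· + ·) k4 (g2.trans
    (congrArg₂ (· + ·) (g3.trans (congrArg₂ (· - ·) k1 k2)) k3)))))
  have hdS := (h.isSVect_drift hν).smooth
  have hl := lieDeriv_add_left (hv1.avgV_slow.slice s) hdS (hm.slice s)
  refine Eq.trans ?_ (congrArg (· - avgC fun τ ↦ fastDeriv (u 3) (s, τ)) total).symm
  refine (congrArg (timeDerivC (avgMomentum u) s + ·) hl).trans ?_
  abel

theorem IsTwoTimingSolution.isSVectFamily_avgVelocity (h : IsTwoTimingSolution ν u v) :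
    IsSVectFamily ν (avgVelocity v) :=
  (h.mem_v 1 (by simp)).avgV

theorem IsTwoTimingSolution.isSVectFamily_add_drift (hν : IsVolumeForm ν)
    (h : IsTwoTimingSolution ν u v) : IsSVectFamily ν (fun s ↦ avgVelocity v s + drift v) :=
  ⟨h.isSVectFamily_avgVelocity.smooth.add (h.isSVect_drift hν).smooth.family,
    fun s ↦ (h.isSVectFamily_avgVelocity.mem s).add (h.isSVect_drift hν)⟩

theorem IsTwoTimingSolution.isAdvected_flat (hν : IsVolumeForm ν) (h : IsTwoTimingSolution ν u v)
    (hc : cls (avgMomentum u) = cls (fun s ↦ flat (avgVelocity v s))) :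
    IsAdvected (fun s ↦ avgVelocity v s + drift v) (fun s ↦ flat (avgVelocity v s)) :=
  (h.isAdvected hν).congr (h.isSVectFamily_add_drift hν).smooth h.smooth_avgMomentum hc

end TwoTiming

/-! ### The Levi-Civita connection and the vector form of the equation -/

section Metric

set_option linter.unusedSectionVars false

open Set Topology

variable {n : ℕ} [NeZero n] {D : Type*} [TopologicalSpace D] [T2Space D]
  [ChartedSpace (EuclideanHalfSpace n) D] [IsManifold (𝓡∂ n) ∞ D]
  [Bundle.RiemannianBundle (fun x : D ↦ TangentSpace (𝓡∂ n) x)]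
  [IsContMDiffRiemannianBundle (𝓡∂ n) ∞ (EuclideanSpace ℝ (Fin n))
      (fun x : D ↦ TangentSpace (𝓡∂ n) x)]
  {P : Type} [NormedAddCommGroup P] [NormedSpace ℝ P]

theorem SmoothVFamily.inner {X Y : P → VField n D} (hX : SmoothVFamily X) (hY : SmoothVFamily Y) :
    SmoothFamily n (fun p x ↦ inner ℝ (X p x) (Y p x)) :=
  ContMDiff.inner_bundle (IB := 𝓡∂ n) (F := EuclideanSpace ℝ (Fin n))
    (E := fun x : D ↦ TangentSpace (𝓡∂ n) x) (b := fun q : P × D ↦ q.2)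
    (v := fun q ↦ X q.1 q.2) (w := fun q ↦ Y q.1 q.2) hX hY

theorem SmoothVFamily.flat {X : P → VField n D} (hX : SmoothVFamily X) :
    SmoothCFamily (fun p ↦ flat (X p)) :=
  smoothCFamily_of_probe fun _ hY ↦ hX.inner hY.family

theorem SmoothVField.flat {X : VField n D} (hX : SmoothVField X) : SmoothCField (flat X) :=
  (hX.family (P := ℝ)).flat.slice 0

theorem timeDerivC_flat {X : ℝ → VField n D} (hX : SmoothVFamily X) (t : ℝ) (x : D)
    (y : TangentSpace (𝓡∂ n) x) :
    timeDerivC (fun t ↦ flat (X t)) t x y = inner ℝ (timeDerivV X t x) y := by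
  rw [timeDerivC_eq hX.flat, paramDerivC_apply hX.flat]
  let α : TangentSpace (𝓡∂ n) x →L[ℝ] ℝ := innerSL ℝ y
  have h1 := ((hX.contDiff_apply x).differentiable (by simp) t).hasDerivAt
  have h2 := (ContinuousLinearMap.hasFDerivAt (E := EuclideanSpace ℝ (Fin n)) α).comp_hasDerivAt
    t h1
  rw [real_inner_comm]
  refine Eq.trans ?_ h2.deriv
  change deriv (fun q ↦ inner ℝ (X q x) y) t = deriv (fun q ↦ inner ℝ y (X q x)) t
  simp only [real_inner_comm y]

variable {nabla : CovariantDerivative (𝓡∂ n) (EuclideanSpace ℝ (Fin n))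
      (fun x : D ↦ TangentSpace (𝓡∂ n) x)}

/-- `𝓛_v v♭ = (∇_v v)♭ + ½ d|v|²`. -/
theorem IsLeviCivita.lieDeriv_flat_self (h : IsLeviCivita nabla) {X : VField n D}
    (hX : SmoothVField X) {Y : VField n D} (hY : SmoothVField Y) (x : D) :
    lieDeriv X (flat X) x (Y x) = inner ℝ (nabla X x (X x)) (Y x) +
      (1 / 2) * mvfderiv (𝓡∂ n) (fun x ↦ inner ℝ (X x) (X x)) x (Y x) := by
  have : IsContMDiffRiemannianBundle (𝓡∂ n) 1 (EuclideanSpace ℝ (Fin n))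
      (fun x : D ↦ TangentSpace (𝓡∂ n) x) := IsContMDiffRiemannianBundle.of_le (n := ∞) (by simp)
  -- Metric compatibility for `X⟨X, Y⟩` and for `Y⟨X, X⟩`. With vanishing torsion the terms `⟨X, ∇_X
  -- Y⟩` cancel, and `⟨X, ∇_Y X⟩ = ½ Y|X|²` is left.
  have h1 := h.metric.mvfderiv_inner_eq X (hX.mdiffAt x) (hY.mdiffAt x)
  have h2 := h.metric.mvfderiv_inner_eq Y (hX.mdiffAt x) (hX.mdiffAt x)
  beta_reduce at h1 h2
  have h3 := nabla.torsion_eq_zero_iff.1 h.torsion_free (hX.mdiffAt x) (hY.mdiffAt x)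
  rw [lieDeriv_apply' hX.flat hY, ← h3, h2]
  refine (congrArg (· - _) h1).trans ?_
  have e : flat X x (nabla Y x (X x) - nabla X x (Y x)) =
      inner ℝ (X x) (nabla Y x (X x)) - inner ℝ (X x) (nabla X x (Y x)) :=
    inner_sub_right (X x) (nabla Y x (X x)) (nabla X x (Y x))
  rw [e, real_inner_comm (nabla X x (Y x)) (X x)]
  ring

/-- Cartan's formula `𝓛_V = i_V d + d i_V`, obtained by comparing the defining formulas of both
sides. -/
theorem lieDeriv_flat_eq_extDeriv₁ {X V : VField n D} (hX : SmoothVField X) (hV : SmoothVField V)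
    {Y : VField n D} (hY : SmoothVField Y) (x : D) :
    lieDeriv V (flat X) x (Y x) = extDeriv₁ (flat X) x (V x) (Y x) +
      mvfderiv (𝓡∂ n) (fun x ↦ inner ℝ (X x) (V x)) x (Y x) := by
  rw [lieDeriv_apply' hX.flat hY, extDeriv₁_apply hX.flat (hV.mdiffAt x) (hY.mdiffAt x)]
  have e : (fun y ↦ flat X y (V y)) = fun x ↦ inner ℝ (X x) (V x) := rfl
  rw [e]
  ring

theorem inner_cross {ν : TopForm n D} {v : VField n D} {c : MultiVField n D (n - 2)}
    (hc : IsCurl ν v c) (w : VField n D) (x : D) (y : TangentSpace (𝓡∂ n) x) :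
    inner ℝ (cross ν c w x) y = extDeriv₁ (flat v) x (w x) y := by
  rw [cross, hodgeStar, inner_sharp, ← hc.interior]
  rfl

/-- The 1-form of the advection equation, in terms of the left hand side of the Craik–Leibovich
equation. -/
theorem advection_apply (hnabla : IsLeviCivita nabla) {ν : TopForm n D} {v : ℝ → VField n D}
    {V₀ : VField n D} (hv : SmoothVFamily v) (hV : SmoothVField V₀)
    {c : ℝ → MultiVField n D (n - 2)} (hc : ∀ t, IsCurl ν (v t) (c t)) (t : ℝ) (x : D)
    (y : TangentSpace (𝓡∂ n) x) :
    (timeDerivC (fun t ↦ flat (v t)) t + lieDeriv (v t + V₀) (flat (v t))) x y =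
      inner ℝ (timeDerivV v t x + nabla (v t) x (v t x) + cross ν (c t) V₀ x) y +
      differential (fun x ↦ (1 / 2) * inner ℝ (v t x) (v t x) + inner ℝ (v t x) (V₀ x)) x y := by
  obtain ⟨Y, hY, rfl⟩ := exists_smoothVField_apply y
  have hvt := hv.slice t
  have h1 := ((hv.inner hv).slice t)
  have h2 := ((hv.inner hV.family).slice t)
  have h3 : ContMDiff (𝓡∂ n) 𝓘(ℝ, ℝ) ∞ fun x ↦ (1 / 2 : ℝ) * inner ℝ (v t x) (v t x) :=
    contMDiff_const.mul h1
  rw [lieDeriv_add_left hvt hV hvt.flat, differential,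
    mvfderiv_fun_add (h3.mdiff x) (h2.mdiff x), mvfderiv_const_mul (h1.mdiff x),
    inner_add_left, inner_add_left, inner_cross (hc t), ← timeDerivC_flat hv]
  simp only [Pi.add_apply, add_apply]
  rw [hnabla.lieDeriv_flat_self hvt hY, lieDeriv_flat_eq_extDeriv₁ hvt hV hY]
  ring

theorem inner_gradient (p : D → ℝ) (x : D) (y : TangentSpace (𝓡∂ n) x) :
    inner ℝ (gradient p x) y = differential p x y := inner_sharp _ _

theorem isAdvected_flat_iff (hnabla : IsLeviCivita nabla) {ν : TopForm n D} {v : ℝ → VField n D}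
    {V₀ : VField n D} (hv : SmoothVFamily v) (hV : SmoothVField V₀)
    {c : ℝ → MultiVField n D (n - 2)} (hc : ∀ t, IsCurl ν (v t) (c t)) :
    IsAdvected (fun t ↦ v t + V₀) (fun t ↦ flat (v t)) ↔ IsCLSolution ν nabla c v V₀ := by
  have hb : SmoothFamily n
      (fun t x ↦ (1 / 2) * inner ℝ (v t x) (v t x) + inner ℝ (v t x) (V₀ x)) :=
    ((hv.inner hv).const_smul (1 / 2)).add (hv.inner hV.family)
  rw [isAdvected_iff]
  constructor
  · rintro ⟨ψ, hψ, h⟩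
    -- The pressure is `½|v|² + ⟨v, V₀⟩ - ψ`. Conversely the potential will be the same function
    -- minus the pressure.
    refine ⟨_, hb.sub hψ, fun t x ↦ ext_inner_right ℝ fun y ↦ ?_⟩
    have e := (congrArg (fun α : CField n D ↦ α x y) (h t)).symm.trans
      (advection_apply hnabla hv hV hc t x y)
    have e' := congrArg (fun α : CField n D ↦ α x y) (differential_sub (hb.slice t) (hψ.slice t))
    rw [inner_neg_left, inner_gradient]
    refine Eq.trans ?_ (congrArg Neg.neg e').symm
    rw [Pi.sub_apply, sub_apply, e]
    ring
  · rintro ⟨p, hp, h⟩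
    refine ⟨_, hb.sub hp, fun t ↦ ?_⟩
    funext x
    ext y
    have e := advection_apply hnabla hv hV hc t x y
    have e' := congrArg (fun α : CField n D ↦ α x y) (differential_sub (hb.slice t) (hp.slice t))
    rw [h, inner_neg_left, inner_gradient] at e
    refine e.trans (Eq.trans ?_ e'.symm)
    rw [Pi.sub_apply, sub_apply]
    ring

end Metric

/-! ### Linear algebra of the interior product with a volume form -/

section InteriorProduct

set_option linter.unusedSectionVars false

open Equiv

universe u

variable {m : ℕ} {V : Type u} [AddCommGroup V] [Module ℝ V]

/-- A permutation of `Fin (m + 2)` whose last two values are `i` and `j` (for `i ≠ j`). -/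
def permWithTail (i j : Fin (m + 2)) : Perm (Fin (m + 2)) :=
  swap (Fin.natAdd m 0) i *
    swap (Fin.natAdd m 1) ((swap (Fin.natAdd m 0) i)⁻¹ j)

theorem natAdd_zero_ne_natAdd_one : Fin.natAdd m (0 : Fin 2) ≠ Fin.natAdd m 1 := by
  simp [Fin.ext_iff]

theorem permWithTail_natAdd_one (i j : Fin (m + 2)) :
    permWithTail i j (Fin.natAdd m 1) = j := by
  simp [permWithTail]

theorem permWithTail_natAdd_zero {i j : Fin (m + 2)} (h : i ≠ j) :
    permWithTail i j (Fin.natAdd m 0) = i := by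
  rw [permWithTail, Perm.mul_apply, swap_apply_of_ne_of_ne natAdd_zero_ne_natAdd_one,
    swap_apply_left]
  intro h'
  rw [Perm.eq_inv_iff_eq, swap_apply_left] at h'
  exact h h'

theorem append_apply_comp (b : Fin (m + 2) → V) (σ : Perm (Fin (m + 2))) (k l : Fin (m + 2)) :
    Fin.append (fun r ↦ b (σ (Fin.castAdd 2 r))) ![b k, b l] =
      b ∘ Fin.append (fun r ↦ σ (Fin.castAdd 2 r)) ![k, l] := by
  funext p
  refine Fin.addCases (fun r ↦ ?_) (fun r ↦ ?_) p
  · simp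
  · fin_cases r <;> simp

theorem append_perm_tail (σ : Perm (Fin (m + 2))) :
    Fin.append (fun r ↦ σ (Fin.castAdd 2 r)) ![σ (Fin.natAdd m 0), σ (Fin.natAdd m 1)] = σ := by
  funext p
  refine Fin.addCases (fun r ↦ ?_) (fun r ↦ ?_) p
  · simp
  · fin_cases r <;> simp

theorem append_perm_tail_swap (σ : Perm (Fin (m + 2))) :
    Fin.append (fun r ↦ σ (Fin.castAdd 2 r)) ![σ (Fin.natAdd m 1), σ (Fin.natAdd m 0)] =
      (σ * swap (Fin.natAdd m 0) (Fin.natAdd m 1) : Perm (Fin (m + 2))) := by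
  rw [← append_perm_tail (σ * _)]
  congr 1
  · funext r
    rw [Perm.mul_apply, swap_apply_of_ne_of_ne] <;> simp [Fin.ext_iff] <;> omega
  · simp

/-- The first `m` values of `σ` are already used, so `k` and `l` must be its last two values in some
order. -/
theorem append_injective {σ : Perm (Fin (m + 2))} {k l : Fin (m + 2)}
    (h : Function.Injective (Fin.append (fun r ↦ σ (Fin.castAdd 2 r)) ![k, l])) :
    (k = σ (Fin.natAdd m 0) ∧ l = σ (Fin.natAdd m 1)) ∨
      (k = σ (Fin.natAdd m 1) ∧ l = σ (Fin.natAdd m 0)) := by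
  have key (q : Fin 2) : ∃ r : Fin 2, (![k, l] : Fin 2 → Fin (m + 2)) q = σ (Fin.natAdd m r) := by
    obtain ⟨p, hp⟩ := σ.surjective ((![k, l] : Fin 2 → Fin (m + 2)) q)
    revert hp
    refine Fin.addCases (fun r hp ↦ ?_) (fun r hp ↦ ⟨r, hp.symm⟩) p
    have := @h (Fin.castAdd 2 r) (Fin.natAdd m q) (by simpa using hp)
    simp [Fin.ext_iff] at this
    omega
  obtain ⟨r, hr⟩ := key 0
  obtain ⟨r', hr'⟩ := key 1
  have hne : r ≠ r' := by
    rintro rfl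
    have := @h (Fin.natAdd m 0) (Fin.natAdd m 1) (by simpa using hr.trans hr'.symm)
    exact natAdd_zero_ne_natAdd_one this
  simp only [Matrix.cons_val_zero, Matrix.cons_val_one] at hr hr'
  fin_cases r <;> fin_cases r' <;> simp_all

/-- Unless `{k, l} = {i, j}`, some basis vector is repeated and `ν` vanishes. Otherwise the tuple is
a permutation of `b`, whose sign cancels the prefactor up to the transposition of the last two
entries. -/
theorem alternating_append_permWithTail (ν : V [⋀^Fin (m + 2)]→ₗ[ℝ] ℝ) (b : Fin (m + 2) → V)
    {i j : Fin (m + 2)} (hij : i ≠ j) (k l : Fin (m + 2)) :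
    ((Perm.sign (permWithTail i j) : ℤ) : ℝ) *
      ν (Fin.append (fun r ↦ b (permWithTail i j (Fin.castAdd 2 r))) ![b k, b l]) =
    ν b * ((if k = i ∧ l = j then 1 else 0) - (if k = j ∧ l = i then 1 else 0)) := by
  set σ := permWithTail i j with hσ
  have h0 : σ (Fin.natAdd m 0) = i := permWithTail_natAdd_zero hij
  have h1 : σ (Fin.natAdd m 1) = j := permWithTail_natAdd_one i j
  have hs : ((Perm.sign σ : ℤ) : ℝ) * ((Perm.sign σ : ℤ) : ℝ) = 1 := by
    rw [← Int.cast_mul, Int.units_coe_mul_self, Int.cast_one]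
  rw [append_apply_comp]
  by_cases hc : k = i ∧ l = j
  · obtain ⟨rfl, rfl⟩ := hc
    have e := append_perm_tail σ
    rw [h0, h1] at e
    rw [e, ν.map_perm, if_pos ⟨rfl, rfl⟩, if_neg (fun h ↦ hij h.1), Units.smul_def,
      ← Int.cast_smul_eq_zsmul ℝ, smul_eq_mul, ← mul_assoc, hs]
    ring
  by_cases hc' : k = j ∧ l = i
  · obtain ⟨rfl, rfl⟩ := hc'
    have e := append_perm_tail_swap σ
    rw [h0, h1] at e
    rw [e, ν.map_perm, if_neg hc, if_pos ⟨rfl, rfl⟩, Perm.sign_mul,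
      Perm.sign_swap natAdd_zero_ne_natAdd_one, Units.smul_def,
      ← Int.cast_smul_eq_zsmul ℝ, smul_eq_mul]
    push_cast
    linear_combination (-ν b) * hs
  · rw [ν.map_eq_zero_of_not_injective, if_neg hc, if_neg hc']
    · ring
    intro hinj
    rcases append_injective hinj.of_comp with h | h
    · exact hc ⟨h.1.trans h0, h.2.trans h1⟩
    · exact hc' ⟨h.1.trans h1, h.2.trans h0⟩

theorem liftAlternating_ιMulti_mul (ν : V [⋀^Fin (m + 2)]→ₗ[ℝ] ℝ) (w : Fin m → V) (y z : V) :
    ExteriorAlgebra.liftAlternating (R := ℝ) (Pi.single (m + 2) ν)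
      (ExteriorAlgebra.ιMulti ℝ m w * ExteriorAlgebra.ι ℝ y * ExteriorAlgebra.ι ℝ z) =
      ν (Fin.append w ![y, z]) := by
  have h : ExteriorAlgebra.ιMulti ℝ 2 ![y, z] =
      ExteriorAlgebra.ι ℝ y * ExteriorAlgebra.ι ℝ z := by
    simp [ExteriorAlgebra.ιMulti_apply]
  rw [mul_assoc, ← h, ExteriorAlgebra.ιMulti_mul_ιMulti,
    ExteriorAlgebra.liftAlternating_apply_ιMulti, Pi.single_eq_same]

/-- The bilinear form `(y, z) ↦ ν(c ∧ y ∧ z)`. -/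
def interiorForm {n : ℕ} (ν : V [⋀^Fin n]→ₗ[ℝ] ℝ) (c : ExteriorAlgebra ℝ V) : V →ₗ[ℝ] V →ₗ[ℝ] ℝ :=
  LinearMap.mk₂ ℝ (fun y z ↦ ExteriorAlgebra.liftAlternating (R := ℝ) (Pi.single n ν)
    (c * ExteriorAlgebra.ι ℝ y * ExteriorAlgebra.ι ℝ z))
    (fun y y' z ↦ by simp only [map_add, mul_add, add_mul])
    (fun a y z ↦ by simp only [map_smul, Algebra.mul_smul_comm, Algebra.smul_mul_assoc])
    (fun y z z' ↦ by simp only [map_add, mul_add])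
    (fun a y z ↦ by simp only [map_smul, Algebra.mul_smul_comm])

/-- An alternating bilinear form is the interior product of `ν` by a multivector with an explicit
expansion in a basis. -/
theorem exists_interior_expansion {n : ℕ} (hm : m + 2 = n) :
    ∃ (σ : Fin n → Fin n → Fin m → Fin n) (s : Fin n → Fin n → ℝ),
      ∀ (V : Type u) [AddCommGroup V] [Module ℝ V] (b : Module.Basis (Fin n) ℝ V)
        (ν : V [⋀^Fin n]→ₗ[ℝ] ℝ) (_ : ν b ≠ 0) (β : V →ₗ[ℝ] V →ₗ[ℝ] ℝ) (_ : ∀ y, β y y = 0),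
        interiorForm ν ((∑ i, ∑ j, (s i j * β (b i) (b j) / ν b) •
          exteriorPower.ιMulti ℝ m (fun r ↦ b (σ i j r)) : ⋀[ℝ]^m V) : ExteriorAlgebra ℝ V) =
          β := by
  subst hm
  -- The factor `1 / 2` compensates for summing over ordered pairs. On the diagonal the permutation
  -- is irrelevant, as the coefficient `β (b i) (b i)` vanishes.
  refine ⟨fun i j r ↦ permWithTail i j (Fin.castAdd 2 r),
    fun i j ↦ (1 / 2) * ((Perm.sign (permWithTail i j) : ℤ) : ℝ), fun V _ _ b ν hν β hβ ↦ ?_⟩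
  refine LinearMap.ext_basis b b fun k l ↦ ?_
  have hswap (y z : V) : β y z = -β z y := by
    have h := hβ (y + z)
    simp only [map_add, LinearMap.add_apply, hβ] at h
    linarith
  have hterm (i j : Fin (m + 2)) :
      ((1 / 2) * ((Perm.sign (permWithTail i j) : ℤ) : ℝ) * β (b i) (b j) / ν b) *
        ν (Fin.append (fun r ↦ b (permWithTail i j (Fin.castAdd 2 r))) ![b k, b l]) =
      (if k = i then (if l = j then (1 / 2) * β (b i) (b j) else 0) else 0) -
        (if l = i then (if k = j then (1 / 2) * β (b i) (b j) else 0) else 0) := by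
    by_cases hij : i = j
    · subst hij
      simp [hβ]
    · have h := alternating_append_permWithTail ν b hij k l
      calc _ = (1 / 2) * β (b i) (b j) / ν b * (((Perm.sign (permWithTail i j) : ℤ) : ℝ) *
          ν (Fin.append (fun r ↦ b (permWithTail i j (Fin.castAdd 2 r))) ![b k, b l])) := by ring
        _ = (1 / 2) * β (b i) (b j) *
            ((if k = i ∧ l = j then 1 else 0) - (if k = j ∧ l = i then 1 else 0)) := by
          rw [h]; field_simp
        _ = _ := by
          simp only [ite_and]
          split_ifs <;> ring
  simp only [interiorForm, LinearMap.mk₂_apply, Submodule.coe_sum, Submodule.coe_smul,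
    exteriorPower.ιMulti_apply_coe, Finset.sum_mul, map_sum, Algebra.smul_mul_assoc, map_smul,
    liftAlternating_ιMulti_mul, smul_eq_mul, hterm, Finset.sum_sub_distrib]
  simp only [Finset.sum_ite_irrel, Finset.sum_const_zero, Finset.sum_ite_eq, Finset.mem_univ,
    if_true]
  rw [hswap (b l) (b k)]
  ring

/-- The linear map `c ↦ (w ↦ ν(c ∧ w))`. -/
def wedgePairing {n : ℕ} (ν : V [⋀^Fin n]→ₗ[ℝ] ℝ) (k l : ℕ) :
    ⋀[ℝ]^k V →ₗ[ℝ] Module.Dual ℝ (⋀[ℝ]^l V) :=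
  ((LinearMap.mul ℝ (ExteriorAlgebra ℝ V)).compr₂
    (ExteriorAlgebra.liftAlternating (R := ℝ) (Pi.single n ν))).compl₁₂
      (Submodule.subtype _) (Submodule.subtype _)

theorem wedgePairing_ιMulti {n : ℕ} (ν : V [⋀^Fin n]→ₗ[ℝ] ℝ) (k : ℕ) (c : ⋀[ℝ]^k V)
    (y : Fin 2 → V) : wedgePairing ν k 2 c (exteriorPower.ιMulti ℝ 2 y) =
      interiorForm ν (c : ExteriorAlgebra ℝ V) (y 0) (y 1) := by
  simp [wedgePairing, interiorForm, ExteriorAlgebra.ιMulti_apply, mul_assoc, Matrix.vecTail]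

/-- A multivector of degree `n - 2` is determined by its interior product with a volume form. -/
theorem interiorForm_injective {n : ℕ} (hm : m + 2 = n) (b : Module.Basis (Fin n) ℝ V)
    {ν : V [⋀^Fin n]→ₗ[ℝ] ℝ} (hν : ν b ≠ 0) {c c' : ⋀[ℝ]^m V}
    (h : interiorForm ν (c : ExteriorAlgebra ℝ V) = interiorForm ν (c' : ExteriorAlgebra ℝ V)) :
    c = c' := by
  have : Module.Finite ℝ V := Module.Finite.of_basis b
  have : Module.Free ℝ V := Module.Free.of_basis b
  have hr : Module.finrank ℝ V = n := by
    rw [Module.finrank_eq_card_basis b, Fintype.card_fin]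
  -- The dimensions agree by symmetry of binomial coefficients, so injectivity follows from
  -- surjectivity, which the explicit expansion provides.
  have hfr : Module.finrank ℝ (⋀[ℝ]^m V) = Module.finrank ℝ (Module.Dual ℝ (⋀[ℝ]^2 V)) := by
    rw [Subspace.dual_finrank_eq, exteriorPower.finrank_eq, exteriorPower.finrank_eq, hr, ← hm,
      Nat.choose_symm_add]
  have hsurj : Function.Surjective (wedgePairing ν m 2) := by
    intro φ
    obtain ⟨σ, s, hs⟩ := exists_interior_expansion.{u} hm
    let β : V →ₗ[ℝ] V →ₗ[ℝ] ℝ := LinearMap.mk₂ ℝ (fun y z ↦ φ (exteriorPower.ιMulti ℝ 2 ![y, z]))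
      (fun y y' z ↦ by
        rw [← map_add]
        exact congrArg φ (Subtype.ext (by simp [ExteriorAlgebra.ιMulti_apply, add_mul])))
      (fun a y z ↦ by
        rw [← map_smul]
        exact congrArg φ (Subtype.ext (by simp [ExteriorAlgebra.ιMulti_apply])))
      (fun y z z' ↦ by
        rw [← map_add]
        exact congrArg φ (Subtype.ext (by simp [ExteriorAlgebra.ιMulti_apply, mul_add])))
      (fun a y z ↦ by
        rw [← map_smul]
        exact congrArg φ (Subtype.ext (by simp [ExteriorAlgebra.ιMulti_apply])))
    have hβ (y : V) : β y y = 0 := by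
      have := (φ.compAlternatingMap (exteriorPower.ιMulti ℝ 2)).map_eq_zero_of_eq ![y, y]
        (i := 0) (j := 1) rfl (by simp)
      exact this
    refine ⟨∑ i, ∑ j, (s i j * β (b i) (b j) / ν b) • exteriorPower.ιMulti ℝ m
      (fun r ↦ b (σ i j r)), exteriorPower.linearMap_ext (AlternatingMap.ext fun y ↦ ?_)⟩
    rw [LinearMap.compAlternatingMap_apply, LinearMap.compAlternatingMap_apply,
      wedgePairing_ιMulti, hs V b ν hν β hβ]
    simp only [β, LinearMap.mk₂_apply]
    congr 2
  have hinj := (LinearMap.injective_iff_surjective_of_finrank_eq_finrank hfr).2 hsurj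
  refine hinj (exteriorPower.linearMap_ext (AlternatingMap.ext fun y ↦ ?_))
  rw [LinearMap.compAlternatingMap_apply, LinearMap.compAlternatingMap_apply,
    wedgePairing_ιMulti, wedgePairing_ιMulti, h]

end InteriorProduct

/-! ### Existence, uniqueness and smoothness of the curl -/

section Curl

set_option linter.unusedSectionVars false

open Set Topology

variable {n : ℕ} [NeZero n] {D : Type*} [TopologicalSpace D] [T2Space D]
  [ChartedSpace (EuclideanHalfSpace n) D] [IsManifold (𝓡∂ n) ∞ D]

theorem exists_local_frame (x₀ : D) :
    ∃ Y : Fin n → VField n D, (∀ j, SmoothVField (Y j)) ∧ ∀ᶠ x in 𝓝 x₀,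
      ∃ b : Module.Basis (Fin n) ℝ (TangentSpace (𝓡∂ n) x), ∀ j, b j = Y j x := by
  obtain ⟨Y, hY, he⟩ := exists_frame_probe (n := n) x₀
  refine ⟨Y, hY, ?_⟩
  filter_upwards [he, eventually_mem_baseSet (n := n) x₀] with x hx hb
  refine ⟨(EuclideanSpace.basisFun (Fin n) ℝ).toBasis.map
    ((trivializationAt (EuclideanSpace ℝ (Fin n)) (TangentSpace (𝓡∂ n) : D → Type _)
      x₀).continuousLinearEquivAt ℝ x hb).symm.toLinearEquiv, fun j ↦ ?_⟩
  rw [hx j, Module.Basis.map_apply, OrthonormalBasis.coe_toBasis]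
  exact (Bundle.Trivialization.symmL_apply _ hb _).symm

/-- The exterior derivative as a bilinear form. -/
def extDerivForm (u : CField n D) (x : D) :
    TangentSpace (𝓡∂ n) x →ₗ[ℝ] TangentSpace (𝓡∂ n) x →ₗ[ℝ] ℝ :=
  LinearMap.mk₂ ℝ (fun y z ↦ extDeriv₁ u x y z) (fun _ _ _ ↦ by simp) (fun _ _ _ ↦ by simp)
    (fun _ _ _ ↦ by simp) (fun _ _ _ ↦ by simp)

theorem extDerivForm_self {u : CField n D} (hu : SmoothCField u) (x : D)
    (y : TangentSpace (𝓡∂ n) x) : extDerivForm u x y y = 0 := by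
  obtain ⟨Y, hY, rfl⟩ := exists_smoothVField_apply y
  have h := extDeriv₁_apply hu (hY.mdiffAt x) (hY.mdiffAt x)
  rw [mlieBracket_self, Pi.zero_apply, map_zero, sub_self, sub_zero] at h
  exact h

theorem contMDiff_extDeriv₁ {u : CField n D} (hu : SmoothCField u) {Y Z : VField n D}
    (hY : SmoothVField Y) (hZ : SmoothVField Z) :
    ContMDiff (𝓡∂ n) 𝓘(ℝ, ℝ) ∞ (fun x ↦ extDeriv₁ u x (Y x) (Z x)) := by
  have e : (fun x ↦ extDeriv₁ u x (Y x) (Z x)) = _ :=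
    funext fun x ↦ extDeriv₁_apply hu (hY.mdiffAt x) (hZ.mdiffAt x)
  rw [e]
  exact ((contMDiff_mvfderiv_apply (hu.apply hZ) hY).sub
    (contMDiff_mvfderiv_apply (hu.apply hY) hZ)).sub (hu.apply (hY.mlieBracket hZ))

variable [Bundle.RiemannianBundle (fun x : D ↦ TangentSpace (𝓡∂ n) x)]

theorem IsVolumeForm.ne_zero {ν : TopForm n D} (hν : IsVolumeForm ν) (x : D) : ν x ≠ 0 := by
  have : FiniteDimensional ℝ (TangentSpace (𝓡∂ n) x) :=
    inferInstanceAs (FiniteDimensional ℝ (EuclideanSpace ℝ (Fin n)))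
  have hr : Module.finrank ℝ (TangentSpace (𝓡∂ n) x) = n :=
    finrank_euclideanSpace_fin (𝕜 := ℝ) (n := n)
  intro h
  have := hν.unit x ((stdOrthonormalBasis ℝ (TangentSpace (𝓡∂ n) x)).reindex (finCongr hr))
  rw [h] at this
  simp at this

variable [IsContMDiffRiemannianBundle (𝓡∂ n) ∞ (EuclideanSpace ℝ (Fin n))
      (fun x : D ↦ TangentSpace (𝓡∂ n) x)]

theorem isCurl_interior_iff {ν : TopForm n D} {v : VField n D}
    {x : D} {c : ⋀[ℝ]^(n - 2) (TangentSpace (𝓡∂ n) x)} :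
    (∀ y z : TangentSpace (𝓡∂ n) x,
      pair (ν x) ((c : ExteriorAlgebra ℝ (TangentSpace (𝓡∂ n) x)) * ExteriorAlgebra.ι ℝ y *
        ExteriorAlgebra.ι ℝ z) = extDeriv₁ (flat v) x y z) ↔
      interiorForm (ν x) (c : ExteriorAlgebra ℝ (TangentSpace (𝓡∂ n) x)) =
        extDerivForm (flat v) x :=
  ⟨fun h ↦ LinearMap.ext fun y ↦ LinearMap.ext fun z ↦ h y z,
    fun h y z ↦ congrArg (fun β : TangentSpace (𝓡∂ n) x →ₗ[ℝ] TangentSpace (𝓡∂ n) x →ₗ[ℝ] ℝ ↦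
      β y z) h⟩

/-- A multivector field whose interior product with the volume form is an exterior derivative is
smooth. -/
theorem smooth_of_interiorForm (hn : 2 ≤ n) {ν : TopForm n D} (hν : IsVolumeForm ν)
    {u : CField n D} (hu : SmoothCField u) {c : MultiVField n D (n - 2)}
    (hc : ∀ x, interiorForm (ν x) (c x : ExteriorAlgebra ℝ (TangentSpace (𝓡∂ n) x)) =
      extDerivForm u x) : SmoothMultiVField c := by
  have hm : n - 2 + 2 = n := Nat.sub_add_cancel hn
  -- The combinatorial data are chosen before the vector space and the basis, so a single expansion
  -- works at all points near `x₀`.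
  obtain ⟨σ, s, hs⟩ := exists_interior_expansion.{0} hm
  intro α hα x₀
  obtain ⟨Y, hY, hb⟩ := exists_local_frame (n := n) x₀
  have hν0 : ν x₀ (fun j ↦ Y j x₀) ≠ 0 := by
    obtain ⟨b, hb⟩ := hb.self_of_nhds
    rw [← funext hb]
    exact (AlternatingMap.map_basis_ne_zero_iff b (ν x₀)).2 (hν.ne_zero x₀)
  have hsm : ContMDiffAt (𝓡∂ n) 𝓘(ℝ, ℝ) ∞ (fun x ↦ ∑ i, ∑ j,
      (s i j * extDeriv₁ u x (Y i x) (Y j x) / ν x (fun j ↦ Y j x)) *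
        Matrix.det (Matrix.of fun k l ↦ α l x (Y (σ i j k) x))) x₀ := by
    refine contMDiffAt_finsetSum fun i _ ↦ contMDiffAt_finsetSum fun j _ ↦ ?_
    refine ContMDiffAt.mul (ContMDiffAt.div₀ (contMDiffAt_const.mul
      (contMDiff_extDeriv₁ hu (hY i) (hY j) x₀)) (hν.smooth Y hY x₀) hν0) ?_
    simp only [Matrix.det_apply']
    refine contMDiffAt_finsetSum fun τ _ ↦ contMDiffAt_const.mul
      (contMDiffAt_finsetProd fun k _ ↦ ?_)
    exact (hα k).apply (hY _) x₀
  refine hsm.congr_of_eventuallyEq ?_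
  filter_upwards [hb] with x ⟨b, hb⟩
  have hνb : ν x b ≠ 0 := (AlternatingMap.map_basis_ne_zero_iff b (ν x)).2 (hν.ne_zero x)
  -- By injectivity `c x` coincides with the expansion in the local frame, whose coefficients are
  -- smooth, however `c` was chosen.
  have e := interiorForm_injective hm b hνb
    ((hc x).trans (hs _ b (ν x) hνb (extDerivForm u x) (extDerivForm_self hu x)).symm)
  rw [e]
  simp only [map_sum, map_smul, exteriorPower.pairingDual_ιMulti_ιMulti, smul_eq_mul, hb,
    funext hb]
  rfl

/-- Existence and uniqueness are pointwise linear algebra. A pointwise choice is harmless because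
`smooth_of_interiorForm` makes any solution smooth. -/
theorem existsUnique_isCurl (hn : 2 ≤ n) {ν : TopForm n D} (hν : IsVolumeForm ν)
    {v : VField n D} (hv : SmoothVField v) :
    ∃! c : MultiVField n D (n - 2), IsCurl ν v c := by
  have hm : n - 2 + 2 = n := Nat.sub_add_cancel hn
  have hb (x : D) : ∃ b : Module.Basis (Fin n) ℝ (TangentSpace (𝓡∂ n) x), ν x b ≠ 0 := by
    obtain ⟨Y, -, hY⟩ := exists_local_frame (n := n) x
    obtain ⟨b, -⟩ := hY.self_of_nhds
    exact ⟨b, (AlternatingMap.map_basis_ne_zero_iff b (ν x)).2 (hν.ne_zero x)⟩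
  have hex (x : D) : ∃ c : ⋀[ℝ]^(n - 2) (TangentSpace (𝓡∂ n) x),
      interiorForm (ν x) (c : ExteriorAlgebra ℝ (TangentSpace (𝓡∂ n) x)) =
        extDerivForm (flat v) x := by
    obtain ⟨b, hb⟩ := hb x
    obtain ⟨σ, s, hs⟩ := exists_interior_expansion.{0} hm
    exact ⟨_, hs _ b (ν x) hb _ (extDerivForm_self hv.flat x)⟩
  choose c hc using hex
  refine ⟨c, ⟨smooth_of_interiorForm hn hν hv.flat hc, fun x ↦ isCurl_interior_iff.2 (hc x)⟩,
    fun c' hc' ↦ funext fun x ↦ ?_⟩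
  obtain ⟨b, hb⟩ := hb x
  exact interiorForm_injective hm b hb
    ((isCurl_interior_iff.1 (hc'.interior x)).trans (hc x).symm)

end Curl

end CraikLeibovich

/-! ### Assembly of the theorem -/

open CraikLeibovich in
theorem theorem5p1 {n : ℕ} [NeZero n] (hn : 2 ≤ n) {D : Type*} [TopologicalSpace D] [T2Space D]
    [SigmaCompactSpace D] [ChartedSpace (EuclideanHalfSpace n) D] [IsManifold (𝓡∂ n) ∞ D]
    [Bundle.RiemannianBundle (fun x : D ↦ TangentSpace (𝓡∂ n) x)]
    [IsContMDiffRiemannianBundle (𝓡∂ n) ∞ (EuclideanSpace ℝ (Fin n))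
      (fun x : D ↦ TangentSpace (𝓡∂ n) x)]
    (ν : TopForm n D) (hν : IsVolumeForm ν)
    (nabla : CovariantDerivative (𝓡∂ n) (EuclideanSpace ℝ (Fin n))
      (fun x : D ↦ TangentSpace (𝓡∂ n) x))
    (hnabla : IsLeviCivita nabla) :
    -- The averaged equation, on any `D`, for an arbitrary velocity expansion `v`.
    (∀ (u : ℕ → ℝ × ℝ → CField n D) (v : ℕ → ℝ × ℝ → VField n D),
      IsTwoTimingSolution ν u v →
        IsSVect ν (drift v) ∧
        IsSVectFamily ν (avgVelocity v) ∧
        IsSVectFamily ν (fun s ↦ avgVelocity v s + drift v) ∧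
        IsAdvected (fun s ↦ avgVelocity v s + drift v) (avgMomentum u) ∧
        (cls (avgMomentum u) = cls (fun s ↦ flat (avgVelocity v s)) →
          IsAdvected (fun s ↦ avgVelocity v s + drift v) (fun s ↦ flat (avgVelocity v s)))) ∧
    -- The averaged equation of the fluid with a free boundary, for a domain `D` in `ℝⁿ`:
    -- `μ = [w♭]`, and the velocity `v = w - a` with the connection term `a` of the boundary.
    (∀ (ι : D → EuclideanSpace ℝ (Fin n)) (η : ℕ → ℝ × ℝ → D → EuclideanSpace ℝ (Fin n))
      (w a : ℕ → ℝ × ℝ → VField n D),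
      IsEuclideanDomain ν ι → IsFreeBoundaryMotion ν η a → (∀ k, IsSVectFamily ν (w k)) →
      IsTwoTimingSolution ν (fun k p ↦ flat (w k p)) (fun k p ↦ w k p - a k p) →
      cls (avgMomentum fun k p ↦ flat (w k p)) =
        cls (fun s ↦ flat (avgVelocity (fun k p ↦ w k p - a k p) s)) →
      IsAdvected
        (fun s ↦ avgVelocity (fun k p ↦ w k p - a k p) s + drift (fun k p ↦ w k p - a k p))
        (fun s ↦ flat (avgVelocity (fun k p ↦ w k p - a k p) s))) ∧
    -- The equivalence with the Craik-Leibovich equation in terms of vector fields.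
    (∀ (v : ℝ → VField n D) (V₀ : VField n D), IsSVectFamily ν v → IsSVect ν V₀ →
      (∀ t, ∃! c : MultiVField n D (n - 2), IsCurl ν (v t) c) ∧
      ∀ c : ℝ → MultiVField n D (n - 2), (∀ t, IsCurl ν (v t) (c t)) →
        (IsAdvected (fun t ↦ v t + V₀) (fun t ↦ flat (v t)) ↔
          IsCLSolution ν nabla c v V₀)) := by
  exact ⟨fun u v h ↦ ⟨h.isSVect_drift hν, h.isSVectFamily_avgVelocity,
      h.isSVectFamily_add_drift hν, h.isAdvected hν, h.isAdvected_flat hν⟩,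
    -- The free-boundary fluid is the averaged equation for `u k = flat (w k)` and `v k = w k - a
    -- k`.
    fun ι η w a _ _ _ h hc ↦ h.isAdvected_flat hν hc,
    fun v V₀ hv hV ↦ ⟨fun t ↦ existsUnique_isCurl hn hν (hv.mem t).smooth,
      fun c hc ↦ isAdvected_flat_iff hnabla hv.smooth hV.smooth hc⟩⟩
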